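/- **Setting.** Let $(V,g)$ be an oriented Euclidean vector space of dimension $2n$ with unit volume element $\epsilon_g$, and $\nu:V\to V^*$, $x\mapsto g(x,\cdot)$. Let $\mathcal J_g\subset \mathrm{End}(V)$ be the space of complex structures on $V$ compatible with $g$ and with the orientation, with the Riemannian metric $\eta_g(A,B)=-\tfrac14\mathrm{tr}(AB)$. For $J\in\mathcal J_g$ let $V^{\mathbb C}=V_J^{1,0}\oplus V_J^{0,1}$ be the decomposition into the $\pm i$-eigenspaces of $J$, and $P_J=\frac12(1-iJ)$. * Let $\mathcal H_0=\bigwedge^\bullet(V^{\mathbb C})^*$ with the inner product $\langle\psi,\psi'\rangle_0=\int_{\Pi V}\bar\psi\wedge\star_0\psi'\,\epsilon_g$ (Berezin integral, $\star_0$ the Hodge star of $\frac12 g$; conjugate linear in the first variable), let $\nabla_x=\iota_x-\frac12\nu(x)\wedge\cdot$ for $x\in V$, extended complex linearly to $x\in V^{\mathbb C}$, and $\mathcal H_J=\{\psi\in\mathcal H_0:\nabla_x\psi=0\ \forall x\in V_J^{0,1}\}$. The bundle $\mathcal H\to\mathcal J_g$ has the connection obtained from the trivial connection on $\mathcal J_g\times\mathcal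 H_0$ by orthogonal projection. The Clifford algebra acts on $\mathcal H_J$ by $\hat\alpha=\iota_{\nu^{-1}\alpha}+\frac12\alpha\wedge\cdot$, $\alpha\in V^*$. * Let $\mathcal K^{-1}\to\mathcal J_g$ have fibres $\mathcal K_J^{-1}=\bigwedge^nV_J^{1,0}$ and the connection induced by the projections $P_J$ on the bundle with fibres $V_J^{1,0}$. For $\mu'\in\mathcal K_{J'}^{-1}$, $\mu\in\mathcal K_J^{-1}$, let $\langle\mu',\mu\rangle$ be $(-1)^{n(n+1)/2}$ times the ratio of $\bar\mu'\wedge\mu$ and $i^n\epsilon_g$, so that $\langle\mu,\mu\rangle>0$ if $\mu\neq0$. * Let $\sqrt{\mathcal K^{-1}}\to\mathcal J_g$ be a complex line bundle with an isomorphism $\sqrt{\mathcal K^{-1}}\otimes\sqrt{\mathcal K^{-1}}\cong\mathcal K^{-1}$, with the induced connection and the inner products given by $\langle\sqrt\mu,\sqrt\mu\rangle=\sqrt{\langle\mu,\mu\rangle}$. Let $\hat{\mathcal H}=\mathcal H\otimes\sqrt{\mathcal K^{-1}}$ with the tensor product connection and inner products. **Theorem.** Let $\gamma=\{J_t\}_{0\le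 t\le1}$ be a geodesic in $\mathcal J_g$, $t$ being proportional to arc-length, and assume that no $J_t$, $t\in[0,1]$, lies on the cut locus of $J_0$. Then $D:=\det\frac{J_0+J_1}{2}>0$; the parallel transports $U^{\mathcal H}$, $U^{\sqrt{\mathcal K^{-1}}}$, $U^{\hat{\mathcal H}}$ along $\gamma$ from the fibres over $J_0$ to those over $J_1$ exist and are unique; and the inner product of $\sqrt{\mathcal K_{J_0}^{-1}}$ extends uniquely and continuously along $\gamma$ to pairings between $\sqrt{\mathcal K_{J_t}^{-1}}$ and $\sqrt{\mathcal K_{J_0}^{-1}}$ that square to the pairings between $\mathcal K_{J_t}^{-1}$ and $\mathcal K_{J_0}^{-1}$. Moreover: 1. $U^{\mathcal H}=D^{-1/4}P_{J_1J_0}$, where $P_{J_1J_0}:\mathcal H_{J_0}\to\mathcal H_{J_1}$ is the orthogonal projection in $\mathcal H_0$. This map is a Bogoliubov transformation: it is unitary and intertwines the actions of the Clifford algebra. 2. $U^{\sqrt{\mathcal K^{-1}}}=\sqrt{\det\big(J_{1/2}/i\,\big|_{V_{J_0}^{1,0}}\big)}$: it is the value at $t=1$ of a continuous family of maps $R_t:\sqrt{\mathcal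 K_{J_0}^{-1}}\to\sqrt{\mathcal K_{J_t}^{-1}}$ with $R_0=\mathrm{id}$ and $R_t\otimes R_t=\bigwedge^n\big(J_{t/2}/i\big):\mathcal K_{J_0}^{-1}\to\mathcal K_{J_t}^{-1}$. Furthermore $$\big\langle U^{\sqrt{\mathcal K^{-1}}}\sqrt{\mu_0'},\sqrt{\mu_0}\big\rangle=D^{1/4}\big\langle\sqrt{\mu_0'},\sqrt{\mu_0}\big\rangle\qquad\text{for all }\mu_0,\mu_0'\in\textstyle\bigwedge^nV_{J_0}^{1,0}.$$ 3. $U^{\hat{\mathcal H}}=U^{\mathcal H}\otimes U^{\sqrt{\mathcal K^{-1}}}$, and it corresponds to the product pairing between $\hat{\mathcal H}_{J_1}$ and $\hat{\mathcal H}_{J_0}$ given by $$\langle\psi_1\otimes\sqrt{\mu_1},\psi_0\otimes\sqrt{\mu_0}\rangle=\langle\psi_1,\psi_0\rangle_0\,\langle\sqrt{\mu_1},\sqrt{\mu_0}\rangle$$ in the following sense: $\langle\Psi_1,\Psi_0\rangle=D^{1/2}\,\langle\Psi_1,U^{\hat{\mathcal H}}\Psi_0\rangle_{\hat{\mathcal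 H}_{J_1}}$ for all $\Psi_1\in\hat{\mathcal H}_{J_1}$, $\Psi_0\in\hat{\mathcal H}_{J_0}$, i.e. $U^{\hat{\mathcal H}}$ is the operator defined by the product pairing, up to the positive scalar $D^{1/2}$; and the powers of $D$ in 1 and 2 cancel in the sense that $$\big\langle U^{\hat{\mathcal H}}(\psi_0'\otimes\sqrt{\mu_0'}),\psi_0\otimes\sqrt{\mu_0}\big\rangle=\langle P_{J_1J_0}\psi_0',\psi_0\rangle_0\,\langle\sqrt{\mu_0'},\sqrt{\mu_0}\rangle .$$ -/

import Mathlib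

open Set Module
open scoped TensorProduct

noncomputable section

namespace FermionQuant

/-! ### Complexified exterior algebras -/

section Exterior

variable (W : Type*) [AddCommGroup W] [Module ℝ W]

/-- The complexification `W^ℂ = ℂ ⊗ W`. -/
abbrev Cplx : Type _ := ℂ ⊗[ℝ] W

/-- The complexified exterior algebra `⋀^•(W^ℂ) = ℂ ⊗ ⋀^• W`; the wedge product is `*`. -/
abbrev CExt : Type _ := ℂ ⊗[ℝ] ExteriorAlgebra ℝ W

variable {W}

/-- The inclusion `W^ℂ → ⋀^•(W^ℂ)` in degree one. -/
def ιC : Cplx W →ₗ[ℂ] CExt W := (ExteriorAlgebra.ι ℝ).baseChange ℂ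

/-- The standard complex conjugation on `⋀^•(W^ℂ)`. -/
def conj : CExt W →ₐ[ℝ] CExt W :=
  Algebra.TensorProduct.map Complex.conjAe.toAlgHom (AlgHom.id ℝ (ExteriorAlgebra ℝ W))

theorem ιC_anticomm (v w : Cplx W) : ιC v * ιC w + ιC w * ιC v = 0 := by
  induction v using TensorProduct.induction_on with
  | zero => simp
  | add a b ha hb =>
    rw [map_add, add_mul, mul_add, add_add_add_comm, ha, hb, add_zero]
  | tmul z x =>
    induction w using TensorProduct.induction_on with
    | zero => simp
    | add a b ha hb =>
      rw [map_add, add_mul, mul_add, add_add_add_comm, ha, hb, add_zero]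
    | tmul z' y =>
      simp only [ιC, LinearMap.baseChange_tmul, Algebra.TensorProduct.tmul_mul_tmul]
      rw [mul_comm z' z, ← TensorProduct.tmul_add, ExteriorAlgebra.ι_add_mul_swap,
        TensorProduct.tmul_zero]

theorem ιC_sq (v : Cplx W) : ιC v * ιC v = 0 := by
  have h := ιC_anticomm v v
  rw [← two_smul ℂ] at h
  exact (smul_eq_zero.mp h).resolve_left two_ne_zero

/-- The algebra endomorphism `⋀^• f` of `⋀^•(W^ℂ)` induced by a complex-linear endomorphism
`f` of `W^ℂ`. -/
def extMap (f : Cplx W →ₗ[ℂ] Cplx W) : CExt W →ₐ[ℂ] CExt W :=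
  Algebra.TensorProduct.lift (Algebra.ofId ℂ (CExt W))
    (ExteriorAlgebra.lift ℝ
      ⟨((ιC ∘ₗ f).restrictScalars ℝ) ∘ₗ TensorProduct.mk ℝ ℂ W 1,
        fun x => ιC_sq (f (1 ⊗ₜ[ℝ] x))⟩)
    (fun z _ => Algebra.commutes z _)

end Exterior

/-- Derivative within `s` of a curve in a finite-dimensional complex vector space,
tested on linear functionals (that is, on coordinates). -/
def HasVecDerivWithinAt {E : Type*} [AddCommGroup E] [Module ℂ E]
    (f : ℝ → E) (f' : E) (s : Set ℝ) (t : ℝ) : Prop :=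
  ∀ l : Module.Dual ℂ E, HasDerivWithinAt (fun r => l (f r)) (l f') s t

section Euclidean

variable {V : Type*} [NormedAddCommGroup V] [InnerProductSpace ℝ V] [FiniteDimensional ℝ V]

/-! ### The pre-quantum Hilbert space -/

variable (V) in
/-- The pre-quantum space `H₀ = ⋀^•(V^ℂ)^*`, the "functions" on `ΠV`. -/
abbrev H₀ : Type _ := CExt (Module.Dual ℝ V)

theorem nondegenerate_inner (E : Type*) [NormedAddCommGroup E] [InnerProductSpace ℝ E] :
    LinearMap.BilinForm.Nondegenerate (innerₗ E) := by
  constructor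
  · intro x hx
    have h := hx x
    rw [innerₗ_apply_apply] at h
    exact inner_self_eq_zero.mp h
  · intro x hx
    have h := hx x
    rw [innerₗ_apply_apply] at h
    exact inner_self_eq_zero.mp h

variable (V) in
/-- The isomorphism `ν : V → V^*`, `x ↦ g(x, ·)`. -/
def flat : V ≃ₗ[ℝ] Module.Dual ℝ V :=
  LinearMap.BilinForm.toDual (innerₗ V) (nondegenerate_inner V)

/-- Contraction `ι_x` on `⋀^• V^*`. -/
def contractR : V →ₗ[ℝ] ExteriorAlgebra ℝ (Module.Dual ℝ V) →ₗ[ℝ]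
    ExteriorAlgebra ℝ (Module.Dual ℝ V) :=
  CliffordAlgebra.contractLeft ∘ₗ Module.Dual.eval ℝ V

/-- Contraction `ι_x` on `H₀`. -/
def contract : V →ₗ[ℝ] H₀ V →ₗ[ℂ] H₀ V :=
  LinearMap.baseChangeHom ℝ ℂ _ _ ∘ₗ contractR

/-- Exterior multiplication `α ∧ ·` on `H₀`. -/
def wedge : Module.Dual ℝ V →ₗ[ℝ] H₀ V →ₗ[ℂ] H₀ V :=
  ((LinearMap.mul ℂ (H₀ V)).restrictScalars ℝ) ∘ₗ
    TensorProduct.mk ℝ ℂ (ExteriorAlgebra ℝ (Module.Dual ℝ V)) 1 ∘ₗ ExteriorAlgebra.ι ℝ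

/-- The covariant derivative `∇_x = ι_x - ½ ν(x) ∧ ·`, for `x ∈ V`. -/
def covDeriv : V →ₗ[ℝ] H₀ V →ₗ[ℂ] H₀ V :=
  contract - (1 / 2 : ℝ) • (wedge ∘ₗ (flat V).toLinearMap)

/-- The covariant derivative `∇_x` for `x ∈ V^ℂ`, complex linear in `x`. -/
def covDerivC : Cplx V →ₗ[ℂ] H₀ V →ₗ[ℂ] H₀ V := covDeriv.liftBaseChange ℂ

/-- The pre-quantum operator `α̂ = ι_{ν⁻¹ α} + ½ α ∧ ·` of the linear observable `α`. -/
def prequantum : Module.Dual ℝ V →ₗ[ℝ] H₀ V →ₗ[ℂ] H₀ V :=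
  contract ∘ₗ (flat V).symm.toLinearMap + (1 / 2 : ℝ) • wedge

section Hermitian

variable {n : ℕ} [Fact (finrank ℝ V = 2 * n)] (o : Orientation ℝ V (Fin (2 * n)))

/-- The alternating forms family that is `a` in degree `N` and `0` in all other degrees. -/
def onlyDegree {W : Type*} [AddCommGroup W] [Module ℝ W] {N : ℕ} (a : W [⋀^Fin N]→ₗ[ℝ] ℝ) :
    ∀ i : ℕ, W [⋀^Fin i]→ₗ[ℝ] ℝ :=
  fun i => if h : i = N then a.domDomCongr (finCongr h.symm) else 0

/-- The Berezin integral `∫_{ΠV} α ε_g`: the pairing of the top-degree component of the form `α`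
with the unit volume element `ε_g`, i.e.
`α₁ ∧ ⋯ ∧ α₂ₙ ↦ ⟨α₁ ∧ ⋯ ∧ α₂ₙ, ε_g⟩ = vol(ν⁻¹ α₁, …, ν⁻¹ α₂ₙ)`. -/
def berezinR : ExteriorAlgebra ℝ (Module.Dual ℝ V) →ₗ[ℝ] ℝ :=
  ExteriorAlgebra.liftAlternating
    (onlyDegree (o.volumeForm.compLinearMap (flat V).symm.toLinearMap))

/-- The Berezin integral of complex forms. -/
def berezin : H₀ V →ₗ[ℂ] ℂ :=
  LinearMap.liftBaseChange ℂ (Complex.ofRealCLM.toLinearMap ∘ₗ berezinR o)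

/-- The Riemannian volume form of `g`, as an element of `⋀^{2n} V^*`: the form
`vol(b₁, …, b₂ₙ) b¹ ∧ ⋯ ∧ b²ⁿ`, where `b` is any orthonormal basis. -/
def volForm : ExteriorAlgebra ℝ (Module.Dual ℝ V) :=
  let b : OrthonormalBasis (Fin (2 * n)) ℝ V :=
    (stdOrthonormalBasis ℝ V).reindex (finCongr Fact.out)
  o.volumeForm b • ExteriorAlgebra.ιMulti ℝ (2 * n) (fun i => flat V (b i))

/-- The Hodge star of the metric `c g` (`c > 0`): the linear map characterised by
`α ∧ ⋆β = ⟨α, β⟩ vol`, that is,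
`⋆(β₁ ∧ ⋯ ∧ β_p) = ι_{β_p^♯} ⋯ ι_{β₁^♯} vol`, where for the metric `c g` one has
`β^♯ = c⁻¹ ν⁻¹(β)` and `vol = c ^ n vol_g` (as `dim V = 2n`). -/
def hodgeR (c : ℝ) : ExteriorAlgebra ℝ (Module.Dual ℝ V) →ₗ[ℝ]
    ExteriorAlgebra ℝ (Module.Dual ℝ V) :=
  (LinearMap.applyₗ (c ^ n • volForm o)) ∘ₗ
    ((MulOpposite.opLinearEquiv ℝ).symm.toLinearMap :
      (Module.End ℝ (ExteriorAlgebra ℝ (Module.Dual ℝ V)))ᵐᵒᵖ →ₗ[ℝ]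
        Module.End ℝ (ExteriorAlgebra ℝ (Module.Dual ℝ V))) ∘ₗ
      (ExteriorAlgebra.lift ℝ
        ⟨((MulOpposite.opLinearEquiv ℝ).toLinearMap :
            Module.End ℝ (ExteriorAlgebra ℝ (Module.Dual ℝ V)) →ₗ[ℝ]
              (Module.End ℝ (ExteriorAlgebra ℝ (Module.Dual ℝ V)))ᵐᵒᵖ) ∘ₗ
            contractR ∘ₗ (c⁻¹ • (flat V).symm.toLinearMap),
          fun β => by
            apply MulOpposite.unop_injective
            refine LinearMap.ext fun ω => ?_
            exact CliffordAlgebra.contractLeft_contractLeft (Q := (0 : QuadraticForm ℝ (Module.Dual ℝ V)))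
              (Module.Dual.eval ℝ V (c⁻¹ • (flat V).symm β)) ω⟩).toLinearMap

/-- The Hodge star `⋆₀` of the metric `½ g`, on complex forms. -/
def hodge₀ : H₀ V →ₗ[ℂ] H₀ V := (hodgeR o (1 / 2)).baseChange ℂ

/-- The Hermitian form `⟨ψ, ψ'⟩₀ = ∫_{ΠV} ψ̄ ∧ ⋆₀ ψ' ε_g` on `H₀`
(conjugate linear in the first variable). -/
def herm₀ (ψ ψ' : H₀ V) : ℂ := berezin o (conj ψ * hodge₀ o ψ')

end Hermitian

/-! ### The space of polarisations and its geodesics -/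

section Polarisations

variable {n : ℕ} (o : Orientation ℝ V (Fin (2 * n)))

/-- The space `J_g` of complex structures compatible with the metric and the orientation, as a
subset of `End V`. A complex structure `J` is compatible with the orientation `o` if the bases
of the form `x₁, J x₁, …, xₙ, J xₙ` are positively oriented. -/
def polarisations : Set (V →L[ℝ] V) :=
  {J | (∀ x, J (J x) = -x) ∧ (∀ x y, inner ℝ (J x) (J y) = inner ℝ x y) ∧
    ∃ b : Basis (Fin (2 * n)) ℝ V,
      (∀ k : Fin n, b ⟨2 * k + 1, by omega⟩ = J (b ⟨2 * k, by omega⟩)) ∧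
      b.orientation = o}

/-- The type of points of `J_g`, a topological subspace of `End V`. -/
abbrev Jg : Type _ := polarisations o

variable {o}

/-- The tangent space of `J_g` at `J`: skew-symmetric operators anticommuting with `J`. -/
def tangent (J : Jg o) : Set (V →L[ℝ] V) :=
  {A | (∀ x, A (J.1 x) + J.1 (A x) = 0) ∧ ∀ x y, inner ℝ (A x) y = -inner ℝ x (A y)}

/-- The Riemannian metric of `J_g`, `η(A, B) = -¼ tr(A B)` for tangent vectors `A`, `B`; on
skew-symmetric operators it is `¼ tr(Aᵀ B)`, the restriction of a Euclidean inner product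
of `End V`. -/
def eta (A B : V →L[ℝ] V) : ℝ :=
  -(1 / 4) * LinearMap.trace ℝ V ((A : V →ₗ[ℝ] V) ∘ₗ (B : V →ₗ[ℝ] V))

/-- `γ` restricted to the interval `s` is a geodesic of `J_g` (parametrised proportionally to
arc-length): its acceleration in `End V` is everywhere orthogonal to `J_g`, i.e. the
Levi-Civita derivative of its velocity vanishes. -/
def IsGeodesicOn (γ : ℝ → Jg o) (s : Set ℝ) : Prop :=
  ∃ γ' γ'' : ℝ → (V →L[ℝ] V), ∀ t ∈ s,
    HasDerivWithinAt (fun r => (γ r).1) (γ' t) s t ∧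
    HasDerivWithinAt γ' (γ'' t) s t ∧
    ∀ A ∈ tangent (γ t), eta (γ'' t) A = 0

/-- The length of the curve `γ` between the parameters `a` and `b`. -/
def curveLength (γ : ℝ → Jg o) (a b : ℝ) : ℝ :=
  ∫ t in a..b, √(eta (derivWithin (fun r => (γ r).1) (Icc a b) t)
    (derivWithin (fun r => (γ r).1) (Icc a b) t))

/-- `γ` restricted to `[0, T]` minimises the length among the `C¹` curves in `J_g` with the same
endpoints. -/
def IsMinimising (γ : ℝ → Jg o) (T : ℝ) : Prop :=
  ∀ c : ℝ → Jg o, ContDiffOn ℝ 1 (fun r => (c r).1) (Icc 0 1) → c 0 = γ 0 → c 1 = γ T →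
    curveLength γ 0 T ≤ curveLength c 0 1

/-- The cut locus of `J₀`: the points `γ(T)`, `T > 0`, on geodesics `γ` from `J₀` that are
length-minimising from `J₀` up to `γ(T)` but not beyond. -/
def cutLocus (J₀ : Jg o) : Set (Jg o) :=
  {J | ∃ (γ : ℝ → Jg o) (T : ℝ), 0 < T ∧ IsGeodesicOn γ (Ici 0) ∧ γ 0 = J₀ ∧ γ T = J ∧
    IsMinimising γ T ∧ ∀ t, T < t → ¬ IsMinimising γ t}

/-- `J` as a complex linear operator on `V^ℂ`. -/
def JC (J : Jg o) : Cplx V →ₗ[ℂ] Cplx V := (J.1 : V →ₗ[ℝ] V).baseChange ℂ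

/-- The holomorphic subspace `V_J^{1,0}` of `V^ℂ`. -/
def V10 (J : Jg o) : Submodule ℂ (Cplx V) := Module.End.eigenspace (JC J) Complex.I

/-- The anti-holomorphic subspace `V_J^{0,1}` of `V^ℂ`. -/
def V01 (J : Jg o) : Submodule ℂ (Cplx V) := Module.End.eigenspace (JC J) (-Complex.I)

/-- The projection `P_J = ½(1 - iJ)` of `V^ℂ` onto `V_J^{1,0}` along `V_J^{0,1}`. -/
def projV (J : Jg o) : Cplx V →ₗ[ℂ] Cplx V :=
  (1 / 2 : ℂ) • (LinearMap.id - Complex.I • JC J)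

/-! ### The bundle of quantum Hilbert spaces -/

/-- The quantum Hilbert space `H_J = {ψ ∈ H₀ | ∇_x ψ = 0 for all x ∈ V_J^{0,1}}`. -/
def HJ (J : Jg o) : Submodule ℂ (H₀ V) := ⨅ x ∈ V01 J, LinearMap.ker (covDerivC x)

/-- The determinant of `(J₀ + J₁)/2` on `V`. -/
def detMean (J₀ J₁ : Jg o) : ℝ :=
  LinearMap.det ((1 / 2 : ℝ) • ((J₀.1 : V →ₗ[ℝ] V) + (J₁.1 : V →ₗ[ℝ] V)))

variable [Fact (finrank ℝ V = 2 * n)]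

/-- `P : H_{J₀} → H_{J₁}` is the (restricted) orthogonal projection in `H₀` onto `H_{J₁}`. -/
def IsOrthProj {J₀ J₁ : Jg o} (P : HJ J₀ →ₗ[ℂ] HJ J₁) : Prop :=
  ∀ (ψ : HJ J₀) (χ : HJ J₁), herm₀ o (χ : H₀ V) ((ψ : H₀ V) - (P ψ : H₀ V)) = 0

/-- A section `ψ` of `H` along `γ|_[0,1]` is parallel for the connection obtained by orthogonal
projection from the trivial connection of `J_g × H₀`. -/
def IsParallelH (γ : ℝ → Jg o) (ψ : ∀ t, HJ (γ t)) : Prop :=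
  ∀ t ∈ Icc (0 : ℝ) 1, ∃ ψ' : H₀ V,
    HasVecDerivWithinAt (fun r => (ψ r : H₀ V)) ψ' (Icc 0 1) t ∧
    ∀ χ : HJ (γ t), herm₀ o (χ : H₀ V) ψ' = 0

/-- `U` is the parallel transport in `H` along `γ|_[0,1]`. -/
def IsTransportH (γ : ℝ → Jg o) (U : HJ (γ 0) →ₗ[ℂ] HJ (γ 1)) : Prop :=
  ∀ ψ₀ : HJ (γ 0), ∃ ψ : ∀ t, HJ (γ t), IsParallelH γ ψ ∧ ψ 0 = ψ₀ ∧ ψ 1 = U ψ₀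

/-- `U : H_{J₀} → H_{J₁}` is a Bogoliubov transformation: a unitary isomorphism
intertwining the two representations of the Clifford algebra. -/
def IsBogoliubov {J₀ J₁ : Jg o} (U : HJ J₀ →ₗ[ℂ] HJ J₁) : Prop :=
  Function.Bijective U ∧
  (∀ ψ ψ' : HJ J₀, herm₀ o (U ψ : H₀ V) (U ψ' : H₀ V) = herm₀ o (ψ : H₀ V) (ψ' : H₀ V)) ∧
  ∀ (α : Module.Dual ℝ V) (ψ : HJ J₀), ∃ φ : HJ J₀,
    (φ : H₀ V) = prequantum α (ψ : H₀ V) ∧ (U φ : H₀ V) = prequantum α (U ψ : H₀ V)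

/-! ### The line bundle `K⁻¹ = det 𝒱` -/

/-- The fibre `K_J⁻¹ = ⋀^n V_J^{1,0}`, as a subspace of `⋀^•(V^ℂ)`: the span of the products of
`n` elements of `V_J^{1,0}`. -/
def Kinv (J : Jg o) : Submodule ℂ (CExt V) := (V10 J).map ιC ^ n

/-- A section `μ` of `K⁻¹` along `γ|_[0,1]` is parallel for the connection of
`K⁻¹ = ⋀^n 𝒱` induced by the connection of `𝒱 ⊆ J_g × V^ℂ` defined by the projections
`P_J : V^ℂ → V_J^{1,0}`. -/
def IsParallelK (γ : ℝ → Jg o) (μ : ∀ t, Kinv (γ t)) : Prop :=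
  ∀ t ∈ Icc (0 : ℝ) 1, ∃ μ' : CExt V,
    HasVecDerivWithinAt (fun r => (μ r : CExt V)) μ' (Icc 0 1) t ∧
    extMap (projV (γ t)) μ' = 0

variable (o) in
/-- The coefficient of the top-degree component of an element of `⋀^•(V^ℂ)` with respect to the
unit volume element `ε_g ∈ ⋀^{2n} V`. -/
def topCoeff : CExt V →ₗ[ℂ] ℂ :=
  LinearMap.liftBaseChange ℂ
    (Complex.ofRealCLM.toLinearMap ∘ₗ ExteriorAlgebra.liftAlternating (onlyDegree o.volumeForm))

variable (o) in
/-- The pairing `⟨μ', μ⟩` of `K_{J'}⁻¹` and `K_J⁻¹`: the ratio of `μ̄' ∧ μ` and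
`ε̃_g = i^n ε_g`, with the overall sign `(-1)^{n(n+1)/2}` that makes `⟨μ, μ⟩ > 0` for
`0 ≠ μ ∈ K_J⁻¹`. -/
def pairK (μ' μ : CExt V) : ℂ :=
  (-1) ^ (n * (n + 1) / 2) * (topCoeff o (conj μ' * μ) / Complex.I ^ n)

/-! ### The line bundle `√K⁻¹` of half-forms -/

section HalfForms

variable (L : Jg o → Type*) [∀ J, AddCommGroup (L J)] [∀ J, Module ℂ (L J)]
  [∀ J, TopologicalSpace (L J)] [TopologicalSpace (Bundle.TotalSpace ℂ L)]

/-- An isomorphism of complex line bundles `L ⊗ L ≅ K⁻¹` over `J_g`, exhibiting `L` as the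
square root `√K⁻¹`. The element `s ∈ L_J` is "`√μ`" for `μ = s ⊗ s`. -/
structure SquareRoot where
  /-- the isomorphism on the fibres -/
  sq : ∀ J : Jg o, (L J ⊗[ℂ] L J) ≃ₗ[ℂ] Kinv J
  /-- continuity of `s ↦ s ⊗ s` as a map from the total space of `L` to that of
  `K⁻¹ ⊆ J_g × ⋀^n V^ℂ`, tested on coordinates -/
  continuous_sq : ∀ l : Module.Dual ℂ (CExt V),
    Continuous fun p : Bundle.TotalSpace ℂ L => l (sq p.proj (p.snd ⊗ₜ[ℂ] p.snd) : CExt V)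

variable {L}

namespace SquareRoot

variable (S : SquareRoot L)

/-- The product `s s' ∈ K_J⁻¹` of two half-forms. -/
def mul {J : Jg o} (s s' : L J) : CExt V := S.sq J (s ⊗ₜ[ℂ] s')

/-- The inner product of the line `L_J`. It is the Hermitian form with `⟨√μ, √μ⟩ = √⟨μ, μ⟩`:
if `s = c s'` with `s' ≠ 0` then
`⟨s', s⟩ = c √⟨s' s', s' s'⟩ = ⟨s' s', s' s⟩ / √⟨s' s', s' s'⟩`. -/
def inner {J : Jg o} (s' s : L J) : ℂ :=
  pairK o (S.mul s' s') (S.mul s' s) / (√(pairK o (S.mul s' s') (S.mul s' s')).re : ℝ)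

/-- A section `s` of `L` along `γ|_[0,1]` is parallel for the connection of `L` induced by that
of `K⁻¹ ≅ L ⊗ L` : it is continuous and `s ⊗ s` is parallel. -/
def IsParallel (γ : ℝ → Jg o) (s : ∀ t, L (γ t)) : Prop :=
  ContinuousOn (fun t => (⟨γ t, s t⟩ : Bundle.TotalSpace ℂ L)) (Icc 0 1) ∧
  IsParallelK γ (fun t => S.sq (γ t) (s t ⊗ₜ[ℂ] s t))

/-- `U` is the parallel transport in `L` along `γ|_[0,1]`. -/
def IsTransport (γ : ℝ → Jg o) (U : L (γ 0) →ₗ[ℂ] L (γ 1)) : Prop :=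
  ∀ s₀ : L (γ 0), ∃ s : ∀ t, L (γ t), S.IsParallel γ s ∧ s 0 = s₀ ∧ s 1 = U s₀

/-- `U` is the square root of `det(J_{1/2}/i|_{V_{J₀}^{1,0}}) : K_{J₀}⁻¹ → K_{J₁}⁻¹` along
`γ`: the value at `t = 1` of the family `R_t : L_{J₀} → L_{J_t}`, continuous in `t ∈ [0,1]`,
with `R_0 = id` and `R_t ⊗ R_t = det(J_{t/2}/i|_{V_{J₀}^{1,0}}) = ⋀^n (J_{t/2}/i)`. -/
def IsSqrtDet (γ : ℝ → Jg o) (U : L (γ 0) →ₗ[ℂ] L (γ 1)) : Prop :=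
  ∃ R : ∀ t : ℝ, L (γ 0) →ₗ[ℂ] L (γ t),
    R 0 = LinearMap.id ∧ R 1 = U ∧
    (∀ s, ContinuousOn (fun t => (⟨γ t, R t s⟩ : Bundle.TotalSpace ℂ L)) (Icc 0 1)) ∧
    ∀ t ∈ Icc (0 : ℝ) 1, ∀ s s' : L (γ 0),
      S.mul (R t s) (R t s') = extMap (Complex.I⁻¹ • JC (γ (t / 2))) (S.mul s s')

/-- `h` is the continuous extension along `γ|_[0,1]` of the inner product of `L_{J₀}` to a
pairing between `L_{J_t}` and `L_{J₀}` (conjugate linear in the first variable) that is a square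
root of the pairing between `K_{J_t}⁻¹` and `K_{J₀}⁻¹`. -/
def IsPairing (γ : ℝ → Jg o) (h : ∀ t : ℝ, L (γ t) →ₗ⋆[ℂ] L (γ 0) →ₗ[ℂ] ℂ) : Prop :=
  (∀ s' s, h 0 s' s = S.inner s' s) ∧
  (∀ t ∈ Icc (0 : ℝ) 1, ∀ s' s, h t s' s ^ 2 = pairK o (S.mul s' s') (S.mul s s)) ∧
  ∀ s : ∀ t, L (γ t),
    ContinuousOn (fun t => (⟨γ t, s t⟩ : Bundle.TotalSpace ℂ L)) (Icc 0 1) →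
    ∀ s₀ : L (γ 0), ContinuousOn (fun t => h t (s t) s₀) (Icc 0 1)

/-! ### The metaplectically corrected bundle `Ĥ = H ⊗ √K⁻¹` -/

/-- A section of `Ĥ = H ⊗ L` along `γ|_[0,1]` is parallel for the tensor product connection: it
is a sum of tensor products of parallel sections of `H` and of `L`. -/
def IsParallelHat (γ : ℝ → Jg o) (Ψ : ∀ t, HJ (γ t) ⊗[ℂ] L (γ t)) : Prop :=
  ∃ (m : ℕ) (ψ : Fin m → ∀ t, HJ (γ t)) (s : Fin m → ∀ t, L (γ t)),
    (∀ k, IsParallelH γ (ψ k)) ∧ (∀ k, S.IsParallel γ (s k)) ∧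
    ∀ t ∈ Icc (0 : ℝ) 1, Ψ t = ∑ k, ψ k t ⊗ₜ[ℂ] s k t

/-- `U` is the parallel transport in `Ĥ = H ⊗ L` along `γ|_[0,1]`. -/
def IsTransportHat (γ : ℝ → Jg o)
    (U : (HJ (γ 0) ⊗[ℂ] L (γ 0)) →ₗ[ℂ] (HJ (γ 1) ⊗[ℂ] L (γ 1))) : Prop :=
  ∀ Ψ₀, ∃ Ψ : ∀ t, HJ (γ t) ⊗[ℂ] L (γ t), S.IsParallelHat γ Ψ ∧ Ψ 0 = Ψ₀ ∧ Ψ 1 = U Ψ₀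

end SquareRoot

/-- `F` is the sesquilinear pairing between `Ĥ_{J'}` and `Ĥ_J` given by
`⟨ψ' ⊗ s', ψ ⊗ s⟩ = ⟨ψ', ψ⟩₀ k(s', s)`. -/
def IsProductPairing {J' J : Jg o} (k : L J' → L J → ℂ)
    (F : (HJ J' ⊗[ℂ] L J') →ₗ⋆[ℂ] (HJ J ⊗[ℂ] L J) →ₗ[ℂ] ℂ) : Prop :=
  ∀ (ψ' : HJ J') (s' : L J') (ψ : HJ J) (s : L J),
    F (ψ' ⊗ₜ[ℂ] s') (ψ ⊗ₜ[ℂ] s) = herm₀ o (ψ' : H₀ V) (ψ : H₀ V) * k s' s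

end HalfForms

end Polarisations

end Euclidean

end FermionQuant

end

open FermionQuant

noncomputable section

set_option linter.unusedSectionVars false

namespace FermionQuant

/-! ### The real exterior algebra: contractions, Berezin integral and Hodge star -/

section ExteriorReal

variable {W : Type*} [AddCommGroup W] [Module ℝ W]

open CliffordAlgebra (involute contractLeft)

/-! A geodesic from `J₀` has the form `J_t = exp(tA) J₀` with `A` skew and anticommuting with `J₀`
(`exists_rot_of_isGeodesicOn`), so `J_t` is `J₀` conjugated by `exp(tA/2)`. The symmetric operator
`A²` commutes with `J₀`, and a unitary basis diagonalises it with eigenvalues `-θ_k²`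
(`nonempty_eigenbasis`). Everything then reduces to trigonometry: `(J₀ + J_t)/2` has determinant `(∏
cos(tθ_k/2))²` (`Eigenbasis.detMean_eq`). The geodesic minimises length until `t θ_max = π` and not
beyond, so avoiding the cut locus means `θ_k < π` (`Eigenbasis.θ_lt_pi`), and all these cosines are
positive on `[0,1]`.

In `H` the transport is the flow of `Q = ¼ ∑ ∇_{e_j} ∇_{A e_j}`. This operator is skew-Hermitian,
commutes with the Clifford action, and satisfies `[Q, ∇_x] = ½ ∇_{Ax}`; hence its flow is unitary,
Clifford-equivariant, and carries `H_{J₀}` onto `H_{J_t}`. The matrix elements of `Q` between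
`H_{J₀}` and `H_{J_t}` are `-¼ ∑ θ_k tan(tθ_k/2)` times the inner product
(`hermL_covDeriv_covDeriv`, `hermL_quadOp_HJ`). At coinciding points they vanish, so the flow is
parallel. For general `t` the factor is the logarithmic derivative of `√(∏ cos(tθ_k/2))`, so `⟨χ,
Uψ⟩ = D^{1/4} ⟨χ, ψ⟩` on `H_{J₀}`; by unitarity the orthogonal projection is `D^{1/4} U`.

In `K⁻¹` the transport is `⋀^n exp(tA/2)`, because the velocity `½ A exp(tA/2) v` is of type `(0,1)`
(`hasVecDerivWithinAt_extMap_rot`); on `V_{J₀}^{1,0}` this rotation is `J_{t/2}/i`. It changes a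
conjugate frame vector into `cos(tθ_k/2)` times itself plus a `(1,0)` vector that dies in the wedge
product, so it multiplies the pairing by `∏ cos(tθ_k/2)` (`pairK_extMap_rot_left`). A continuous
square root of the parallel frame (`HalfFormFrame`) passes this to `√K⁻¹`: connectedness of the
interval settles every sign, and the factor is again `D^{1/4}`. The two factors multiply to the
`D^{1/2}` of the product pairing (`productPairing_transport`). -/

theorem involute_ι' (β : W) :
    involute (ExteriorAlgebra.ι ℝ β) = -ExteriorAlgebra.ι ℝ β :=
  CliffordAlgebra.involute_ι β

theorem exterior_left_induction {P : ExteriorAlgebra ℝ W → Prop}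
    (hr : ∀ r : ℝ, P (algebraMap ℝ _ r)) (hadd : ∀ x y, P x → P y → P (x + y))
    (hmul : ∀ (β : W) (x), P x → P (ExteriorAlgebra.ι ℝ β * x)) (x) : P x :=
  CliffordAlgebra.left_induction (0 : QuadraticForm ℝ W) hr hadd (fun x m => hmul m x) x

theorem exterior_right_induction {P : ExteriorAlgebra ℝ W → Prop}
    (hr : ∀ r : ℝ, P (algebraMap ℝ _ r)) (hadd : ∀ x y, P x → P y → P (x + y))
    (hmul : ∀ (β : W) (x), P x → P (x * ExteriorAlgebra.ι ℝ β)) (x) : P x :=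
  CliffordAlgebra.right_induction (0 : QuadraticForm ℝ W) hr hadd hmul x

theorem contractLeft_ι_mul' (d : Dual ℝ W) (β : W) (ω : ExteriorAlgebra ℝ W) :
    contractLeft d (ExteriorAlgebra.ι ℝ β * ω) =
      d β • ω - ExteriorAlgebra.ι ℝ β * contractLeft d ω :=
  CliffordAlgebra.contractLeft_ι_mul (Q := (0 : QuadraticForm ℝ W)) d β ω

theorem contractLeft_algebraMap' (d : Dual ℝ W) (r : ℝ) :
    contractLeft d (algebraMap ℝ (ExteriorAlgebra ℝ W) r) = 0 :=
  CliffordAlgebra.contractLeft_algebraMap (0 : QuadraticForm ℝ W) d r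

/-- Moving `β` past a form of degree `k` costs `(-1)^k`, which the grade involution records. This
turns left factors into right factors, on which the Hodge star acts recursively. -/
theorem ι_mul_eq_involute_mul (β : W) (ω : ExteriorAlgebra ℝ W) :
    ExteriorAlgebra.ι ℝ β * ω = involute ω * ExteriorAlgebra.ι ℝ β := by
  induction ω using exterior_left_induction with
  | hr r => rw [AlgHom.commutes, Algebra.commutes]
  | hadd x y hx hy => rw [mul_add, map_add, add_mul, hx, hy]
  | hmul α x hx =>
    rw [map_mul, involute_ι', mul_assoc, ← hx, ← mul_assoc,
      eq_neg_of_add_eq_zero_left (ExteriorAlgebra.ι_add_mul_swap β α), neg_mul, neg_mul, mul_assoc]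

theorem contractLeft_involute (d : Dual ℝ W) (ω : ExteriorAlgebra ℝ W) :
    contractLeft d (involute ω) = -involute (contractLeft d ω) := by
  induction ω using exterior_left_induction with
  | hr r => rw [AlgHom.commutes, contractLeft_algebraMap', map_zero, neg_zero]
  | hadd x y hx hy => rw [map_add, map_add, map_add, map_add, hx, hy, neg_add]
  | hmul α x hx =>
    rw [map_mul, involute_ι', neg_mul, map_neg, contractLeft_ι_mul', contractLeft_ι_mul', hx,
      map_sub, map_smul, map_mul, involute_ι', mul_neg, neg_mul]

theorem contractLeft_mul (d : Dual ℝ W) (ψ η : ExteriorAlgebra ℝ W) :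
    contractLeft d (ψ * η) = contractLeft d ψ * η + involute ψ * contractLeft d η := by
  induction ψ using exterior_left_induction with
  | hr r =>
    rw [AlgHom.commutes, contractLeft_algebraMap', zero_mul, zero_add, ← Algebra.smul_def,
      ← Algebra.smul_def, map_smul]
  | hadd x y hx hy =>
    rw [add_mul, map_add, hx, hy, map_add, map_add, add_mul, add_mul]; abel
  | hmul α x hx =>
    rw [mul_assoc, contractLeft_ι_mul', contractLeft_ι_mul', hx, map_mul, involute_ι', sub_mul,
      smul_mul_assoc, mul_add, neg_mul, neg_mul, mul_assoc, mul_assoc]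
    abel

/-- Contraction lowers the degree by one, so only the component of `f` in degree `k - 1` could see
the result. Peeling off a factor replaces `f` by a partially evaluated family, hence the induction
over all `f`. -/
theorem liftAlternating_contractLeft_ιMulti (d : Dual ℝ W) (k : ℕ) (v : Fin k → W)
    (f : ∀ i, W [⋀^Fin i]→ₗ[ℝ] ℝ) (hf : ∀ j, j + 1 = k → f j = 0) :
    ExteriorAlgebra.liftAlternating f (contractLeft d (ExteriorAlgebra.ιMulti ℝ k v)) = 0 := by
  induction k generalizing f with
  | zero =>
    rw [ExteriorAlgebra.ιMulti_zero_apply, ← map_one (algebraMap ℝ _), contractLeft_algebraMap',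
      map_zero]
  | succ k ih =>
    rw [ExteriorAlgebra.ιMulti_succ_apply, contractLeft_ι_mul', map_sub, map_smul,
      ExteriorAlgebra.liftAlternating_apply_ιMulti, hf k rfl,
      ExteriorAlgebra.liftAlternating_ι_mul, ih]
    · simp
    · intro j hj
      subst hj
      rw [hf _ rfl]
      ext
      simp

theorem ιMulti_eq_zero_of_finrank_lt [FiniteDimensional ℝ W] {k : ℕ} (hk : finrank ℝ W < k)
    (v : Fin k → W) : ExteriorAlgebra.ιMulti ℝ k v = 0 := by
  apply AlternatingMap.map_linearDependent
  intro h
  have := h.fintype_card_le_finrank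
  simp at this
  omega

theorem onlyDegree_self {N : ℕ} (a : W [⋀^Fin N]→ₗ[ℝ] ℝ) : onlyDegree a N = a := by
  ext v
  simp [onlyDegree]

theorem onlyDegree_of_ne {N i : ℕ} (a : W [⋀^Fin N]→ₗ[ℝ] ℝ) (h : i ≠ N) : onlyDegree a i = 0 := by
  simp [onlyDegree, h]

theorem exterior_lhom_ext {N : Type*} [AddCommGroup N] [Module ℝ N]
    {f g : ExteriorAlgebra ℝ W →ₗ[ℝ] N}
    (h : ∀ (k : ℕ) (v : Fin k → W),
      f (ExteriorAlgebra.ιMulti ℝ k v) = g (ExteriorAlgebra.ιMulti ℝ k v)) : f = g :=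
  ExteriorAlgebra.lhom_ext fun k => AlternatingMap.ext fun v => h k v

/-- Only forms of degree `N + 1` contract into degree `N`, and there are none. This plays the role
of Stokes' theorem for the Berezin integral and permits integration by parts. -/
theorem topForm_contractLeft [FiniteDimensional ℝ W] {N : ℕ} (hN : finrank ℝ W = N)
    (a : W [⋀^Fin N]→ₗ[ℝ] ℝ) (d : Dual ℝ W) (ω : ExteriorAlgebra ℝ W) :
    ExteriorAlgebra.liftAlternating (onlyDegree a) (contractLeft d ω) = 0 := by
  have : ExteriorAlgebra.liftAlternating (onlyDegree a) ∘ₗ contractLeft d = 0 := by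
    refine exterior_lhom_ext fun k v => ?_
    rw [LinearMap.comp_apply, LinearMap.zero_apply]
    by_cases hk : k = N + 1
    · rw [ιMulti_eq_zero_of_finrank_lt (by omega), map_zero, map_zero]
    · refine liftAlternating_contractLeft_ιMulti d k v _ fun j hj => onlyDegree_of_ne _ ?_
      omega
  exact LinearMap.congr_fun this ω

theorem involute_ιMulti (k : ℕ) (v : Fin k → W) :
    involute (ExteriorAlgebra.ιMulti ℝ k v) = (-1 : ℝ) ^ k • ExteriorAlgebra.ιMulti ℝ k v := by
  induction k with
  | zero => rw [ExteriorAlgebra.ιMulti_zero_apply, map_one, pow_zero, one_smul]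
  | succ k ih =>
    rw [ExteriorAlgebra.ιMulti_succ_apply, map_mul, ih, involute_ι', pow_succ]
    simp

theorem topForm_involute {N : ℕ} (a : W [⋀^Fin (2 * N)]→ₗ[ℝ] ℝ) (ω : ExteriorAlgebra ℝ W) :
    ExteriorAlgebra.liftAlternating (onlyDegree a) (involute ω) =
      ExteriorAlgebra.liftAlternating (onlyDegree a) ω := by
  have : ExteriorAlgebra.liftAlternating (onlyDegree a) ∘ₗ
      (involute : ExteriorAlgebra ℝ W →ₐ[ℝ] ExteriorAlgebra ℝ W).toLinearMap =
      ExteriorAlgebra.liftAlternating (onlyDegree a) := by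
    refine exterior_lhom_ext fun k v => ?_
    rw [LinearMap.comp_apply, AlgHom.toLinearMap_apply, involute_ιMulti, map_smul,
      ExteriorAlgebra.liftAlternating_apply_ιMulti]
    by_cases hk : k = 2 * N
    · subst hk
      simp
    · rw [onlyDegree_of_ne _ hk]
      simp
  exact LinearMap.congr_fun this ω

/-- Degree-zero component. -/
abbrev scalarPart : ExteriorAlgebra ℝ W →ₐ[ℝ] ℝ := ExteriorAlgebra.algebraMapInv

theorem scalarPart_ι (β : W) : scalarPart (ExteriorAlgebra.ι ℝ β) = 0 := by
  simp [scalarPart, ExteriorAlgebra.algebraMapInv]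

theorem scalarPart_algebraMap (r : ℝ) :
    scalarPart (algebraMap ℝ (ExteriorAlgebra ℝ W) r) = r :=
  ExteriorAlgebra.algebraMap_leftInverse W r

/-- A factor of positive degree pushes the product above the top degree. -/
theorem mul_top [FiniteDimensional ℝ W] {N : ℕ} (hN : finrank ℝ W = N) (v : Fin N → W)
    (ω : ExteriorAlgebra ℝ W) :
    ω * ExteriorAlgebra.ιMulti ℝ N v = scalarPart ω • ExteriorAlgebra.ιMulti ℝ N v := by
  induction ω using exterior_left_induction with
  | hr r => rw [scalarPart_algebraMap, Algebra.smul_def]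
  | hadd x y hx hy => rw [add_mul, map_add, hx, hy, add_smul]
  | hmul α x hx =>
    rw [mul_assoc, hx, map_mul, scalarPart_ι, zero_mul, zero_smul, mul_smul_comm]
    have := ExteriorAlgebra.ιMulti_succ_apply (R := ℝ) (Fin.cons α v : Fin (N + 1) → W)
    rw [ιMulti_eq_zero_of_finrank_lt (by omega)] at this
    simp only [Fin.cons_zero, Matrix.vecTail, Function.comp_def, Fin.cons_succ] at this
    rw [← this, smul_zero]

end ExteriorReal

/-! ### Adjointness, symmetry and positivity of the real form on exterior forms -/

section RealForm

variable {V : Type*} [NormedAddCommGroup V] [InnerProductSpace ℝ V] [FiniteDimensional ℝ V]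
variable {n : ℕ} [Fact (finrank ℝ V = 2 * n)] (o : Orientation ℝ V (Fin (2 * n)))

open CliffordAlgebra (involute)

theorem flat_apply (x y : V) : flat V x y = inner ℝ x y := rfl

theorem finrank_dual_eq : finrank ℝ (Dual ℝ V) = 2 * n := by
  rw [Subspace.dual_finrank_eq]; exact Fact.out

theorem contractR_ι_mul (x : V) (β : Dual ℝ V) (ω : ExteriorAlgebra ℝ (Dual ℝ V)) :
    contractR x (ExteriorAlgebra.ι ℝ β * ω) =
      β x • ω - ExteriorAlgebra.ι ℝ β * contractR x ω :=
  contractLeft_ι_mul' _ β ω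

theorem contractR_algebraMap (x : V) (r : ℝ) :
    contractR x (algebraMap ℝ (ExteriorAlgebra ℝ (Dual ℝ V)) r) = 0 :=
  contractLeft_algebraMap' _ r

theorem contractR_one (x : V) : contractR x (1 : ExteriorAlgebra ℝ (Dual ℝ V)) = 0 := by
  rw [← map_one (algebraMap ℝ (ExteriorAlgebra ℝ (Dual ℝ V))), contractR_algebraMap]

theorem contractR_contractR (x : V) (ω : ExteriorAlgebra ℝ (Dual ℝ V)) :
    contractR x (contractR x ω) = 0 :=
  CliffordAlgebra.contractLeft_contractLeft (Q := (0 : QuadraticForm ℝ (Dual ℝ V))) _ ω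

theorem contractR_comm (x y : V) (ω : ExteriorAlgebra ℝ (Dual ℝ V)) :
    contractR x (contractR y ω) = -contractR y (contractR x ω) :=
  CliffordAlgebra.contractLeft_comm (Q := (0 : QuadraticForm ℝ (Dual ℝ V))) _ _ ω

theorem hodgeR_one (c : ℝ) : hodgeR o c 1 = c ^ n • volForm o := by
  simp [hodgeR]

/-- The star is built from an algebra map into the opposite endomorphism algebra, so the rightmost
factor becomes the outermost contraction. -/
theorem hodgeR_mul_ι (c : ℝ) (ω : ExteriorAlgebra ℝ (Dual ℝ V)) (β : Dual ℝ V) :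
    hodgeR o c (ω * ExteriorAlgebra.ι ℝ β) =
      contractR (c⁻¹ • (flat V).symm β) (hodgeR o c ω) := by
  simp [hodgeR]

theorem involute_volForm : involute (volForm o) = volForm o := by
  simp only [volForm, map_smul, involute_ιMulti]
  simp

theorem hodgeR_involute (c : ℝ) (ω : ExteriorAlgebra ℝ (Dual ℝ V)) :
    hodgeR o c (involute ω) = involute (hodgeR o c ω) := by
  induction ω using exterior_right_induction with
  | hr r =>
    rw [AlgHom.commutes, Algebra.algebraMap_eq_smul_one, map_smul, map_smul, hodgeR_one, map_smul,
      involute_volForm]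
  | hadd x y hx hy => rw [map_add, map_add, map_add, map_add, hx, hy]
  | hmul α x hx =>
    rw [map_mul, involute_ι', mul_neg, map_neg, hodgeR_mul_ι, hx, hodgeR_mul_ι, contractR,
      LinearMap.comp_apply, contractLeft_involute, neg_neg]

/-- The real bilinear form underlying `herm₀`. -/
def formR : LinearMap.BilinForm ℝ (ExteriorAlgebra ℝ (Dual ℝ V)) :=
  (LinearMap.mul ℝ _).compr₂ (berezinR o) |>.compl₂ (hodgeR o (1 / 2))

theorem formR_apply (ψ ω : ExteriorAlgebra ℝ (Dual ℝ V)) :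
    formR o ψ ω = berezinR o (ψ * hodgeR o (1 / 2) ω) := rfl

/-- Integration by parts: a contraction of `involute ψ * involute (⋆ω)` has no top component, and
the antiderivation rule splits it into the two sides. The factor `2` is the inverse of the scale in
the metric `½ g`. -/
theorem formR_ι_mul_right (β : Dual ℝ V) (ψ ω : ExteriorAlgebra ℝ (Dual ℝ V)) :
    formR o ψ (ExteriorAlgebra.ι ℝ β * ω) =
      formR o (contractR ((2 : ℝ) • (flat V).symm β) ψ) ω := by
  have hc : ((1 / 2 : ℝ))⁻¹ = 2 := by norm_num
  rw [formR_apply, formR_apply, ι_mul_eq_involute_mul, hodgeR_mul_ι, hc, hodgeR_involute]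
  set x := (2 : ℝ) • (flat V).symm β
  have h := topForm_contractLeft (finrank_dual_eq (V := V) (n := n))
    (o.volumeForm.compLinearMap (flat V).symm.toLinearMap) (Dual.eval ℝ V x)
    (involute ψ * involute (hodgeR o (1 / 2) ω))
  rw [contractLeft_mul, contractLeft_involute, CliffordAlgebra.involute_involute, neg_mul,
    ← map_mul, map_add, map_neg, topForm_involute] at h
  exact (neg_add_eq_zero.mp h).symm

/-- The number `vol(b) = ±1` appears twice, so the orientation of the chosen orthonormal basis is
irrelevant. -/
theorem berezinR_volForm : berezinR o (volForm o) = 1 := by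
  simp only [volForm, berezinR, map_smul, ExteriorAlgebra.liftAlternating_apply_ιMulti,
    onlyDegree_self, AlternatingMap.compLinearMap_apply, smul_eq_mul]
  simp only [LinearEquiv.coe_coe, LinearEquiv.symm_apply_apply]
  rw [← abs_mul_abs_self, o.abs_volumeForm_apply_of_orthonormal, one_mul]

theorem formR_one_right (ψ : ExteriorAlgebra ℝ (Dual ℝ V)) :
    formR o ψ 1 = (1 / 2) ^ n * scalarPart ψ := by
  rw [formR_apply, hodgeR_one, mul_smul_comm, map_smul, smul_eq_mul]
  congr 1
  have : ψ * volForm o = scalarPart ψ • volForm o := by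
    simp only [volForm, mul_smul_comm, mul_top (finrank_dual_eq (V := V) (n := n))]
    rw [smul_comm]
  rw [this, map_smul, berezinR_volForm, smul_eq_mul, mul_one]

/-- The adjunction in the other argument is needed to derive the symmetry of the form, so it cannot
be deduced from it. In the inductive step the two scalars produced by the contractions agree because
`g` is symmetric. -/
theorem formR_ι_mul_left (β : Dual ℝ V) (ψ ω : ExteriorAlgebra ℝ (Dual ℝ V)) :
    formR o (ExteriorAlgebra.ι ℝ β * ψ) ω =
      formR o ψ (contractR ((2 : ℝ) • (flat V).symm β) ω) := by
  induction ω using exterior_left_induction generalizing ψ with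
  | hr r =>
    rw [contractR_algebraMap, map_zero, Algebra.algebraMap_eq_smul_one, map_smul, formR_one_right,
      map_mul, scalarPart_ι, zero_mul, mul_zero, smul_zero]
  | hadd x y hx hy => rw [map_add, map_add, map_add, hx, hy]
  | hmul α x hx =>
    rw [formR_ι_mul_right, contractR_ι_mul, contractR_ι_mul, map_sub, map_sub,
      formR_ι_mul_right, LinearMap.sub_apply, hx, map_smul, map_smul, LinearMap.smul_apply]
    congr 2
    have h1 : ∀ a b : Dual ℝ V, a ((flat V).symm b) = inner ℝ ((flat V).symm a) ((flat V).symm b) := by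
      intro a b
      rw [← flat_apply, LinearEquiv.apply_symm_apply]
    rw [map_smul, map_smul, h1, h1, real_inner_comm]

theorem formR_symm (ψ ω : ExteriorAlgebra ℝ (Dual ℝ V)) : formR o ψ ω = formR o ω ψ := by
  induction ψ using exterior_left_induction generalizing ω with
  | hr r =>
    rw [Algebra.algebraMap_eq_smul_one, map_smul, map_smul, LinearMap.smul_apply]
    congr 1
    induction ω using exterior_left_induction with
    | hr r =>
      rw [Algebra.algebraMap_eq_smul_one, map_smul, map_smul, LinearMap.smul_apply]
    | hadd x y hx hy => rw [map_add, map_add, LinearMap.add_apply, hx, hy]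
    | hmul α x hx =>
      rw [formR_ι_mul_left, formR_ι_mul_right, contractR_one, map_zero, map_zero,
        LinearMap.zero_apply]
  | hadd x y hx hy => rw [map_add, map_add, LinearMap.add_apply, hx, hy]
  | hmul α x hx => rw [formR_ι_mul_left, hx, formR_ι_mul_right]

/-- `1 - f_i ι_i`. -/
def vacProj (x : V) : Module.End ℝ (ExteriorAlgebra ℝ (Dual ℝ V)) :=
  1 - LinearMap.mulLeft ℝ (ExteriorAlgebra.ι ℝ (flat V x)) * contractR x

theorem vacProj_apply (x : V) (ψ) :
    vacProj x ψ = ψ - ExteriorAlgebra.ι ℝ (flat V x) * contractR x ψ := rfl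

theorem vacProj_ι_mul_of_orthogonal {x y : V} (h : inner ℝ y x = 0)
    (ψ : ExteriorAlgebra ℝ (Dual ℝ V)) :
    vacProj x (ExteriorAlgebra.ι ℝ (flat V y) * ψ) =
      ExteriorAlgebra.ι ℝ (flat V y) * vacProj x ψ := by
  rw [vacProj_apply, vacProj_apply, contractR_ι_mul, flat_apply, h, zero_smul, zero_sub, mul_neg,
    mul_sub, ← mul_assoc, ← mul_assoc,
    eq_neg_of_add_eq_zero_left (ExteriorAlgebra.ι_add_mul_swap (R := ℝ) (flat V x) (flat V y)),
    neg_mul, neg_neg]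

theorem vacProj_ι_mul_self {x : V} (h : inner ℝ x x = (1 : ℝ))
    (ψ : ExteriorAlgebra ℝ (Dual ℝ V)) :
    vacProj x (ExteriorAlgebra.ι ℝ (flat V x) * ψ) = 0 := by
  rw [vacProj_apply, contractR_ι_mul, flat_apply, h, one_smul, mul_sub, ← mul_assoc,
    ExteriorAlgebra.ι_sq_zero, zero_mul, sub_zero, sub_self]

/-- The factors with index other than `j` commute with multiplication by the covector of `b j`, and
`vacProj (b j)` annihilates such products. -/
theorem foldr_vacProj_ι_mul {ι : Type*} {b : ι → V} (hb : Orthonormal ℝ b) (l : List ι) (j : ι)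
    (hj : j ∈ l) (ψ : ExteriorAlgebra ℝ (Dual ℝ V)) :
    (l.map fun i => vacProj (b i)).prod (ExteriorAlgebra.ι ℝ (flat V (b j)) * ψ) = 0 := by
  classical
  induction l with
  | nil => simp at hj
  | cons i l ih =>
    rw [List.map_cons, List.prod_cons, Module.End.mul_apply]
    by_cases hjl : j ∈ l
    · rw [ih hjl, map_zero]
    · have hij : i = j := by
        rcases List.mem_cons.mp hj with h | h
        · exact h.symm
        · exact absurd h hjl
      subst hij
      have : (l.map fun i => vacProj (b i)).prod (ExteriorAlgebra.ι ℝ (flat V (b i)) * ψ) =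
          ExteriorAlgebra.ι ℝ (flat V (b i)) * (l.map fun i => vacProj (b i)).prod ψ := by
        clear ih hj
        induction l with
        | nil => simp
        | cons k l ih =>
          rw [List.map_cons, List.prod_cons, Module.End.mul_apply, Module.End.mul_apply,
            ih (fun h => hjl (List.mem_cons_of_mem _ h)), vacProj_ι_mul_of_orthogonal]
          apply hb.2
          rintro rfl
          exact hjl List.mem_cons_self
      rw [this, vacProj_ι_mul_self]
      rw [real_inner_self_eq_norm_sq, hb.1, one_pow]

/-- Each factor removes what is divisible by one orthonormal covector; only the degree-zero
component survives all of them. -/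
theorem prod_vacProj {ι : Type*} [Fintype ι] (b : OrthonormalBasis ι ℝ V)
    (ψ : ExteriorAlgebra ℝ (Dual ℝ V)) :
    ((Finset.univ : Finset ι).toList.map fun i => vacProj (b i)).prod ψ =
      algebraMap ℝ _ (scalarPart ψ) := by
  induction ψ using exterior_left_induction with
  | hr r =>
    rw [scalarPart_algebraMap]
    generalize (Finset.univ : Finset ι).toList = l
    induction l with
    | nil => simp
    | cons i l ih =>
      rw [List.map_cons, List.prod_cons, Module.End.mul_apply, ih, vacProj_apply,
        contractR_algebraMap, mul_zero, sub_zero]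
  | hadd x y hx hy => rw [map_add, hx, hy, map_add, map_add]
  | hmul α x hx =>
    rw [map_mul scalarPart, scalarPart_ι, zero_mul, map_zero]
    obtain ⟨y, rfl⟩ := (flat V).surjective α
    conv_lhs => rw [← b.sum_repr y]
    simp only [map_sum, map_smul, Finset.sum_mul, smul_mul_assoc]
    refine Finset.sum_eq_zero fun i _ => ?_
    rw [foldr_vacProj_ι_mul b.orthonormal _ _ (by simp), smul_zero]

/-- Induction on the set `k` of directions that may occur in `ψ`. Splitting off `b i` gives `ψ = ψ'
+ b i ∧ ψ''` with `b i` absent from both parts; when no direction is left, `ψ` is a scalar. -/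
theorem formR_self_aux {ι : Type*} {b : ι → V} (hb : Orthonormal ℝ b) (l : List ι)
    (hl : ∀ ψ : ExteriorAlgebra ℝ (Dual ℝ V), ∃ r, (l.map fun i => vacProj (b i)).prod ψ =
      algebraMap ℝ _ r) (k : Finset ι) :
    ∀ ψ : ExteriorAlgebra ℝ (Dual ℝ V), (∀ i, i ∉ k → contractR (b i) ψ = 0) →
      0 ≤ formR o ψ ψ ∧ (formR o ψ ψ = 0 → ψ = 0) := by
  classical
  induction k using Finset.induction_on with
  | empty =>
    intro ψ hψ
    have hfix : ψ = (l.map fun i => vacProj (b i)).prod ψ := by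
      have : ∀ i ∈ l, contractR (b i) ψ = 0 := fun i _ => hψ i (by simp)
      clear hl
      induction l with
      | nil => simp
      | cons i l ih =>
        rw [List.map_cons, List.prod_cons, Module.End.mul_apply,
          ← ih (fun j hj => this j (List.mem_cons_of_mem _ hj)), vacProj_apply,
          this i List.mem_cons_self, mul_zero, sub_zero]
    obtain ⟨r, hr⟩ := hl ψ
    rw [hr] at hfix
    have hval : formR o ψ ψ = (1 / 2) ^ n * r * r := by
      rw [hfix]
      conv_lhs => rw [Algebra.algebraMap_eq_smul_one, map_smul, formR_one_right,
        ← Algebra.algebraMap_eq_smul_one, scalarPart_algebraMap]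
      rw [smul_eq_mul]; ring
    have hpos : (0 : ℝ) < (1 / 2) ^ n := by positivity
    rw [hval, mul_assoc]
    refine ⟨mul_nonneg hpos.le (mul_self_nonneg r), fun h => ?_⟩
    rw [hfix, mul_self_eq_zero.mp ((mul_eq_zero.mp h).resolve_left hpos.ne'), map_zero]
  | insert i k _ ih =>
    intro ψ hψ
    set ψ'' := contractR (b i) ψ with h''
    set ψ' := vacProj (b i) ψ with h'
    have hbi : inner ℝ (b i) (b i) = (1 : ℝ) := by
      rw [real_inner_self_eq_norm_sq, hb.1, one_pow]
    have hc2 : contractR (b i) ψ'' = 0 := contractR_contractR _ _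
    have hc1 : contractR (b i) ψ' = 0 := by
      rw [h', vacProj_apply, map_sub, contractR_ι_mul, flat_apply, hbi, one_smul, ← h'', hc2,
        mul_zero, sub_zero, sub_self]
    have hj2 : ∀ j, j ∉ k → contractR (b j) ψ'' = 0 := by
      intro j hjk
      by_cases hji : j = i
      · rw [hji, hc2]
      · rw [h'', contractR_comm, hψ j (by simp [hji, hjk]), map_zero, neg_zero]
    have hj1 : ∀ j, j ∉ k → contractR (b j) ψ' = 0 := by
      intro j hjk
      by_cases hji : j = i
      · rw [hji, hc1]
      · rw [h', vacProj_apply, map_sub, contractR_ι_mul, flat_apply, hb.2 (Ne.symm hji), zero_smul,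
          ← h'', hj2 j hjk, mul_zero, hψ j (by simp [hji, hjk]), sub_zero, sub_zero]
    have hdec : ψ = ψ' + ExteriorAlgebra.ι ℝ (flat V (b i)) * ψ'' := by
      rw [h', vacProj_apply, sub_add_cancel]
    -- By adjunction the cross terms contain `ι_{b i} ψ' = 0`; the `2` is that of the half metric.
    have hval : formR o ψ ψ = formR o ψ' ψ' + 2 * formR o ψ'' ψ'' := by
      rw [hdec, map_add, map_add, LinearMap.add_apply, LinearMap.add_apply, formR_ι_mul_right,
        formR_ι_mul_left, formR_ι_mul_left, LinearEquiv.symm_apply_apply, map_smul,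
        LinearMap.smul_apply, LinearMap.smul_apply, hc1, smul_zero, map_zero, map_zero,
        LinearMap.zero_apply, contractR_ι_mul, flat_apply, hbi, one_smul, hc2, mul_zero, sub_zero,
        map_smul, smul_eq_mul, zero_add, add_zero]
    obtain ⟨p1, q1⟩ := ih ψ' hj1
    obtain ⟨p2, q2⟩ := ih ψ'' hj2
    rw [hval]
    refine ⟨by positivity, fun h => ?_⟩
    rw [hdec, q1 (by linarith), q2 (by linarith), mul_zero, add_zero]

theorem formR_self (ψ : ExteriorAlgebra ℝ (Dual ℝ V)) :
    0 ≤ formR o ψ ψ ∧ (formR o ψ ψ = 0 → ψ = 0) :=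
  formR_self_aux o (stdOrthonormalBasis ℝ V).orthonormal (Finset.univ : Finset _).toList
    (fun ψ => ⟨_, prod_vacProj _ ψ⟩) Finset.univ ψ (by simp)

end RealForm

/-! ### The Hermitian form on `H₀` -/

section Complexification

variable {W : Type*} [AddCommGroup W] [Module ℝ W]

theorem conj_tmul (z : ℂ) (a : ExteriorAlgebra ℝ W) :
    conj (z ⊗ₜ[ℝ] a) = (starRingEnd ℂ z) ⊗ₜ[ℝ] a := by
  simp [conj]

theorem conj_smul (z : ℂ) (ψ : CExt W) : conj (z • ψ) = starRingEnd ℂ z • conj ψ := by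
  induction ψ using TensorProduct.induction_on with
  | zero => simp
  | tmul w a => rw [TensorProduct.smul_tmul', conj_tmul, conj_tmul, TensorProduct.smul_tmul',
      smul_eq_mul, smul_eq_mul, map_mul]
  | add x y hx hy => rw [smul_add, map_add, hx, hy, map_add, smul_add]

/-- Conjugation as a conjugate-linear map. -/
def conjS : CExt W →ₗ⋆[ℂ] CExt W where
  toFun := conj
  map_add' := map_add _
  map_smul' := conj_smul

theorem coe_smul_tensor {M : Type*} [AddCommGroup M] [Module ℝ M] (r : ℝ) (ψ : ℂ ⊗[ℝ] M) :
    (r : ℂ) • ψ = r • ψ :=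
  algebraMap_smul ℂ r ψ

theorem exists_re_im {M : Type*} [AddCommGroup M] [Module ℝ M] (ψ : ℂ ⊗[ℝ] M) :
    ∃ a b : M, ψ = (1 : ℂ) ⊗ₜ[ℝ] a + Complex.I ⊗ₜ[ℝ] b := by
  induction ψ using TensorProduct.induction_on with
  | zero => exact ⟨0, 0, by simp⟩
  | tmul z x =>
    refine ⟨z.re • x, z.im • x, ?_⟩
    rw [← TensorProduct.smul_tmul, ← TensorProduct.smul_tmul, ← TensorProduct.add_tmul]
    congr 1
    simp only [Complex.real_smul, mul_one]
    exact (Complex.re_add_im z).symm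
  | add x y hx hy =>
    obtain ⟨a, b, rfl⟩ := hx
    obtain ⟨c, d, rfl⟩ := hy
    exact ⟨a + c, b + d, by rw [TensorProduct.tmul_add, TensorProduct.tmul_add]; abel⟩

variable (W) in
/-- The conjugation of `W^ℂ`. -/
def conjV : Cplx W →ₗ⋆[ℂ] Cplx W where
  toFun := TensorProduct.map Complex.conjAe.toLinearMap LinearMap.id
  map_add' := map_add _
  map_smul' z v := by
    induction v using TensorProduct.induction_on with
    | zero => simp
    | tmul w a => simp [TensorProduct.smul_tmul']
    | add x y hx hy => rw [smul_add, map_add, hx, hy, map_add, smul_add]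

theorem conjV_tmul (z : ℂ) (x : W) : conjV W (z ⊗ₜ[ℝ] x) = (starRingEnd ℂ z) ⊗ₜ[ℝ] x := by
  simp [conjV]

theorem conjV_conjV (v : Cplx W) : conjV W (conjV W v) = v := by
  induction v using TensorProduct.induction_on with
  | zero => simp
  | tmul w a => simp [conjV_tmul]
  | add x y hx hy => rw [map_add, map_add, hx, hy]

theorem ιC_tmul (z : ℂ) (x : W) : ιC (z ⊗ₜ[ℝ] x) = z ⊗ₜ[ℝ] ExteriorAlgebra.ι ℝ x := by
  simp [ιC]

instance [FiniteDimensional ℝ W] : Module.Finite ℝ (ExteriorAlgebra ℝ W) :=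
  Module.Finite.of_basis (Module.finBasis ℝ W).ExteriorAlgebra

end Complexification

/-! ### Derivatives in finite-dimensional complex spaces and linear flows -/

section VecDeriv

variable {E F G : Type*} [AddCommGroup E] [Module ℂ E] [AddCommGroup F] [Module ℂ F]
  [AddCommGroup G] [Module ℂ G] {s : Set ℝ} {t : ℝ}

theorem HasVecDerivWithinAt.linear {f : ℝ → E} {f' : E} (h : HasVecDerivWithinAt f f' s t)
    (T : E →ₗ[ℂ] F) : HasVecDerivWithinAt (fun r => T (f r)) (T f') s t :=
  fun l => h (l ∘ₗ T)

theorem hasDerivWithinAt_conj {f : ℝ → ℂ} {f' : ℂ} (h : HasDerivWithinAt f f' s t) :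
    HasDerivWithinAt (fun r => starRingEnd ℂ (f r)) (starRingEnd ℂ f') s t :=
  Complex.conjCLE.toContinuousLinearMap.hasFDerivAt.comp_hasDerivWithinAt t h

theorem HasVecDerivWithinAt.semilinear {f : ℝ → E} {f' : E} (h : HasVecDerivWithinAt f f' s t)
    (T : E →ₗ⋆[ℂ] F) : HasVecDerivWithinAt (fun r => T (f r)) (T f') s t := by
  intro l
  -- The functional `l ∘ T` is only conjugate linear; its complex conjugate is an admissible test
  -- functional.
  let l' : Module.Dual ℂ E :=
    { toFun := fun x => starRingEnd ℂ (l (T x))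
      map_add' := by simp
      map_smul' := by simp }
  have := hasDerivWithinAt_conj (h l')
  simpa [l'] using this

theorem HasVecDerivWithinAt.add {f g : ℝ → E} {f' g' : E} (hf : HasVecDerivWithinAt f f' s t)
    (hg : HasVecDerivWithinAt g g' s t) :
    HasVecDerivWithinAt (fun r => f r + g r) (f' + g') s t := by
  intro l
  simp only [map_add]
  exact (hf l).add (hg l)

theorem HasVecDerivWithinAt.sub {f g : ℝ → E} {f' g' : E} (hf : HasVecDerivWithinAt f f' s t)
    (hg : HasVecDerivWithinAt g g' s t) :
    HasVecDerivWithinAt (fun r => f r - g r) (f' - g') s t := by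
  intro l
  simp only [map_sub]
  exact (hf l).sub (hg l)

theorem hasVecDerivWithinAt_const (x : E) : HasVecDerivWithinAt (fun _ => x) 0 s t := by
  intro l
  rw [map_zero]
  exact hasDerivWithinAt_const _ _ _

theorem hasVecDerivWithinAt_complex {f : ℝ → ℂ} {f' : ℂ} :
    HasVecDerivWithinAt f f' s t ↔ HasDerivWithinAt f f' s t := by
  refine ⟨fun h => h LinearMap.id, fun h l => ?_⟩
  have key : ∀ x, l x = x * l 1 := fun x => by rw [← smul_eq_mul, ← map_smul, smul_eq_mul, mul_one]
  rw [key f', show (fun r => l (f r)) = fun r => f r * l 1 from funext fun r => key _]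
  exact h.mul_const _

theorem HasVecDerivWithinAt.congr {f g : ℝ → E} {f' : E} (hf : HasVecDerivWithinAt f f' s t)
    (h : ∀ x ∈ s, g x = f x) (ht : t ∈ s) : HasVecDerivWithinAt g f' s t :=
  fun l => (hf l).congr (fun x hx => by rw [h x hx]) (by rw [h t ht])

/-- Expanding the first argument in a basis reduces the product rule to a finite sum of products of
scalar functions, so only one of the spaces has to be finite-dimensional. -/
theorem HasVecDerivWithinAt.bilin [FiniteDimensional ℂ E] {f : ℝ → E} {f' : E} {g : ℝ → F}
    {g' : F} (hf : HasVecDerivWithinAt f f' s t) (hg : HasVecDerivWithinAt g g' s t)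
    (B : E →ₗ[ℂ] F →ₗ[ℂ] G) :
    HasVecDerivWithinAt (fun r => B (f r) (g r)) (B f' (g t) + B (f t) g') s t := by
  intro l
  let e := Module.finBasis ℂ E
  have key : ∀ x y, l (B x y) = ∑ i, e.coord i x * (l ∘ₗ B (e i)) y := by
    intro x y
    conv_lhs => rw [← e.sum_repr x]
    simp only [map_sum, map_smul, LinearMap.sum_apply, LinearMap.smul_apply, smul_eq_mul]
    rfl
  rw [map_add, key, key, ← Finset.sum_add_distrib]
  simp only [key]
  exact HasDerivWithinAt.fun_sum fun i _ => (hf (e.coord i)).mul (hg (l ∘ₗ B (e i)))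

theorem HasVecDerivWithinAt.smul {f : ℝ → ℂ} {f' : ℂ} {g : ℝ → F}
    {g' : F} (hf : HasDerivWithinAt f f' s t) (hg : HasVecDerivWithinAt g g' s t) :
    HasVecDerivWithinAt (fun r => f r • g r) (f' • g t + f t • g') s t :=
  (hasVecDerivWithinAt_complex.mpr hf).bilin hg (LinearMap.lsmul ℂ F)

theorem HasVecDerivWithinAt.mul {A : Type*} [Ring A] [Algebra ℂ A] [FiniteDimensional ℂ A]
    {f g : ℝ → A} {f' g' : A} (hf : HasVecDerivWithinAt f f' s t)
    (hg : HasVecDerivWithinAt g g' s t) :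
    HasVecDerivWithinAt (fun r => f r * g r) (f' * g t + f t * g') s t :=
  hf.bilin hg (LinearMap.mul ℂ A)

theorem exp_zero_smul' {A : Type*} [NormedRing A] [NormedAlgebra ℝ A] [CompleteSpace A] (q : A) :
    NormedSpace.exp ((0 : ℝ) • q) = 1 := by
  rw [zero_smul, NormedSpace.exp_zero]

theorem exp_add_smul' {A : Type*} [NormedRing A] [NormedAlgebra ℝ A] [CompleteSpace A] (q : A)
    (s t : ℝ) : NormedSpace.exp ((s + t) • q) =
      NormedSpace.exp (s • q) * NormedSpace.exp (t • q) := by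
  let := NormedAlgebra.restrictScalars ℚ ℝ A
  rw [add_smul, NormedSpace.exp_add_of_commute]
  exact ((Commute.refl q).smul_left s).smul_right t

theorem exp_smul_mul_exp_neg_smul {A : Type*} [NormedRing A] [NormedAlgebra ℝ A] [CompleteSpace A]
    (q : A) (t : ℝ) : NormedSpace.exp (t • q) * NormedSpace.exp ((-t) • q) = 1 := by
  rw [← exp_add_smul', add_neg_cancel, exp_zero_smul']

/-- The flow of a linear vector field. -/
theorem exists_flow [FiniteDimensional ℂ E] (Q : E →ₗ[ℂ] E) :
    ∃ Φ : ℝ → E →ₗ[ℂ] E, Φ 0 = LinearMap.id ∧ (∀ t, Φ t ∘ₗ Φ (-t) = LinearMap.id) ∧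
      ∀ (x : E) (s : Set ℝ) (t : ℝ), HasVecDerivWithinAt (fun r => Φ r x) (Q (Φ t x)) s t := by
  let e : E ≃ₗ[ℂ] (Fin (finrank ℂ E) → ℂ) := (Module.finBasis ℂ E).equivFun
  -- The exponential series lives in a normed algebra, so the operator is first transported to
  -- coordinates.
  let q : (Fin (finrank ℂ E) → ℂ) →L[ℂ] (Fin (finrank ℂ E) → ℂ) :=
    LinearMap.toContinuousLinearMap (e.toLinearMap ∘ₗ Q ∘ₗ e.symm.toLinearMap)
  let Ψ : ℝ → (Fin (finrank ℂ E) → ℂ) →L[ℂ] (Fin (finrank ℂ E) → ℂ) :=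
    fun t => NormedSpace.exp (t • q)

  refine ⟨fun t => e.symm.toLinearMap ∘ₗ (Ψ t).toLinearMap ∘ₗ e.toLinearMap, ?_, ?_, ?_⟩
  · ext x
    have h : Ψ 0 = 1 := exp_zero_smul' q
    simp [h]
  · intro t
    ext x
    have h : Ψ t * Ψ (-t) = 1 := exp_smul_mul_exp_neg_smul q t
    have h' : Ψ t (Ψ (-t) (e x)) = e x := congrArg (fun T => T (e x)) h
    simp [h']
  · intro x s t l
    have h1 : HasDerivAt Ψ (q * Ψ t) t := hasDerivAt_exp_smul_const' (𝕂 := ℝ) q t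
    have h2 : HasDerivAt (fun r => Ψ r (e x)) ((q * Ψ t) (e x)) t :=
      ((ContinuousLinearMap.apply ℂ (Fin (finrank ℂ E) → ℂ) (e x)).restrictScalars
        ℝ).hasFDerivAt.comp_hasDerivAt t h1
    let l' : (Fin (finrank ℂ E) → ℂ) →L[ℂ] ℂ :=
      LinearMap.toContinuousLinearMap (l ∘ₗ e.symm.toLinearMap)
    have h3 := ((l'.restrictScalars ℝ).hasFDerivAt.comp_hasDerivAt t h2).hasDerivWithinAt (s := s)
    have h4 : l (Q ((e.symm.toLinearMap ∘ₗ (Ψ t).toLinearMap ∘ₗ e.toLinearMap) x)) =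
        l' ((q * Ψ t) (e x)) := by
      simp [l', q]
    rw [h4]
    exact h3

end VecDeriv

/-! ### The covariant derivatives, the Clifford action and the Hermitian form -/

section Form

variable {V : Type*} [NormedAddCommGroup V] [InnerProductSpace ℝ V] [FiniteDimensional ℝ V]

theorem contract_tmul (x : V) (z : ℂ) (a : ExteriorAlgebra ℝ (Dual ℝ V)) :
    contract x (z ⊗ₜ[ℝ] a) = z ⊗ₜ[ℝ] contractR x a := by
  simp [contract]

theorem wedge_tmul (β : Dual ℝ V) (z : ℂ) (a : ExteriorAlgebra ℝ (Dual ℝ V)) :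
    wedge β (z ⊗ₜ[ℝ] a) = z ⊗ₜ[ℝ] (ExteriorAlgebra.ι ℝ β * a) := by
  simp [wedge]

theorem covDeriv_apply (x : V) (ψ : H₀ V) :
    covDeriv x ψ = contract x ψ - (1 / 2 : ℂ) • wedge (flat V x) ψ := by
  have : (1 / 2 : ℂ) • wedge (flat V x) ψ = (1 / 2 : ℝ) • wedge (flat V x) ψ := by
    rw [← coe_smul_tensor]; norm_num
  rw [this]
  rfl

theorem prequantum_apply (α : Dual ℝ V) (ψ : H₀ V) :
    prequantum α ψ = contract ((flat V).symm α) ψ + (1 / 2 : ℂ) • wedge α ψ := by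
  have : (1 / 2 : ℂ) • wedge α ψ = (1 / 2 : ℝ) • wedge α ψ := by
    rw [← coe_smul_tensor]; norm_num
  rw [this]
  rfl

theorem covDerivC_tmul (z : ℂ) (x : V) : covDerivC (z ⊗ₜ[ℝ] x) = z • covDeriv x := by
  simp [covDerivC]

theorem contract_wedge (x : V) (β : Dual ℝ V) (ψ : H₀ V) :
    contract x (wedge β ψ) = ((β x : ℝ) : ℂ) • ψ - wedge β (contract x ψ) := by
  induction ψ using TensorProduct.induction_on with
  | zero => simp
  | tmul z a =>
    rw [wedge_tmul, contract_tmul, contractR_ι_mul, contract_tmul, wedge_tmul,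
      TensorProduct.tmul_sub, TensorProduct.tmul_smul, coe_smul_tensor]
  | add x y hx hy => simp only [map_add, smul_add, hx, hy]; abel

theorem contract_contract (x y : V) (ψ : H₀ V) :
    contract x (contract y ψ) = -contract y (contract x ψ) := by
  induction ψ using TensorProduct.induction_on with
  | zero => simp
  | tmul z a => simp only [contract_tmul, contractR_comm x y, TensorProduct.tmul_neg]
  | add x y hx hy => simp only [map_add, hx, hy]; abel

theorem wedge_wedge (α β : Dual ℝ V) (ψ : H₀ V) :
    wedge α (wedge β ψ) = -wedge β (wedge α ψ) := by
  induction ψ using TensorProduct.induction_on with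
  | zero => simp
  | tmul z a =>
    simp only [wedge_tmul, ← mul_assoc,
      eq_neg_of_add_eq_zero_left (ExteriorAlgebra.ι_add_mul_swap α β), neg_mul,
      TensorProduct.tmul_neg]
  | add x y hx hy => simp only [map_add, hx, hy]; abel

/-- Contractions anticommute, and so do exterior multiplications; the two mixed terms each
contribute `-½ g(x, y)` to the anticommutator. -/
theorem covDeriv_covDeriv (x y : V) (ψ : H₀ V) :
    covDeriv x (covDeriv y ψ) = -((inner ℝ x y : ℝ) : ℂ) • ψ - covDeriv y (covDeriv x ψ) := by
  simp only [covDeriv_apply, map_sub, map_smul, contract_wedge, flat_apply,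
    contract_contract x y, wedge_wedge (flat V x) (flat V y), real_inner_comm x y]
  module

/-- The opposite signs in front of `½` make the two mixed terms cancel. This is why the Clifford
action preserves each `HJ J`. -/
theorem covDeriv_prequantum (x : V) (α : Dual ℝ V) (ψ : H₀ V) :
    covDeriv x (prequantum α ψ) = -prequantum α (covDeriv x ψ) := by
  have h : flat V x ((flat V).symm α) = α x := by
    rw [flat_apply, real_inner_comm, ← flat_apply, LinearEquiv.apply_symm_apply]
  simp only [covDeriv_apply, prequantum_apply, map_sub, map_add, map_smul, contract_wedge,
    contract_contract x ((flat V).symm α), wedge_wedge (flat V x) α, h]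
  module

theorem covDerivC_prequantum (v : Cplx V) (α : Dual ℝ V) (ψ : H₀ V) :
    covDerivC v (prequantum α ψ) = -prequantum α (covDerivC v ψ) := by
  induction v using TensorProduct.induction_on with
  | zero => simp
  | tmul z x => simp only [covDerivC_tmul, LinearMap.smul_apply, covDeriv_prequantum, map_smul,
      smul_neg]
  | add x y hx hy => simp only [map_add, LinearMap.add_apply, hx, hy]; abel

variable {n : ℕ} [Fact (finrank ℝ V = 2 * n)] (o : Orientation ℝ V (Fin (2 * n)))

/-- `herm₀` as a sesquilinear map. -/
def hermL : H₀ V →ₗ⋆[ℂ] H₀ V →ₗ[ℂ] ℂ :=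
  ((LinearMap.mul ℂ (H₀ V)).compr₂ (berezin o) |>.compl₂ (hodge₀ o)) ∘ₛₗ conjS

theorem hermL_apply (ψ φ : H₀ V) : hermL o ψ φ = herm₀ o ψ φ := rfl

theorem hermL_tmul (z w : ℂ) (a b : ExteriorAlgebra ℝ (Dual ℝ V)) :
    hermL o (z ⊗ₜ[ℝ] a) (w ⊗ₜ[ℝ] b) = starRingEnd ℂ z * w * formR o a b := by
  simp [hermL_apply, herm₀, conj_tmul, hodge₀, berezin, formR_apply]

theorem hermL_symm (ψ φ : H₀ V) : starRingEnd ℂ (hermL o ψ φ) = hermL o φ ψ := by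
  induction ψ using TensorProduct.induction_on with
  | zero => simp
  | tmul z a =>
    induction φ using TensorProduct.induction_on with
    | zero => simp
    | tmul w b =>
      rw [hermL_tmul, hermL_tmul, formR_symm]
      simp only [map_mul, Complex.conj_conj, Complex.conj_ofReal]
      ring
    | add x y hx hy => simp only [map_add, LinearMap.add_apply, hx, hy]
  | add x y hx hy => simp only [map_add, LinearMap.add_apply, hx, hy]

/-- For `ψ = a + ib` the cross terms cancel by symmetry of the real form, leaving two nonnegative
numbers with sum zero. -/
theorem eq_zero_of_hermL_self {ψ : H₀ V} (h : hermL o ψ ψ = 0) : ψ = 0 := by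
  obtain ⟨a, b, rfl⟩ := exists_re_im ψ
  simp only [map_add, LinearMap.add_apply, hermL_tmul, formR_symm o b a] at h
  have h' := congrArg Complex.re h
  simp at h'
  obtain ⟨pa, qa⟩ := formR_self o a
  obtain ⟨pb, qb⟩ := formR_self o b
  rw [qa (by linarith), qb (by linarith)]
  simp

theorem hermL_contract_left (x : V) (ψ φ : H₀ V) :
    hermL o (contract x ψ) φ = hermL o ψ ((1 / 2 : ℂ) • wedge (flat V x) φ) := by
  induction ψ using TensorProduct.induction_on with
  | zero => simp
  | tmul z a =>
    induction φ using TensorProduct.induction_on with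
    | zero => simp
    | tmul w b =>
      rw [contract_tmul, hermL_tmul, wedge_tmul, map_smul, hermL_tmul, formR_ι_mul_right,
        LinearEquiv.symm_apply_apply, map_smul contractR, LinearMap.smul_apply, map_smul (formR o),
        LinearMap.smul_apply]
      simp only [smul_eq_mul]
      push_cast
      ring
    | add x y hx hy => simp only [map_add, smul_add, hx, hy]
  | add x y hx hy => simp only [map_add, LinearMap.add_apply, hx, hy]

theorem hermL_contract_right (x : V) (ψ φ : H₀ V) :
    hermL o ψ (contract x φ) = hermL o ((1 / 2 : ℂ) • wedge (flat V x) ψ) φ := by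
  rw [← hermL_symm, hermL_contract_left, hermL_symm]

/-- Contraction and `½ ν(x) ∧ ·` are adjoint to each other, so their difference is skew-adjoint. The
scale `½` of the metric in `⋆₀` matches the `½` in `∇`. -/
theorem hermL_covDeriv (x : V) (ψ φ : H₀ V) :
    hermL o (covDeriv x ψ) φ = -hermL o ψ (covDeriv x φ) := by
  rw [covDeriv_apply, covDeriv_apply, map_sub, LinearMap.sub_apply, map_sub,
    hermL_contract_left, hermL_contract_right]
  ring

theorem hermL_covDerivC (v : Cplx V) (ψ φ : H₀ V) :
    hermL o (covDerivC v ψ) φ = -hermL o ψ (covDerivC (conjV V v) φ) := by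
  induction v using TensorProduct.induction_on with
  | zero => simp
  | tmul z x =>
    rw [conjV_tmul, covDerivC_tmul, covDerivC_tmul, LinearMap.smul_apply, LinearMap.smul_apply,
      LinearMap.map_smulₛₗ, LinearMap.smul_apply, hermL_covDeriv, map_smul, smul_neg]
  | add x y hx hy => simp only [map_add, LinearMap.add_apply, hx, hy]; ring

/-- The derivative of the Hermitian form. -/
theorem HasVecDerivWithinAt.hermL {f g : ℝ → H₀ V} {f' g' : H₀ V} {s : Set ℝ} {t : ℝ}
    (hf : HasVecDerivWithinAt f f' s t) (hg : HasVecDerivWithinAt g g' s t) :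
    HasDerivWithinAt (fun r => hermL o (f r) (g r)) (hermL o f' (g t) + hermL o (f t) g') s t :=
  hasVecDerivWithinAt_complex.mp
    ((hf.semilinear conjS).bilin hg
      ((LinearMap.mul ℂ (H₀ V)).compr₂ (berezin o) |>.compl₂ (hodge₀ o)))

theorem eq_of_hasDerivWithinAt_zero {E : Type*} [NormedAddCommGroup E] [NormedSpace ℝ E]
    {f : ℝ → E} (h : ∀ t ∈ Icc (0 : ℝ) 1, HasDerivWithinAt f 0 (Icc 0 1) t) {t : ℝ} (ht : t ∈ Icc (0 : ℝ) 1) :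
    f t = f 0 := by
  refine constant_of_has_deriv_right_zero (fun t ht => (h t ht).continuousWithinAt)
    (fun t ht => ?_) t ht
  exact (h t ⟨ht.1, ht.2.le⟩).mono_of_mem_nhdsWithin (Icc_mem_nhdsGE_of_mem ht)

/-- A curve starting at `0` whose velocity is orthogonal to it in the real sense vanishes. -/
theorem eq_zero_of_hermL_deriv {f : ℝ → H₀ V} (h0 : f 0 = 0)
    (h : ∀ t ∈ Icc (0 : ℝ) 1, ∃ f', HasVecDerivWithinAt f f' (Icc 0 1) t ∧
      hermL o f' (f t) + hermL o (f t) f' = 0) {t : ℝ} (ht : t ∈ Icc (0 : ℝ) 1) : f t = 0 := by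
  apply eq_zero_of_hermL_self o
  -- The squared norm has zero derivative and keeps its initial value.
  rw [eq_of_hasDerivWithinAt_zero (f := fun r => hermL o (f r) (f r)) (fun t ht => ?_) ht]
  · rw [h0]; simp
  · obtain ⟨f', h1, h2⟩ := h t ht
    have := h1.hermL o h1
    rwa [h2] at this

end Form

/-! ### One-parameter groups of rotations and geodesics -/

section Rotations

variable {V : Type*} [NormedAddCommGroup V] [InnerProductSpace ℝ V] [FiniteDimensional ℝ V]

instance completeSpace_of_finiteDimensional : CompleteSpace V := FiniteDimensional.complete ℝ V

/-- The one-parameter group `t ↦ exp(tA)`. -/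
def rot (A : V →L[ℝ] V) (t : ℝ) : V →L[ℝ] V := NormedSpace.exp (t • A)

/-- Skew-symmetric operators. -/
def IsSkew (A : V →L[ℝ] V) : Prop := ∀ x y, inner ℝ (A x) y = -inner ℝ x (A y)

variable {A : V →L[ℝ] V}

theorem rot_zero : rot A 0 = 1 := exp_zero_smul' A

theorem rot_add (s t : ℝ) : rot A (s + t) = rot A s * rot A t := exp_add_smul' A s t

theorem rot_mul_rot_neg (t : ℝ) : rot A t * rot A (-t) = 1 := exp_smul_mul_exp_neg_smul A t

theorem rot_neg_mul_rot (t : ℝ) : rot A (-t) * rot A t = 1 := by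
  rw [← rot_add, neg_add_cancel, rot_zero]

theorem hasDerivAt_rot (t : ℝ) : HasDerivAt (rot A) (A * rot A t) t :=
  hasDerivAt_exp_smul_const' (𝕂 := ℝ) A t

theorem hasDerivAt_rot_apply (x : V) (t : ℝ) :
    HasDerivAt (fun t => rot A t x) (A (rot A t x)) t :=
  (hasDerivAt_rot t).clm_apply (hasDerivAt_const t x) |>.congr_deriv (by simp)

theorem rot_inner (hA : IsSkew A) (t : ℝ) (x y : V) :
    inner ℝ (rot A t x) (rot A t y) = inner ℝ x y := by
  have h : ∀ t, HasDerivAt (fun t => inner ℝ (rot A t x) (rot A t y)) 0 t := by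
    intro t
    refine ((hasDerivAt_rot_apply x t).inner ℝ (hasDerivAt_rot_apply y t)).congr_deriv ?_
    rw [hA, add_neg_cancel]
  have := is_const_of_deriv_eq_zero (fun t => (h t).differentiableAt) (fun t => (h t).deriv) t 0
  simpa [rot_zero] using this

/-- The operator `J` intertwines `-A` with `A`, hence also their exponentials. -/
theorem rot_mul_of_anticommute {J : V →L[ℝ] V} (h : A * J = -(J * A)) (t : ℝ) :
    rot A t * J = J * rot A (-t) := by
  let := NormedAlgebra.restrictScalars ℚ ℝ (V →L[ℝ] V)
  have : SemiconjBy J ((-t) • A) (t • A) := by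
    rw [SemiconjBy, mul_smul_comm, smul_mul_assoc, h, neg_smul, smul_neg]
  exact (this.exp_right).symm

theorem rot_mul_of_commute {J : V →L[ℝ] V} (h : A * J = J * A) (t : ℝ) :
    rot A t * J = J * rot A t := by
  let := NormedAlgebra.restrictScalars ℚ ℝ (V →L[ℝ] V)
  have : SemiconjBy J (t • A) (t • A) := by
    rw [SemiconjBy, mul_smul_comm, smul_mul_assoc, h]
  exact (this.exp_right).symm

theorem commute_rot (t : ℝ) : A * rot A t = rot A t * A := (rot_mul_of_commute rfl t).symm

theorem commute_rot_apply (t : ℝ) (x : V) : A (rot A t x) = rot A t (A x) :=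
  congrArg (fun T : V →L[ℝ] V => T x) (commute_rot t)

/-- The operator is the square of the invertible operator `exp((t/2)A)`. -/
theorem det_rot_pos (t : ℝ) : 0 < LinearMap.det (rot A t : V →ₗ[ℝ] V) := by
  have h : rot A t = rot A (t / 2) * rot A (t / 2) := by rw [← rot_add, add_halves]
  have h2 : LinearMap.det (rot A (t / 2) : V →ₗ[ℝ] V) *
      LinearMap.det (rot A (-(t / 2)) : V →ₗ[ℝ] V) = 1 := by
    rw [← LinearMap.det_comp]
    have := congrArg (fun T : V →L[ℝ] V => LinearMap.det (T : V →ₗ[ℝ] V)) (rot_mul_rot_neg (A := A) (t / 2))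
    simpa using this
  have h3 : LinearMap.det (rot A t : V →ₗ[ℝ] V) =
      LinearMap.det (rot A (t / 2) : V →ₗ[ℝ] V) * LinearMap.det (rot A (t / 2) : V →ₗ[ℝ] V) := by
    rw [← LinearMap.det_comp, h]
    rfl
  rw [h3]
  exact mul_self_pos.mpr (left_ne_zero_of_mul_eq_one h2)

/-- `exp(tA)` as a linear equivalence. -/
def rotEquiv (A : V →L[ℝ] V) (t : ℝ) : V ≃ₗ[ℝ] V :=
  LinearEquiv.ofLinearMap (rot A t : V →ₗ[ℝ] V) (rot A (-t) : V →ₗ[ℝ] V)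
    (LinearMap.ext fun x => congrArg (fun T : V →L[ℝ] V => T x) (rot_mul_rot_neg t))
    (LinearMap.ext fun x => congrArg (fun T : V →L[ℝ] V => T x) (rot_neg_mul_rot t))

/-- `exp(tA)` as a linear isometry, for `A` skew. -/
def rotIsometry (hA : IsSkew A) (t : ℝ) : V ≃ₗᵢ[ℝ] V :=
  (rotEquiv A t).isometryOfInner (rot_inner hA t)

theorem eq_zero_of_sq_zero (hA : IsSkew A) {x : V} (h : A (A x) = 0) : A x = 0 := by
  have := hA x (A x)
  rw [h, inner_zero_right, neg_zero, inner_self_eq_zero] at this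
  exact this

/-- Both sides solve `u' = Au` with `u(0) = x`. For `θ = 0` the convention `sin 0 / 0 = 0` is
harmless, since a skew operator with `A² x = 0` has `A x = 0`. -/
theorem rot_eigen (hA : IsSkew A) {x : V} {θ : ℝ} (h : A (A x) = -(θ ^ 2) • x) (t : ℝ) :
    rot A t x = Real.cos (t * θ) • x + (Real.sin (t * θ) / θ) • A x := by
  by_cases hθ : θ = 0
  · subst hθ
    have hx : A x = 0 := eq_zero_of_sq_zero hA (by simpa using h)
    have hd : ∀ t, HasDerivAt (fun t => rot A t x) 0 t := by
      intro t
      refine (hasDerivAt_rot_apply x t).congr_deriv ?_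
      rw [commute_rot_apply, hx, map_zero]
    have := is_const_of_deriv_eq_zero (fun t => (hd t).differentiableAt) (fun t => (hd t).deriv) t 0
    simpa [hx, rot_zero] using this
  · set u : ℝ → V := fun t => Real.cos (t * θ) • x + (Real.sin (t * θ) / θ) • A x with hu
    have hu' : ∀ t, HasDerivAt u (A (u t)) t := by
      intro t
      have h1 : HasDerivAt (fun t : ℝ => t * θ) θ t := by simpa using (hasDerivAt_id t).mul_const θ
      have h2 := (h1.cos.smul_const x).add ((h1.sin.div_const θ).smul_const (A x))
      refine h2.congr_deriv ?_
      simp only [hu, map_add, map_smul, h, smul_smul]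
      rw [add_comm]
      congr 2
      · field_simp
      · field_simp
    have hd : ∀ t, HasDerivAt (fun t => rot A (-t) (u t)) 0 t := by
      intro t
      have h1 := ((hasDerivAt_rot (A := A) (-t)).scomp t (hasDerivAt_neg t)).clm_apply (hu' t)
      refine h1.congr_deriv ?_
      simp [commute_rot_apply]
    have h0 := is_const_of_deriv_eq_zero (fun t => (hd t).differentiableAt)
      (fun t => (hd t).deriv) t 0
    have h1 : u 0 = x := by simp [hu]
    simp only [neg_zero, rot_zero, h1] at h0
    have h2 : rot A (-t) (u t) = x := h0
    have h3 : rot A t (rot A (-t) (u t)) = u t :=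
      congrArg (fun T : V →L[ℝ] V => T (u t)) (rot_mul_rot_neg (A := A) t)
    rwa [h2] at h3

end Rotations

/-! ### Geodesics of the space of polarisations -/

section Geodesics

variable {V : Type*} [NormedAddCommGroup V] [InnerProductSpace ℝ V] [FiniteDimensional ℝ V]
  {n : ℕ} {o : Orientation ℝ V (Fin (2 * n))}

theorem Jg_sq (J : Jg o) : J.1 * J.1 = -1 := by
  ext x
  exact J.2.1 x

theorem Jg_apply_apply (J : Jg o) (x : V) : J.1 (J.1 x) = -x := J.2.1 x

theorem Jg_skew (J : Jg o) : IsSkew J.1 := by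
  intro x y
  have := J.2.2.1 x (J.1 y)
  rw [Jg_apply_apply, inner_neg_right] at this
  rw [← this, neg_neg]

theorem mem_tangent_iff {J : Jg o} {A : V →L[ℝ] V} :
    A ∈ tangent J ↔ A * J.1 = -(J.1 * A) ∧ IsSkew A := by
  refine and_congr ⟨fun h => ?_, fun h x => ?_⟩ Iff.rfl
  · ext x
    exact eq_neg_of_add_eq_zero_left (h x)
  · have := congrArg (fun T : V →L[ℝ] V => T x) h
    exact eq_neg_iff_add_eq_zero.mp this

/-- The operator `exp(tA) J` is `J` conjugated by `exp(tA/2)`. The half-way rotation therefore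
carries a positive complex frame of `J` to one of `exp(tA) J`, positive because its determinant is.
-/
theorem rot_mul_mem {J : Jg o} {A : V →L[ℝ] V} (hA : A ∈ tangent J) (t : ℝ) :
    rot A t * J.1 ∈ polarisations o := by
  obtain ⟨h1, h2⟩ := mem_tangent_iff.mp hA
  refine ⟨fun x => ?_, fun x y => ?_, ?_⟩
  · have : rot A t * J.1 * (rot A t * J.1) = -1 := by
      nth_rewrite 1 [rot_mul_of_anticommute h1]
      rw [mul_assoc, ← mul_assoc (rot A (-t)), rot_neg_mul_rot, one_mul, Jg_sq]
    exact congrArg (fun T : V →L[ℝ] V => T x) this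
  · exact (rot_inner h2 t _ _).trans (J.2.2.1 x y)
  · obtain ⟨b, hb, hbo⟩ := J.2.2.2
    refine ⟨b.map (rotEquiv A (t / 2)), fun k => ?_, ?_⟩
    · rw [Basis.map_apply, Basis.map_apply, hb]
      have : rot A (t / 2) * J.1 = rot A t * J.1 * rot A (t / 2) := by
        have e := rot_mul_of_anticommute h1 (-(t / 2))
        rw [neg_neg] at e
        have e2 : rot A t = rot A (t / 2) * rot A (t / 2) := by rw [← rot_add, add_halves]
        rw [e2, mul_assoc, mul_assoc, ← e, ← mul_assoc (rot A (t / 2)) (rot A (-(t / 2))),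
          rot_mul_rot_neg, one_mul]
      exact congrArg (fun T : V →L[ℝ] V => T (b ⟨2 * k, by omega⟩)) this
    · rw [Basis.orientation_map, hbo, Orientation.map_eq_iff_det_pos]
      · exact det_rot_pos (t / 2)
      · rw [finrank_eq_card_basis b]

/-- The geodesic `t ↦ exp(tA) J` of `J_g`. -/
def rotCurve (J : Jg o) {A : V →L[ℝ] V} (hA : A ∈ tangent J) (t : ℝ) : Jg o :=
  ⟨rot A t * J.1, rot_mul_mem hA t⟩

theorem hasDerivAt_rotCurve (J : Jg o) {A : V →L[ℝ] V} (hA : A ∈ tangent J) (t : ℝ) :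
    HasDerivAt (fun r => (rotCurve J hA r).1) (A * (rotCurve J hA t).1) t := by
  have := (hasDerivAt_rot (A := A) t).mul_const J.1
  rwa [mul_assoc] at this

theorem rotCurve_zero (J : Jg o) {A : V →L[ℝ] V} (hA : A ∈ tangent J) :
    rotCurve J hA 0 = J := by
  apply Subtype.ext
  simp [rotCurve, rot_zero]

/-- The velocity of a rotation curve anticommutes with it. -/
theorem rotCurve_mem_tangent (J : Jg o) {A : V →L[ℝ] V} (hA : A ∈ tangent J) (t : ℝ) :
    A ∈ tangent (rotCurve J hA t) := by
  obtain ⟨h1, h2⟩ := mem_tangent_iff.mp hA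
  refine mem_tangent_iff.mpr ⟨?_, h2⟩
  simp only [rotCurve]
  rw [← mul_assoc, commute_rot, mul_assoc, h1, mul_neg, mul_assoc]

theorem eta_eq_sum {ι : Type*} [Fintype ι] (b : OrthonormalBasis ι ℝ V) {A B : V →L[ℝ] V}
    (hA : IsSkew A) : eta A B = 1 / 4 * ∑ i, inner ℝ (A (b i)) (B (b i)) := by
  rw [eta, LinearMap.trace_eq_sum_inner _ b, neg_mul, ← mul_neg, ← Finset.sum_neg_distrib]
  congr 1
  refine Finset.sum_congr rfl fun i _ => ?_
  rw [hA]
  rfl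

theorem eta_comm (A B : V →L[ℝ] V) : eta A B = eta B A := by
  rw [eta, eta, ← Module.End.mul_eq_comp, LinearMap.trace_mul_comm]; rfl

theorem eq_zero_of_eta_self {A : V →L[ℝ] V} (hA : IsSkew A) (h : eta A A = 0) : A = 0 := by
  let b := stdOrthonormalBasis ℝ V
  rw [eta_eq_sum b hA] at h
  have h2 : ∑ i, inner ℝ (A (b i)) (A (b i)) = 0 := by linarith
  rw [Finset.sum_eq_zero_iff_of_nonneg (fun i _ => real_inner_self_nonneg)] at h2
  have : (A : V →ₗ[ℝ] V) = 0 := by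
    refine b.toBasis.ext fun i => ?_
    simpa using h2 i (Finset.mem_univ i)
  ext x
  exact LinearMap.congr_fun this x

/-- Conjugation by `J` preserves the trace but maps `YX` to `-YX`. -/
theorem eta_commute_anticommute {J : Jg o} {X Y : V →L[ℝ] V} (hY : Y * J.1 = J.1 * Y)
    (hX : X * J.1 = -(J.1 * X)) : eta Y X = 0 := by
  have h1 : J.1 * (Y * X) * J.1 = Y * X := by
    rw [mul_assoc, mul_assoc, hX, mul_neg, ← mul_assoc Y, hY, mul_neg, mul_assoc J.1 Y X,
      ← mul_assoc J.1 J.1, Jg_sq, neg_one_mul, neg_neg]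
  have h2 : J.1 * (J.1 * (Y * X)) = -(Y * X) := by
    rw [← mul_assoc, Jg_sq, neg_one_mul]
  have h3 : eta (J.1 * (Y * X)) J.1 = eta J.1 (J.1 * (Y * X)) := eta_comm _ _
  have h4 : ∀ B C : V →L[ℝ] V, eta B C =
      -(1 / 4) * LinearMap.trace ℝ V ((B * C : V →L[ℝ] V) : V →ₗ[ℝ] V) := fun _ _ => rfl
  have h5 : eta Y X = -eta Y X := by
    conv_lhs => rw [h4, ← h1, ← h4, h3, h4, h2]
    rw [h4]
    simp
  linarith

/-- The acceleration `A² J_t` commutes with `J_t`, which makes it orthogonal to the tangent space.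
-/
theorem isGeodesicOn_rotCurve (J : Jg o) {A : V →L[ℝ] V} (hA : A ∈ tangent J) (s : Set ℝ) :
    IsGeodesicOn (rotCurve J hA) s := by
  refine ⟨fun t => A * (rotCurve J hA t).1, fun t => A * (A * (rotCurve J hA t).1), fun t _ =>
    ⟨(hasDerivAt_rotCurve J hA t).hasDerivWithinAt,
      ((hasDerivAt_rotCurve J hA t).const_mul A).hasDerivWithinAt, fun X hX => ?_⟩⟩
  have h1 := (mem_tangent_iff.mp (rotCurve_mem_tangent J hA t)).1
  refine eta_commute_anticommute (J := rotCurve J hA t) ?_ (mem_tangent_iff.mp hX).1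
  have h1' := neg_eq_iff_eq_neg.mpr h1
  rw [← mul_assoc (rotCurve J hA t).1 A, ← h1', neg_mul, mul_assoc A (rotCurve J hA t).1,
    ← mul_assoc (rotCurve J hA t).1 A, ← h1', neg_mul, mul_neg, neg_neg, mul_assoc A]

theorem hasDerivWithinAt_unique {E : Type*} [NormedAddCommGroup E] [NormedSpace ℝ E] {f : ℝ → E}
    {a b : E} {t : ℝ} (ht : t ∈ Icc (0 : ℝ) 1) (ha : HasDerivWithinAt f a (Icc 0 1) t)
    (hb : HasDerivWithinAt f b (Icc 0 1) t) : a = b :=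
  (uniqueDiffOn_Icc zero_lt_one t ht).eq_deriv _ ha hb

theorem isSkew_of_hasDerivWithinAt {f : ℝ → V →L[ℝ] V} {f' : V →L[ℝ] V} {t : ℝ}
    (ht : t ∈ Icc (0 : ℝ) 1) (h : HasDerivWithinAt f f' (Icc 0 1) t)
    (hs : ∀ t ∈ Icc (0 : ℝ) 1, IsSkew (f t)) : IsSkew f' := by
  intro x y
  have hx := ((h.clm_apply (hasDerivWithinAt_const t _ x)).inner ℝ (hasDerivWithinAt_const t _ y))
  have hy := ((hasDerivWithinAt_const t (Icc (0 : ℝ) 1) x).inner ℝ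
    (h.clm_apply (hasDerivWithinAt_const t _ y)))
  have h0 := (hx.add hy).congr (f₁ := fun _ => (0 : ℝ)) (fun s hs' => by simp [hs s hs' x y])
    (by simp [hs t ht x y])
  have := hasDerivWithinAt_unique ht h0 (hasDerivWithinAt_const t _ 0)
  simp only [map_zero, zero_add, add_zero, inner_zero_right, inner_zero_left] at this
  linarith

/-- Geodesics of `J_g` are rotation curves. -/
theorem exists_rot_of_isGeodesicOn {γ : ℝ → Jg o} (hγ : IsGeodesicOn γ (Icc 0 1)) :
    ∃ A ∈ tangent (γ 0), ∀ t ∈ Icc (0 : ℝ) 1, (γ t).1 = rot A t * (γ 0).1 := by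
  obtain ⟨γ', γ'', h⟩ := hγ
  have hsk : ∀ t ∈ Icc (0 : ℝ) 1, IsSkew (γ' t) := fun t ht =>
    isSkew_of_hasDerivWithinAt ht (h t ht).1 fun s _ => Jg_skew (γ s)
  have hsk2 : ∀ t ∈ Icc (0 : ℝ) 1, IsSkew (γ'' t) := fun t ht =>
    isSkew_of_hasDerivWithinAt ht (h t ht).2.1 hsk
  have h1 : ∀ t ∈ Icc (0 : ℝ) 1, γ' t * (γ t).1 + (γ t).1 * γ' t = 0 := fun t ht => by
    refine hasDerivWithinAt_unique ht (((h t ht).1.mul (h t ht).1).congr_of_eventuallyEq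
      (f₁ := fun _ => (-1 : V →L[ℝ] V)) ?_ ?_) (hasDerivWithinAt_const t _ _)
    · exact Filter.Eventually.of_forall fun s => (Jg_sq (γ s)).symm
    · exact (Jg_sq (γ t)).symm
  have h2 : ∀ t ∈ Icc (0 : ℝ) 1, γ'' t * (γ t).1 + γ' t * γ' t +
      (γ' t * γ' t + (γ t).1 * γ'' t) = 0 := fun t ht => by
    refine hasDerivWithinAt_unique ht ((((h t ht).2.1.mul (h t ht).1).add
      ((h t ht).1.mul (h t ht).2.1)).congr (f₁ := fun _ => (0 : V →L[ℝ] V)) ?_ ?_)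
      (hasDerivWithinAt_const t _ _)
    · exact fun s hs => (h1 s hs).symm
    · exact (h1 t ht).symm
  -- The acceleration splits into a part `X` anticommuting with `J` and a part `Y` commuting with
  -- it. Here `X` is tangent and orthogonal to `Y`, so the geodesic equation tested on `X` gives
  -- `η(X, X) = 0`.
  have h3 : ∀ t ∈ Icc (0 : ℝ) 1, γ'' t * (γ t).1 = (γ t).1 * γ'' t := fun t ht => by
    set J := γ t
    set G := γ'' t
    have hJ := Jg_sq J
    set X := (1 / 2 : ℝ) • (G + J.1 * G * J.1) with hX
    set Y := (1 / 2 : ℝ) • (G - J.1 * G * J.1) with hY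
    have e1 : J.1 * G * J.1 * J.1 = -(J.1 * G) := by rw [mul_assoc, hJ, mul_neg_one]
    have e2 : J.1 * (J.1 * G * J.1) = -(G * J.1) := by
      rw [← mul_assoc, ← mul_assoc, hJ, neg_one_mul, neg_mul]
    have hXa : X * J.1 = -(J.1 * X) := by
      rw [hX, smul_mul_assoc, mul_smul_comm, add_mul, mul_add, e1, e2, ← smul_neg]
      congr 1
      abel
    have hYa : Y * J.1 = J.1 * Y := by
      rw [hY, smul_mul_assoc, mul_smul_comm, sub_mul, mul_sub, e1, e2]
      congr 1
      abel
    have hXs : IsSkew X := by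
      intro x y
      have a1 := hsk2 t ht x y
      have a2 : inner ℝ (J.1 (G (J.1 x))) y = -inner ℝ x (J.1 (G (J.1 y))) := by
        rw [Jg_skew, hsk2 t ht, Jg_skew, neg_neg]
      change inner ℝ ((1 / 2 : ℝ) • (G x + _)) y = -inner ℝ x ((1 / 2 : ℝ) • (G y + _))
      rw [real_inner_smul_left, real_inner_smul_right, inner_add_left, inner_add_right]
      change _ * (_ + inner ℝ (J.1 (G (J.1 x))) y) = -(_ * (_ + inner ℝ x (J.1 (G (J.1 y)))))
      rw [a1, a2]
      ring
    have hG : G = X + Y := by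
      rw [hX, hY, ← smul_add]
      module
    have hz : eta G X = 0 := (h t ht).2.2 X (mem_tangent_iff.mpr ⟨hXa, hXs⟩)
    have hz2 : eta X X = 0 := by
      have e3 : eta (X + Y) X = eta X X + eta Y X := by
        have h4 : ∀ B C : V →L[ℝ] V, eta B C =
          -(1 / 4) * LinearMap.trace ℝ V ((B * C : V →L[ℝ] V) : V →ₗ[ℝ] V) := fun _ _ => rfl
        rw [h4, h4, h4, add_mul]
        simp only [ContinuousLinearMap.toLinearMap_add, map_add]
        ring
      rw [hG, e3, eta_commute_anticommute hYa hXa, add_zero] at hz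
      exact hz
    rw [hG, eq_zero_of_eta_self hXs hz2, zero_add, hYa]
  -- Conservation of angular momentum: as `γ''` commutes with `γ`, the derivative `γ''γ + γ'γ'` is
  -- half the second derivative of `γ² = -1`.
  have hA : ∀ t ∈ Icc (0 : ℝ) 1, -(γ' t * (γ t).1) = -(γ' 0 * (γ 0).1) := fun t ht => by
    refine eq_of_hasDerivWithinAt_zero (f := fun t => -(γ' t * (γ t).1)) (fun t ht => ?_) ht
    refine ((h t ht).2.1.mul (h t ht).1).neg.congr_deriv ?_
    have := h2 t ht
    rw [← h3 t ht] at this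
    have e : (2 : ℝ) • (γ'' t * (γ t).1 + γ' t * γ' t) = 0 := by
      rw [two_smul, ← this]
      abel
    rw [(smul_eq_zero.mp e).resolve_left two_ne_zero, neg_zero]
  set A := -(γ' 0 * (γ 0).1) with hAdef
  have h01 : (0 : ℝ) ∈ Icc (0 : ℝ) 1 := ⟨le_rfl, zero_le_one⟩
  have hγ' : ∀ t ∈ Icc (0 : ℝ) 1, A * (γ t).1 = γ' t := fun t ht => by
    rw [← hA t ht, neg_mul, mul_assoc, Jg_sq, mul_neg_one, neg_neg]
  have hAJ : A * (γ 0).1 = -((γ 0).1 * A) := by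
    have e := eq_neg_of_add_eq_zero_left (h1 0 h01)
    rw [hγ' 0 h01, hAdef, mul_neg, neg_neg, ← mul_assoc, ← neg_eq_iff_eq_neg.mpr e, neg_mul,
      mul_assoc, Jg_sq, mul_neg_one, neg_neg]
  refine ⟨A, mem_tangent_iff.mpr ⟨hAJ, fun x y => ?_⟩, fun t ht => ?_⟩
  · have e := congrArg (fun T : V →L[ℝ] V => T y) (eq_neg_of_add_eq_zero_left (h1 0 h01))

    change inner ℝ (-(γ' 0 ((γ 0).1 x))) y = -inner ℝ x (-(γ' 0 ((γ 0).1 y)))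
    rw [inner_neg_left, hsk 0 h01, Jg_skew]
    have e' : γ' 0 ((γ 0).1 y) = -((γ 0).1 (γ' 0 y)) := e
    rw [e', neg_neg, neg_neg]
  -- Since `γ' = Aγ` with `A` constant, the curve `exp(-tA) γ(t)` stands still.
  · have hd : rot A (-t) * (γ t).1 = rot A (-0) * (γ 0).1 := by
      refine eq_of_hasDerivWithinAt_zero (f := fun t => rot A (-t) * (γ t).1) (fun t ht => ?_) ht
      have e := ((hasDerivAt_rot (A := A) (-t)).scomp t (hasDerivAt_neg t)).hasDerivWithinAt
        (s := Icc 0 1)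
      refine (e.mul (h t ht).1).congr_deriv ?_
      rw [← hγ' t ht, neg_one_smul, commute_rot, neg_mul, mul_assoc, Function.comp_apply,
        neg_add_cancel]
    rw [neg_zero, rot_zero, one_mul] at hd
    rw [← hd, ← mul_assoc, rot_mul_rot_neg, one_mul]

end Geodesics

/-! ### Adapted eigenbases and the cut locus -/

section Eigenbasis

variable {V : Type*} [NormedAddCommGroup V] [InnerProductSpace ℝ V] [FiniteDimensional ℝ V]
  {n : ℕ} {o : Orientation ℝ V (Fin (2 * n))}

theorem exists_eigenvector_mem {S : V →ₗ[ℝ] V} (hS : S.IsSymmetric) {W : Submodule ℝ V}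
    (hW : W ≠ ⊥) (hSW : ∀ x ∈ W, S x ∈ W) : ∃ x ∈ W, ‖x‖ = 1 ∧ ∃ c : ℝ, S x = c • x := by
  have hnt : Nontrivial W := Submodule.nontrivial_iff_ne_bot.mpr hW
  have hsym := hS.restrict_invariant hSW
  have hpos : 0 < finrank ℝ W := finrank_pos
  let i : Fin (finrank ℝ W) := ⟨0, hpos⟩
  refine ⟨hsym.eigenvectorBasis rfl i, SetLike.coe_mem _, ?_, hsym.eigenvalues rfl i, ?_⟩
  · exact (hsym.eigenvectorBasis rfl).orthonormal.1 i
  · have := congrArg Subtype.val (hsym.apply_eigenvectorBasis rfl i)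
    exact this

theorem finrank_eq_of_Jg (J : Jg o) : finrank ℝ V = 2 * n := by
  obtain ⟨b, -⟩ := J.2.2.2
  rw [finrank_eq_card_basis b, Fintype.card_fin]

/-- A spectral theorem for `A²` respecting `J`: the orthogonal complement of the `x_i, J x_i` found
so far is stable under the symmetric operator `A²`, and it is nonzero as long as fewer than `n`
vectors have been chosen. -/
theorem exists_eigenfamily (J : Jg o) {A : V →L[ℝ] V} (hA : A ∈ tangent J) (k : ℕ) (hk : k ≤ n) :
    ∃ x : Fin k → V, (∀ i j, inner ℝ (x i) (x j) = if i = j then (1 : ℝ) else 0) ∧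
      (∀ i j, inner ℝ (x i) (J.1 (x j)) = (0 : ℝ)) ∧
      ∀ i, A (A (x i)) = -(‖A (x i)‖ ^ 2) • x i := by
  obtain ⟨hAJ, hsk⟩ := mem_tangent_iff.mp hA
  have hAJ' : ∀ x, A (J.1 x) = -J.1 (A x) := fun x => congrArg (fun T : V →L[ℝ] V => T x) hAJ
  induction k with
  | zero => exact ⟨Fin.elim0, fun i => i.elim0, fun i => i.elim0, fun i => i.elim0⟩
  | succ k ih =>
    obtain ⟨x, h1, h2, h3⟩ := ih (by omega)
    let f : Fin k ⊕ Fin k → V := Sum.elim x (fun i => J.1 (x i))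
    let U : Submodule ℝ V := Submodule.span ℝ (Set.range f)
    have hU : U ≠ ⊤ := by
      intro hU
      have := finrank_range_le_card (R := ℝ) f
      rw [Set.finrank, show Submodule.span ℝ (Set.range f) = ⊤ from hU, finrank_top,
        finrank_eq_of_Jg J, Fintype.card_sum, Fintype.card_fin] at this
      omega
    have hU' : Uᗮ ≠ ⊥ := fun h => hU (Submodule.orthogonal_eq_bot_iff.mp h)
    have hmem : ∀ y, y ∈ Uᗮ ↔ ∀ i, inner ℝ (x i) y = (0 : ℝ) ∧ inner ℝ (J.1 (x i)) y = (0 : ℝ) := by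
      intro y
      rw [Submodule.mem_orthogonal]
      refine ⟨fun h i => ⟨h _ (Submodule.subset_span ⟨Sum.inl i, rfl⟩),
        h _ (Submodule.subset_span ⟨Sum.inr i, rfl⟩)⟩, fun h u hu => ?_⟩
      induction hu using Submodule.span_induction with
      | mem u hu =>
        obtain ⟨i | i, rfl⟩ := hu
        · exact (h i).1
        · exact (h i).2
      | zero => exact inner_zero_left _
      | add a b _ _ ha hb => rw [inner_add_left, ha, hb, add_zero]
      | smul c a _ ha => rw [real_inner_smul_left, ha, mul_zero]
    have hS : ((A * A : V →L[ℝ] V) : V →ₗ[ℝ] V).IsSymmetric := by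
      intro a b
      change inner ℝ (A (A a)) b = inner ℝ a (A (A b))
      rw [hsk, hsk, neg_neg]
    obtain ⟨y, hyU, hy1, c, hc⟩ := exists_eigenvector_mem hS hU' (by
      intro y hy
      rw [hmem] at hy ⊢
      intro i
      obtain ⟨hy1, hy2⟩ := hy i
      change inner ℝ _ (A (A y)) = (0 : ℝ) ∧ inner ℝ _ (A (A y)) = (0 : ℝ)
      have e : ∀ z, inner ℝ z (A (A y)) = (inner ℝ (A (A z)) y : ℝ) := fun z => by
        rw [hsk, hsk, neg_neg]
      rw [e, e, hAJ', map_neg, hAJ', neg_neg, h3, map_smul, real_inner_smul_left,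
        real_inner_smul_left, hy1, hy2, mul_zero]
      exact ⟨rfl, rfl⟩)
    have hc' : A (A y) = c • y := hc
    have hyy : inner ℝ y y = (1 : ℝ) := by rw [real_inner_self_eq_norm_sq, hy1, one_pow]
    -- Skewness shows that the eigenvalue is minus a square, so the angle can be taken to be the
    -- norm of `A y`.
    have hcy : c = -(‖A y‖ ^ 2) := by
      have : inner ℝ (A y) (A y) = -(inner ℝ y (A (A y)) : ℝ) := hsk y (A y)
      rw [hc', real_inner_smul_right, hyy, real_inner_self_eq_norm_sq] at this
      linarith
    have hyJ : ∀ z, inner ℝ z (J.1 z) = (0 : ℝ) := fun z => by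
      have := Jg_skew J z z
      rw [real_inner_comm] at this
      linarith
    rw [hmem] at hyU
    refine ⟨Fin.cons y x, ?_, ?_, ?_⟩
    · intro i j
      refine Fin.cases ?_ (fun i => ?_) i <;> refine Fin.cases ?_ (fun j => ?_) j
      · simp [hy1]
      · simp only [Fin.cons_zero, Fin.cons_succ]
        rw [real_inner_comm, (hyU j).1, if_neg (Fin.succ_ne_zero j).symm]
      · simp only [Fin.cons_zero, Fin.cons_succ]
        rw [(hyU i).1, if_neg (Fin.succ_ne_zero i)]
      · simp only [Fin.cons_succ, h1, Fin.succ_inj]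
    · intro i j
      refine Fin.cases ?_ (fun i => ?_) i <;> refine Fin.cases ?_ (fun j => ?_) j
      · exact hyJ y
      · simp only [Fin.cons_zero, Fin.cons_succ]
        rw [real_inner_comm, (hyU j).2]
      · simp only [Fin.cons_zero, Fin.cons_succ]
        have := Jg_skew J (x i) y
        rw [(hyU i).2] at this
        linarith
      · simpa only [Fin.cons_succ] using h2 i j
    · intro i
      refine Fin.cases ?_ (fun i => ?_) i
      · simp only [Fin.cons_zero]
        rw [← hcy, hc']
      · simpa only [Fin.cons_succ] using h3 i

/-- A unitary basis of `(V, J)` that diagonalises `A²`. -/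
structure Eigenbasis (J : Jg o) (A : V →L[ℝ] V) where
  /-- the orthonormal basis -/
  b : OrthonormalBasis (Fin n × Fin 2) ℝ V
  /-- the angles -/
  θ : Fin n → ℝ
  θ_nonneg : ∀ k, 0 ≤ θ k
  J_b : ∀ k, J.1 (b (k, 0)) = b (k, 1)
  A_A_b : ∀ p, A (A (b p)) = -(θ p.1 ^ 2) • b p

theorem nonempty_eigenbasis (J : Jg o) {A : V →L[ℝ] V} (hA : A ∈ tangent J) :
    Nonempty (Eigenbasis J A) := by
  obtain ⟨hAJ, hsk⟩ := mem_tangent_iff.mp hA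
  have hAJ' : ∀ x, A (J.1 x) = -J.1 (A x) := fun x => congrArg (fun T : V →L[ℝ] V => T x) hAJ
  obtain ⟨x, h1, h2, h3⟩ := exists_eigenfamily J hA n le_rfl
  let v : Fin n × Fin 2 → V := fun p => if p.2 = 0 then x p.1 else J.1 (x p.1)
  have hv : Orthonormal ℝ v := by
    rw [orthonormal_iff_ite]
    rintro ⟨i, a⟩ ⟨j, c⟩
    fin_cases a <;> fin_cases c
    · simp [v, h1]
    · simp [v, h2]
    · have := h2 j i
      rw [real_inner_comm] at this
      simp [v, this]
    · simp [v, J.2.2.1, h1]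
  have hspan : ⊤ ≤ Submodule.span ℝ (Set.range v) := by
    have := hv.linearIndependent.span_eq_top_of_card_eq_finrank' (by
      rw [finrank_eq_of_Jg J]; simp [mul_comm])
    exact this.ge
  refine ⟨⟨OrthonormalBasis.mk hv hspan, fun k => ‖A (x k)‖, fun _ => norm_nonneg _, ?_, ?_⟩⟩
  · intro k
    simp [v]
  · rintro ⟨k, a⟩
    rw [OrthonormalBasis.coe_mk]
    fin_cases a
    · simpa [v] using h3 k
    · simp only [v]
      simp only [Fin.mk_one, Fin.isValue, one_ne_zero, if_false]
      rw [hAJ', map_neg, hAJ', neg_neg, h3, map_smul]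

variable {J : Jg o} {A : V →L[ℝ] V}

theorem Eigenbasis.norm_A_b (E : Eigenbasis J A) (hA : IsSkew A) (p : Fin n × Fin 2) :
    inner ℝ (A (E.b p)) (A (E.b p)) = E.θ p.1 ^ 2 := by
  rw [hA, E.A_A_b, real_inner_smul_right, real_inner_self_eq_norm_sq, E.b.orthonormal.1]
  ring

theorem Eigenbasis.eta_self (E : Eigenbasis J A) (hA : IsSkew A) :
    eta A A = 1 / 4 * ∑ p : Fin n × Fin 2, E.θ p.1 ^ 2 := by
  rw [eta_eq_sum E.b hA]
  simp only [E.norm_A_b hA]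

/-- Anticommutation gives `(AJ)² = A²`, so rotation curves have constant speed. -/
theorem eta_mul_Jg (hA : A ∈ tangent J) : eta (A * J.1) (A * J.1) = eta A A := by
  have h1 := (mem_tangent_iff.mp hA).1
  have h4 : ∀ B C : V →L[ℝ] V, eta B C =
    -(1 / 4) * LinearMap.trace ℝ V ((B * C : V →L[ℝ] V) : V →ₗ[ℝ] V) := fun _ _ => rfl
  rw [h4, h4]
  congr 3
  nth_rewrite 2 [h1]
  rw [mul_neg, mul_assoc, ← mul_assoc J.1 J.1, Jg_sq, neg_one_mul, mul_neg, neg_neg]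

theorem curveLength_rotCurve (J : Jg o) (hA : A ∈ tangent J) {T : ℝ} (hT : 0 < T) :
    curveLength (rotCurve J hA) 0 T = T * √(eta A A) := by
  rw [curveLength]
  have : ∀ t ∈ Set.uIcc 0 T, √(eta (derivWithin (fun r => (rotCurve J hA r).1) (Icc 0 T) t)
    (derivWithin (fun r => (rotCurve J hA r).1) (Icc 0 T) t)) = √(eta A A) := by
    intro t ht
    rw [Set.uIcc_of_le hT.le] at ht
    rw [((hasDerivAt_rotCurve J hA t).hasDerivWithinAt).derivWithin
      (uniqueDiffOn_Icc hT t ht), eta_mul_Jg (rotCurve_mem_tangent J hA t)]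
  rw [intervalIntegral.integral_congr this]
  simp

theorem contDiff_rotCurve (J : Jg o) (hA : A ∈ tangent J) :
    ContDiff ℝ 1 (fun r => (rotCurve J hA r).1) := by
  rw [contDiff_one_iff_deriv]
  refine ⟨fun t => (hasDerivAt_rotCurve J hA t).differentiableAt, ?_⟩
  have : deriv (fun r => (rotCurve J hA r).1) = fun t => A * (rotCurve J hA t).1 :=
    funext fun t => (hasDerivAt_rotCurve J hA t).deriv
  rw [this]
  have hc : Continuous fun r => (rotCurve J hA r).1 :=
    continuous_iff_continuousAt.mpr fun t => (hasDerivAt_rotCurve J hA t).continuousAt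
  exact continuous_const.mul hc

end Eigenbasis

/-! ### Lengths of curves on the unit sphere -/

section SphereLength

variable {V : Type*} [NormedAddCommGroup V] [InnerProductSpace ℝ V]

/-- A curve on the unit sphere is at least as long as the angle between its endpoints. -/
theorem angle_le_length {u u' : ℝ → V} (hu : ∀ t ∈ Icc (0 : ℝ) 1, ‖u t‖ = 1)
    (hd : ∀ t ∈ Icc (0 : ℝ) 1, HasDerivWithinAt u (u' t) (Icc 0 1) t)
    (hc : ContinuousOn u' (Icc 0 1)) {α : ℝ} (h0 : 0 ≤ α) (hπ : α ≤ Real.pi)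
    (hα : inner ℝ (u 0) (u 1) = Real.cos α) : α ≤ ∫ t in (0 : ℝ)..1, ‖u' t‖ := by
  have h01 : (0 : ℝ) ∈ Icc (0 : ℝ) 1 := ⟨le_rfl, zero_le_one⟩
  set f : ℝ → ℝ := fun t => inner ℝ (u 0) (u t) with hf
  have hfd : ∀ t ∈ Icc (0 : ℝ) 1, HasDerivWithinAt f (inner ℝ (u 0) (u' t)) (Icc 0 1) t := by
    intro t ht
    simpa using (hasDerivWithinAt_const t (Icc (0 : ℝ) 1) (u 0)).inner ℝ (hd t ht)
  have horth : ∀ t ∈ Icc (0 : ℝ) 1, inner ℝ (u t) (u' t) = (0 : ℝ) := by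
    intro t ht
    have e := ((hd t ht).inner ℝ (hd t ht)).congr (f₁ := fun _ => (1 : ℝ))
      (fun s hs => by rw [real_inner_self_eq_norm_sq, hu s hs, one_pow])
      (by rw [real_inner_self_eq_norm_sq, hu t ht, one_pow])
    have e2 := hasDerivWithinAt_unique ht e (hasDerivWithinAt_const t _ 1)
    rw [real_inner_comm] at e2
    rw [real_inner_comm]
    linarith
  have hf1 : ∀ t ∈ Icc (0 : ℝ) 1, f t ^ 2 ≤ 1 := by
    intro t ht
    have := abs_real_inner_le_norm (u 0) (u t)
    rw [hu 0 h01, hu t ht, one_mul] at this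
    exact (sq_le_one_iff_abs_le_one _).mpr this
  -- The velocity is orthogonal to `u t`, so it only sees the component of `u 0` orthogonal to `u
  -- t`, of length `√(1 - f²)`.
  have hbound : ∀ t ∈ Icc (0 : ℝ) 1, |inner ℝ (u 0) (u' t)| ≤ √(1 - f t ^ 2) * ‖u' t‖ := by
    intro t ht
    have e1 : inner ℝ (u 0) (u' t) = inner ℝ (u 0 - f t • u t) (u' t) := by
      rw [inner_sub_left, real_inner_smul_left, horth t ht, mul_zero, sub_zero]
    have e2 : ‖u 0 - f t • u t‖ = √(1 - f t ^ 2) := by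
      symm
      rw [Real.sqrt_eq_iff_mul_self_eq (by linarith [hf1 t ht]) (norm_nonneg _), ← sq,
        ← real_inner_self_eq_norm_sq, inner_sub_left, inner_sub_right, inner_sub_right,
        real_inner_smul_left, real_inner_smul_left, real_inner_smul_right, real_inner_smul_right,
        real_inner_self_eq_norm_sq, real_inner_self_eq_norm_sq, hu 0 h01, hu t ht,
        real_inner_comm (u 0) (u t)]
      simp only [hf]
      ring
    rw [e1, ← e2]
    exact abs_real_inner_le_norm _ _
  -- The angle to `u 0` is `arccos f`, but `arccos` is not differentiable at `±1`. The factor `1 -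
  -- ε` keeps away from these points and is removed by a limit.
  have key : ∀ ε ∈ Ioo (0 : ℝ) 1, Real.arccos ((1 - ε) * Real.cos α) - Real.arccos (1 - ε) ≤
      ∫ t in (0 : ℝ)..1, ‖u' t‖ := by
    intro ε hε
    have hlt : ∀ t ∈ Icc (0 : ℝ) 1, ((1 - ε) * f t) ^ 2 < 1 := by
      intro t ht
      have := hf1 t ht
      have h1 : (1 - ε) ^ 2 < 1 := by nlinarith [hε.1, hε.2]
      rw [mul_pow]
      nlinarith [sq_nonneg (f t), sq_nonneg (1 - ε)]
    have hne : ∀ t ∈ Icc (0 : ℝ) 1, (1 - ε) * f t ≠ -1 ∧ (1 - ε) * f t ≠ 1 := by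
      intro t ht
      have := hlt t ht
      constructor <;> intro h <;> rw [h] at this <;> norm_num at this
    have hg : ∀ t ∈ Icc (0 : ℝ) 1, HasDerivWithinAt (fun t => Real.arccos ((1 - ε) * f t))
        (-(1 / √(1 - ((1 - ε) * f t) ^ 2)) * ((1 - ε) * inner ℝ (u 0) (u' t))) (Icc 0 1) t := by
      intro t ht
      exact HasDerivAt.comp_hasDerivWithinAt (h₂ := Real.arccos) t
        (Real.hasDerivAt_arccos (hne t ht).1 (hne t ht).2) ((hfd t ht).const_mul (1 - ε))
    have hint : MeasureTheory.IntegrableOn (fun t => ‖u' t‖) (Icc 0 1) :=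
      hc.norm.integrableOn_Icc
    have := intervalIntegral.sub_le_integral_of_hasDeriv_right_of_le zero_le_one
      (fun t ht => (hg t ht).continuousWithinAt)
      (fun t ht => (hg t ⟨ht.1.le, ht.2.le⟩).mono_of_mem_nhdsWithin
        (mem_nhdsWithin_of_mem_nhds (Icc_mem_nhds ht.1 ht.2))) hint
      (fun t ht => by
        have ht' : t ∈ Icc (0 : ℝ) 1 := ⟨ht.1.le, ht.2.le⟩
        have hs : 0 < √(1 - ((1 - ε) * f t) ^ 2) := Real.sqrt_pos.mpr (by linarith [hlt t ht'])
        have hb := hbound t ht'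
        have hle : (1 - ε) * √(1 - f t ^ 2) ≤ √(1 - ((1 - ε) * f t) ^ 2) := by
          apply Real.le_sqrt_of_sq_le
          rw [mul_pow, Real.sq_sqrt (by linarith [hf1 t ht'])]
          nlinarith [hε.1, hε.2, sq_nonneg (f t)]
        rw [neg_mul, one_div, ← mul_neg, inv_mul_le_iff₀ hs]
        calc -((1 - ε) * inner ℝ (u 0) (u' t)) ≤ (1 - ε) * |inner ℝ (u 0) (u' t)| := by
              rw [← mul_neg]
              exact mul_le_mul_of_nonneg_left (neg_le_abs _) (by linarith [hε.2])
          _ ≤ (1 - ε) * (√(1 - f t ^ 2) * ‖u' t‖) :=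
              mul_le_mul_of_nonneg_left hb (by linarith [hε.2])
          _ = (1 - ε) * √(1 - f t ^ 2) * ‖u' t‖ := by ring
          _ ≤ _ := mul_le_mul_of_nonneg_right hle (norm_nonneg _))
    have e0 : f 0 = 1 := by simp [hf, hu 0 h01]
    have e1 : f 1 = Real.cos α := hα
    simpa [e0, e1] using this
  have hlim : Filter.Tendsto (fun ε : ℝ => Real.arccos ((1 - ε) * Real.cos α) -
      Real.arccos (1 - ε)) (nhdsWithin 0 (Ioi 0)) (nhds α) := by
    have hcont : Continuous (fun ε : ℝ => Real.arccos ((1 - ε) * Real.cos α) -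
      Real.arccos (1 - ε)) := by fun_prop
    have := hcont.tendsto 0
    simp only [sub_zero, one_mul, Real.arccos_one, Real.arccos_cos h0 hπ] at this
    exact this.mono_left nhdsWithin_le_nhds
  refine le_of_tendsto hlim ?_
  filter_upwards [Ioo_mem_nhdsGT (zero_lt_one' ℝ)] with ε hε using key ε hε

end SphereLength

/-! ### Minimality while all angles are at most `π` -/

section CutLocus

variable {V : Type*} [NormedAddCommGroup V] [InnerProductSpace ℝ V] [FiniteDimensional ℝ V]
  {n : ℕ} {o : Orientation ℝ V (Fin (2 * n))} {J : Jg o} {A : V →L[ℝ] V}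

theorem A_A_J (hA : A ∈ tangent J) (x : V) : A (A (J.1 x)) = J.1 (A (A x)) := by
  have hAJ' : ∀ x, A (J.1 x) = -J.1 (A x) := fun x =>
    congrArg (fun T : V →L[ℝ] V => T x) (mem_tangent_iff.mp hA).1
  rw [hAJ', map_neg, hAJ', neg_neg]

theorem inner_self_skew (hA : IsSkew A) (x : V) : inner ℝ x (A x) = (0 : ℝ) := by
  have := hA x x
  rw [real_inner_comm] at this
  linarith

/-- A competing curve moves each basis vector along the unit sphere between two points at angle `T
θ_p ≤ π`, so that path has length at least `T θ_p`. Cauchy–Schwarz against the constant vector `(T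
θ_p)_p` combines these bounds into one for the `η`-length. -/
theorem isMinimising_rotCurve (hA : A ∈ tangent J) (E : Eigenbasis J A) {T : ℝ} (hT : 0 < T)
    (hle : ∀ k, T * E.θ k ≤ Real.pi) : IsMinimising (rotCurve J hA) T := by
  intro c hc hc0 hc1
  have hsk := (mem_tangent_iff.mp hA).2
  rw [rotCurve_zero] at hc0
  set c' : ℝ → V →L[ℝ] V := derivWithin (fun r => (c r).1) (Icc 0 1) with hc'
  have hd : ∀ t ∈ Icc (0 : ℝ) 1, HasDerivWithinAt (fun r => (c r).1) (c' t) (Icc 0 1) t :=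
    fun t ht => ((hc.differentiableOn one_ne_zero) t ht).hasDerivWithinAt
  have hcont : ContinuousOn c' (Icc 0 1) :=
    hc.continuousOn_derivWithin (uniqueDiffOn_Icc zero_lt_one) le_rfl
  have hskc : ∀ t ∈ Icc (0 : ℝ) 1, IsSkew (c' t) := fun t ht =>
    isSkew_of_hasDerivWithinAt ht (hd t ht) fun s _ => Jg_skew (c s)
  have hang : ∀ p : Fin n × Fin 2, T * E.θ p.1 ≤ ∫ t in (0 : ℝ)..1, ‖c' t (E.b p)‖ := by
    intro p
    refine angle_le_length (u := fun t => (c t).1 (E.b p)) ?_ ?_ ?_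
      (mul_nonneg hT.le (E.θ_nonneg _)) (hle _) ?_
    · intro t _
      have := (c t).2.2.1 (E.b p) (E.b p)
      rw [real_inner_self_eq_norm_sq, real_inner_self_eq_norm_sq, E.b.orthonormal.1] at this
      exact (sq_eq_sq₀ (norm_nonneg _) zero_le_one).mp this
    · intro t ht
      simpa using (hd t ht).clm_apply (hasDerivWithinAt_const t _ (E.b p))
    · exact hcont.clm_apply continuousOn_const
    · rw [hc0, hc1]
      change inner ℝ (J.1 (E.b p)) (rot A T (J.1 (E.b p))) = _
      rw [rot_eigen hsk (θ := E.θ p.1) (by rw [A_A_J hA, E.A_A_b, map_smul]), inner_add_right,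
        real_inner_smul_right, real_inner_smul_right, inner_self_skew hsk, J.2.2.1,
        real_inner_self_eq_norm_sq, E.b.orthonormal.1]
      ring
  rw [curveLength_rotCurve J hA hT, curveLength, E.eta_self hsk]
  -- `N` is twice the length of the rotation curve; the `½` from the normalisation of `η` occurs on
  -- both sides.
  set N := √(∑ p : Fin n × Fin 2, (T * E.θ p.1) ^ 2) with hN
  have hN2 : N ^ 2 = ∑ p : Fin n × Fin 2, (T * E.θ p.1) ^ 2 :=
    Real.sq_sqrt (Finset.sum_nonneg fun _ _ => sq_nonneg _)
  have hlhs : T * √(1 / 4 * ∑ p : Fin n × Fin 2, E.θ p.1 ^ 2) = 1 / 2 * N := by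
    rw [hN]
    simp only [mul_pow]
    rw [← Finset.mul_sum, Real.sqrt_mul (by positivity), Real.sqrt_mul (by positivity),
      Real.sqrt_sq hT.le, show (1 / 4 : ℝ) = (1 / 2) ^ 2 by norm_num, Real.sqrt_sq (by norm_num)]
    ring
  rw [hlhs]
  have heta : ∀ t ∈ Icc (0 : ℝ) 1, √(eta (c' t) (c' t)) =
      1 / 2 * √(∑ p : Fin n × Fin 2, ‖c' t (E.b p)‖ ^ 2) := by
    intro t ht
    rw [eta_eq_sum E.b (hskc t ht), Real.sqrt_mul (by norm_num),
      show (1 / 4 : ℝ) = (1 / 2) ^ 2 by norm_num, Real.sqrt_sq (by norm_num)]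
    simp only [real_inner_self_eq_norm_sq]
  rw [intervalIntegral.integral_congr (g := fun t => 1 / 2 *
    √(∑ p : Fin n × Fin 2, ‖c' t (E.b p)‖ ^ 2)) (fun t ht => by
      rw [Set.uIcc_of_le zero_le_one] at ht
      exact heta t ht), intervalIntegral.integral_const_mul]
  refine mul_le_mul_of_nonneg_left ?_ (by norm_num)
  have hcp : ∀ p : Fin n × Fin 2, ContinuousOn (fun t => ‖c' t (E.b p)‖) (Set.uIcc 0 1) := by
    intro p
    rw [Set.uIcc_of_le zero_le_one]
    exact (hcont.clm_apply continuousOn_const).norm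
  have hint : ∀ p : Fin n × Fin 2, IntervalIntegrable (fun t => ‖c' t (E.b p)‖)
      MeasureTheory.volume 0 1 := fun p => (hcp p).intervalIntegrable
  have hintS : IntervalIntegrable (fun t => √(∑ p : Fin n × Fin 2, ‖c' t (E.b p)‖ ^ 2))
      MeasureTheory.volume 0 1 :=
    (Real.continuous_sqrt.comp_continuousOn
      (continuousOn_finsetSum _ fun p _ => (hcp p).pow 2)).intervalIntegrable
  have hCS : N ^ 2 ≤ N * ∫ t in (0 : ℝ)..1, √(∑ p : Fin n × Fin 2, ‖c' t (E.b p)‖ ^ 2) := by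
    calc N ^ 2 = ∑ p : Fin n × Fin 2, (T * E.θ p.1) * (T * E.θ p.1) := by
          rw [hN2]; simp only [sq]
      _ ≤ ∑ p : Fin n × Fin 2, (T * E.θ p.1) * ∫ t in (0 : ℝ)..1, ‖c' t (E.b p)‖ :=
          Finset.sum_le_sum fun p _ => mul_le_mul_of_nonneg_left (hang p)
            (mul_nonneg hT.le (E.θ_nonneg _))
      _ = ∫ t in (0 : ℝ)..1, ∑ p : Fin n × Fin 2, (T * E.θ p.1) * ‖c' t (E.b p)‖ := by
          rw [intervalIntegral.integral_finsetSum fun p _ => (hint p).const_mul _]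
          simp only [intervalIntegral.integral_const_mul]
      _ ≤ ∫ t in (0 : ℝ)..1, N * √(∑ p : Fin n × Fin 2, ‖c' t (E.b p)‖ ^ 2) := by
          refine intervalIntegral.integral_mono_on zero_le_one ?_ (hintS.const_mul _) ?_
          · exact (continuousOn_finsetSum _ fun p _ =>
              (hcp p).const_mul (T * E.θ p.1)).intervalIntegrable
          · intro t _
            exact Real.sum_mul_le_sqrt_mul_sqrt _ _ _
      _ = _ := intervalIntegral.integral_const_mul _ _
  by_cases hN0 : N = 0
  · rw [hN0]
    exact intervalIntegral.integral_nonneg zero_le_one fun _ _ => Real.sqrt_nonneg _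
  · have hNpos : 0 < N := lt_of_le_of_ne (Real.sqrt_nonneg _) (Ne.symm hN0)
    rw [sq] at hCS
    exact le_of_mul_le_mul_left hCS hNpos

end CutLocus

/-! ### Failure of minimality beyond `π`, and the determinant of the mean -/

section CutLocusBound

variable {V : Type*} [NormedAddCommGroup V] [InnerProductSpace ℝ V] [FiniteDimensional ℝ V]
  {n : ℕ} {o : Orientation ℝ V (Fin (2 * n))} {J : Jg o} {A : V →L[ℝ] V}

/-- The function `c` of the symmetric operator with eigenbasis `b` and eigenvalues `θ`. -/
def Eigenbasis.calc (E : Eigenbasis J A) (c : ℝ → ℝ) : V →L[ℝ] V :=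
  ∑ p : Fin n × Fin 2, c (E.θ p.1) • (innerSL ℝ (E.b p)).smulRight (E.b p)

theorem Eigenbasis.calc_apply (E : Eigenbasis J A) (c : ℝ → ℝ) (x : V) :
    E.calc c x = ∑ p : Fin n × Fin 2, (c (E.θ p.1) * inner ℝ (E.b p) x) • E.b p := by
  simp [Eigenbasis.calc, mul_smul]

theorem Eigenbasis.calc_symm (E : Eigenbasis J A) (c : ℝ → ℝ) (x y : V) :
    inner ℝ (E.calc c x) y = inner ℝ x (E.calc c y) := by
  rw [E.calc_apply, E.calc_apply, sum_inner, inner_sum]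
  refine Finset.sum_congr rfl fun p _ => ?_
  rw [real_inner_smul_left, real_inner_smul_right, real_inner_comm x]
  ring

/-- An operator commuting with `A²` preserves its eigenspaces, so `N (b p)` has components only
along basis vectors with the angle of `b p`; nonnegative angles are determined by their squares. -/
theorem Eigenbasis.calc_comm_apply (hA : IsSkew A) (E : Eigenbasis J A) (c : ℝ → ℝ)
    {N : V →L[ℝ] V} (hN : ∀ x, N (A (A x)) = A (A (N x))) (p : Fin n × Fin 2) :
    E.calc c (N (E.b p)) = c (E.θ p.1) • N (E.b p) := by
  have key : ∀ q, c (E.θ q.1) * inner ℝ (E.b q) (N (E.b p)) =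
      c (E.θ p.1) * inner ℝ (E.b q) (N (E.b p)) := by
    intro q
    by_cases h : E.θ q.1 = E.θ p.1
    · rw [h]
    · have e1 : inner ℝ (A (A (E.b q))) (N (E.b p)) =
          (inner ℝ (E.b q) (A (A (N (E.b p)))) : ℝ) := by rw [hA, hA, neg_neg]
      rw [← hN, E.A_A_b, E.A_A_b, map_smul, real_inner_smul_left, real_inner_smul_right] at e1
      have e2 : (E.θ q.1 ^ 2 - E.θ p.1 ^ 2) * inner ℝ (E.b q) (N (E.b p)) = (0 : ℝ) := by
        linarith
      have e3 : E.θ q.1 ^ 2 - E.θ p.1 ^ 2 ≠ 0 := by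
        intro h'
        exact h ((sq_eq_sq₀ (E.θ_nonneg _) (E.θ_nonneg _)).mp (sub_eq_zero.mp h'))
      rw [(mul_eq_zero.mp e2).resolve_left e3, mul_zero, mul_zero]
  rw [E.calc_apply]
  simp only [key]
  simp only [mul_smul]
  rw [← Finset.smul_sum, E.b.sum_repr']

theorem Eigenbasis.calc_b (hA : IsSkew A) (E : Eigenbasis J A) (c : ℝ → ℝ) (p : Fin n × Fin 2) :
    E.calc c (E.b p) = c (E.θ p.1) • E.b p :=
  E.calc_comm_apply hA c (N := 1) (fun _ => rfl) p

theorem Eigenbasis.clm_ext (E : Eigenbasis J A) {S T : V →L[ℝ] V}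
    (h : ∀ p, S (E.b p) = T (E.b p)) : S = T := by
  have : (S : V →ₗ[ℝ] V) = T := E.b.toBasis.ext fun p => by simpa using h p
  ext x
  exact LinearMap.congr_fun this x

theorem Eigenbasis.calc_comm (hA : IsSkew A) (E : Eigenbasis J A) (c : ℝ → ℝ)
    {N : V →L[ℝ] V} (hN : ∀ x, N (A (A x)) = A (A (N x))) : E.calc c * N = N * E.calc c := by
  refine E.clm_ext fun p => ?_
  change E.calc c (N (E.b p)) = N (E.calc c (E.b p))
  rw [E.calc_comm_apply hA c hN, E.calc_b hA, map_smul]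

/-- A rotation by `tφ > π` has the same endpoint as the one by `tφ - 2π`, whose angle is smaller in
absolute value. Changing the generator in this way on the `φ`-eigenspace gives a strictly shorter
curve. -/
theorem not_isMinimising_rotCurve (hA : A ∈ tangent J) (E : Eigenbasis J A) {t : ℝ} (ht : 0 < t)
    {k : Fin n} (hk : Real.pi < t * E.θ k) : ¬ IsMinimising (rotCurve J hA) t := by
  classical
  obtain ⟨hAJ, hsk⟩ := mem_tangent_iff.mp hA
  set φ := E.θ k with hφ
  have hφpos : 0 < φ := by
    by_contra h
    have : φ = 0 := le_antisymm (not_lt.mp h) (E.θ_nonneg k)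
    rw [this, mul_zero] at hk
    exact absurd hk (not_lt.mpr Real.pi_pos.le)
  -- Every direction with angle `φ` is changed, not just the one of index `k`: `c` has to be a
  -- function of `A²` for `B` to stay skew and anticommute with `J`.
  let c : ℝ → ℝ := fun θ => if θ = φ then t - 2 * Real.pi / φ else t
  let B : V →L[ℝ] V := A * E.calc c
  have hcA : E.calc c * A = A * E.calc c := E.calc_comm hsk c fun _ => rfl
  have hcJ : E.calc c * J.1 = J.1 * E.calc c := E.calc_comm hsk c fun x => (A_A_J hA x).symm
  have hBb : ∀ p, B (E.b p) = c (E.θ p.1) • A (E.b p) := fun p => by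
    change A (E.calc c (E.b p)) = _
    rw [E.calc_b hsk, map_smul]
  have hBsk : IsSkew B := by
    intro x y
    change inner ℝ (A (E.calc c x)) y = -inner ℝ x (A (E.calc c y))
    rw [hsk, E.calc_symm]
    have : E.calc c (A y) = A (E.calc c y) := congrArg (fun T : V →L[ℝ] V => T y) hcA
    rw [this]
  have hB : B ∈ tangent J := by
    refine mem_tangent_iff.mpr ⟨?_, hBsk⟩
    change A * E.calc c * J.1 = -(J.1 * (A * E.calc c))
    rw [mul_assoc, hcJ, ← mul_assoc, hAJ, neg_mul, mul_assoc]
  have hBB : ∀ p, B (B (E.b p)) = -((c (E.θ p.1) * E.θ p.1) ^ 2) • E.b p := fun p => by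
    rw [hBb, map_smul]
    change c (E.θ p.1) • A (E.calc c (A (E.b p))) = _
    rw [E.calc_comm_apply hsk c fun _ => rfl, map_smul, E.A_A_b, smul_smul, smul_smul]
    congr 1
    ring
  have hrot : rot B 1 = rot A t := by
    refine E.clm_ext fun p => ?_
    rw [rot_eigen hBsk (hBB p), rot_eigen hsk (E.A_A_b p), hBb, smul_smul, one_mul]
    by_cases hp : E.θ p.1 = φ
    · have hc : c (E.θ p.1) = t - 2 * Real.pi / φ := by simp [c, hp]
      have e : c (E.θ p.1) * E.θ p.1 = t * φ - 2 * Real.pi := by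
        rw [hc, hp]; field_simp
      rw [e, Real.cos_sub_two_pi, Real.sin_sub_two_pi, hp]
      congr 2
      -- When the shortened angle is zero, the sine in both formulas vanishes and the division by
      -- zero does no harm.
      by_cases hz : t * φ - 2 * Real.pi = 0
      · have : t * φ = 2 * Real.pi := by linarith
        rw [this]
        simp
      · have : c φ = (t * φ - 2 * Real.pi) / φ := by
          rw [← hp, hc, hp]; field_simp
        rw [this]
        field_simp
    · have hc : c (E.θ p.1) = t := by simp [c, hp]
      rw [hc]
      congr 2
      field_simp
  intro hmin
  have h := hmin (rotCurve J hB) (contDiff_rotCurve J hB).contDiffOn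
    (by rw [rotCurve_zero, rotCurve_zero]) (by
      apply Subtype.ext
      change rot B 1 * J.1 = rot A t * J.1
      rw [hrot])
  rw [curveLength_rotCurve J hA ht, curveLength_rotCurve J hB one_pos, one_mul] at h
  have hlt : eta B B < t ^ 2 * eta A A := by
    have e0 : t ^ 2 * (1 / 4 * ∑ p : Fin n × Fin 2, E.θ p.1 ^ 2) =
        1 / 4 * ∑ p : Fin n × Fin 2, t ^ 2 * E.θ p.1 ^ 2 := by
      rw [← Finset.mul_sum]; ring
    rw [eta_eq_sum E.b hBsk, E.eta_self hsk, e0]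
    refine mul_lt_mul_of_pos_left ?_ (show (0 : ℝ) < 1 / 4 by norm_num)
    have hterm : ∀ p : Fin n × Fin 2, inner ℝ (B (E.b p)) (B (E.b p)) =
        (c (E.θ p.1) * E.θ p.1) ^ 2 := fun p => by
      rw [hBb, real_inner_smul_left, real_inner_smul_right, E.norm_A_b hsk]
      ring
    have hφterm : (c φ * φ) ^ 2 < t ^ 2 * φ ^ 2 := by
      have e : c φ * φ = t * φ - 2 * Real.pi := by
        simp only [c, if_true]; field_simp
      rw [e, ← mul_pow]
      have := Real.pi_pos
      nlinarith
    refine Finset.sum_lt_sum (fun p _ => ?_) ⟨(k, 0), Finset.mem_univ _, ?_⟩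
    · rw [hterm]
      by_cases hp : E.θ p.1 = φ
      · rw [hp]; exact hφterm.le
      · simp only [c, if_neg hp, mul_pow]; exact le_rfl
    · rw [hterm]
      exact hφterm
  have : √(eta B B) < t * √(eta A A) := by
    have e1 : 0 ≤ eta B B := by
      rw [eta_eq_sum E.b hBsk]
      exact mul_nonneg (by norm_num) (Finset.sum_nonneg fun _ _ => real_inner_self_nonneg)
    have e2 : 0 < eta A A := by
      by_contra h0
      nlinarith [sq_nonneg t]
    rw [Real.sqrt_lt' (mul_pos ht (Real.sqrt_pos.mpr e2)), mul_pow, Real.sq_sqrt e2.le]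
    exact hlt
  linarith

/-- Along a geodesic that stays away from the cut locus all angles are less than `π`. -/
theorem Eigenbasis.θ_lt_pi {γ : ℝ → Jg o} {A : V →L[ℝ] V} (hA : A ∈ tangent (γ 0))
    (hγ : ∀ t ∈ Icc (0 : ℝ) 1, (γ t).1 = rot A t * (γ 0).1)
    (hcut : ∀ t ∈ Icc (0 : ℝ) 1, γ t ∉ cutLocus (γ 0)) (E : Eigenbasis (γ 0) A) (k : Fin n) :
    E.θ k < Real.pi := by
  by_contra hk
  have : Nonempty (Fin n) := ⟨k⟩
  obtain ⟨m, hm⟩ := Finite.exists_max E.θ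
  have hmπ : Real.pi ≤ E.θ m := (not_lt.mp hk).trans (hm k)
  have hmpos : 0 < E.θ m := Real.pi_pos.trans_le hmπ
  have hT : 0 < Real.pi / E.θ m := div_pos Real.pi_pos hmpos
  have hT1 : Real.pi / E.θ m ≤ 1 := (div_le_one hmpos).mpr hmπ
  -- The largest angle reaches `π` at the time `π / θ_m ≤ 1`, so this point of the geodesic is a cut
  -- point.
  refine hcut (Real.pi / E.θ m) ⟨hT.le, hT1⟩ ⟨rotCurve (γ 0) hA, Real.pi / E.θ m, hT,
    isGeodesicOn_rotCurve _ hA _, rotCurve_zero _ hA, ?_, ?_, fun t ht => ?_⟩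
  · exact Subtype.ext (hγ _ ⟨hT.le, hT1⟩).symm
  · refine isMinimising_rotCurve hA E hT fun j => ?_
    rw [div_mul_eq_mul_div, div_le_iff₀ hmpos]
    exact mul_le_mul_of_nonneg_left (hm j) Real.pi_pos.le
  · exact not_isMinimising_rotCurve hA E (hT.trans ht) (k := m) ((div_lt_iff₀ hmpos).mp ht)

theorem det_rot_eq_one (hA : IsSkew A) (t : ℝ) : LinearMap.det (rot A t : V →ₗ[ℝ] V) = 1 := by
  let a := stdOrthonormalBasis ℝ V
  have h := a.det_to_matrix_orthonormalBasis (a.map (rotIsometry hA t))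
  have e : a.toBasis.det (a.map (rotIsometry hA t)) = LinearMap.det (rot A t : V →ₗ[ℝ] V) := by
    have := a.toBasis.det_comp (rot A t : V →ₗ[ℝ] V) a.toBasis
    rw [a.toBasis.det_self, mul_one] at this
    rw [← this]
    congr 1
  rw [e, Real.norm_eq_abs, abs_of_pos (det_rot_pos t)] at h
  exact h

/-- A complex structure is itself a rotation, `J = exp((π/2) J)`. -/
theorem det_Jg (J : Jg o) : LinearMap.det (J.1 : V →ₗ[ℝ] V) = 1 := by
  have : J.1 = rot J.1 (Real.pi / 2) := by
    ext x
    rw [rot_eigen (Jg_skew J) (θ := 1) (by rw [Jg_apply_apply]; simp)]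
    simp
  rw [this, det_rot_eq_one (Jg_skew J)]

/-- The determinant of the mean is a product of cosines. -/
theorem Eigenbasis.detMean_eq (hA : A ∈ tangent J) (E : Eigenbasis J A) {J₁ : Jg o} {t : ℝ}
    (h : J₁.1 = rot A t * J.1) :
    detMean J J₁ = (∏ k, Real.cos (t * E.θ k / 2)) ^ 2 := by
  obtain ⟨hAJ, hsk⟩ := mem_tangent_iff.mp hA
  -- Taking the half-way rotation out of `(J + exp(tA) J)/2` leaves the even part of `exp((t/2)A)`,
  -- which is diagonal with entries `cos(tθ/2)`. Each `θ_k` occurs for two basis vectors, hence the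
  -- square.
  let C : V →L[ℝ] V := (1 / 2 : ℝ) • (rot A (-(t / 2)) + rot A (t / 2))
  have hC : (1 / 2 : ℝ) • ((J.1 : V →ₗ[ℝ] V) + (J₁.1 : V →ₗ[ℝ] V)) =
      (rot A (t / 2) : V →ₗ[ℝ] V) ∘ₗ (C : V →ₗ[ℝ] V) ∘ₗ (J.1 : V →ₗ[ℝ] V) := by
    have : (1 / 2 : ℝ) • (J.1 + J₁.1) = rot A (t / 2) * (C * J.1) := by
      rw [h, smul_mul_assoc, mul_smul_comm, add_mul, mul_add, ← mul_assoc, rot_mul_rot_neg, one_mul,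
        ← mul_assoc, ← rot_add, add_halves]
    exact congrArg (fun T : V →L[ℝ] V => (T : V →ₗ[ℝ] V)) this
  have hCb : ∀ p, C (E.b p) = Real.cos (t * E.θ p.1 / 2) • E.b p := by
    intro p
    change (1 / 2 : ℝ) • (rot A (-(t / 2)) (E.b p) + rot A (t / 2) (E.b p)) = _
    rw [rot_eigen hsk (E.A_A_b p), rot_eigen hsk (E.A_A_b p), neg_mul, Real.cos_neg, Real.sin_neg,
      show t / 2 * E.θ p.1 = t * E.θ p.1 / 2 by ring]
    module
  have hdet : LinearMap.det (C : V →ₗ[ℝ] V) =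
      ∏ p : Fin n × Fin 2, Real.cos (t * E.θ p.1 / 2) := by
    have := E.b.toBasis.det_comp (C : V →ₗ[ℝ] V) E.b.toBasis
    rw [E.b.toBasis.det_self, mul_one] at this
    rw [← this, show ((C : V →ₗ[ℝ] V) ∘ E.b.toBasis) =
      fun p => Real.cos (t * E.θ p.1 / 2) • E.b.toBasis p from funext fun p => by simpa using hCb p]
    rw [AlternatingMap.map_smul_univ, E.b.toBasis.det_self, smul_eq_mul, mul_one]
  rw [detMean, hC, LinearMap.det_comp, LinearMap.det_comp, det_rot_eq_one hsk, det_Jg, one_mul,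
    mul_one, hdet, Fintype.prod_prod_type]
  simp [sq, Finset.prod_mul_distrib]

end CutLocusBound

/-! ### Parallel transport in the bundle of quantum Hilbert spaces -/

section Transport

variable {V : Type*} [NormedAddCommGroup V] [InnerProductSpace ℝ V] [FiniteDimensional ℝ V]

/-- The complexification of a real operator. -/
abbrev opC (T : V →L[ℝ] V) : Cplx V →ₗ[ℂ] Cplx V := (T : V →ₗ[ℝ] V).baseChange ℂ

theorem opC_tmul (T : V →L[ℝ] V) (z : ℂ) (x : V) : opC T (z ⊗ₜ[ℝ] x) = z ⊗ₜ[ℝ] T x := by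
  simp [opC]

theorem opC_mul (S T : V →L[ℝ] V) (v : Cplx V) : opC (S * T) v = opC S (opC T v) := by
  induction v using TensorProduct.induction_on with
  | zero => simp
  | tmul z x => simp only [opC_tmul]; rfl
  | add x y hx hy => rw [map_add, map_add, map_add, hx, hy]

theorem opC_one (v : Cplx V) : opC (1 : V →L[ℝ] V) v = v := by
  induction v using TensorProduct.induction_on with
  | zero => simp
  | tmul z x => simp only [opC_tmul]; rfl
  | add x y hx hy => rw [map_add, hx, hy]

theorem opC_neg (T : V →L[ℝ] V) (v : Cplx V) : opC (-T) v = -opC T v := by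
  induction v using TensorProduct.induction_on with
  | zero => simp
  | tmul z x => simp only [opC_tmul]; rw [← TensorProduct.tmul_neg]; rfl
  | add x y hx hy => rw [map_add, map_add, hx, hy, neg_add]

theorem conjV_opC (T : V →L[ℝ] V) (v : Cplx V) : conjV V (opC T v) = opC T (conjV V v) := by
  induction v using TensorProduct.induction_on with
  | zero => simp
  | tmul z x => simp only [opC_tmul, conjV_tmul]
  | add x y hx hy => rw [map_add, map_add, map_add, map_add, hx, hy]

theorem hasVecDerivWithinAt_opC_rot (A : V →L[ℝ] V) (v : Cplx V) (c : ℝ) (s : Set ℝ) (t : ℝ) :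
    HasVecDerivWithinAt (fun r => opC (rot A (c * r)) v)
      ((c : ℂ) • opC A (opC (rot A (c * t)) v)) s t := by
  induction v using TensorProduct.induction_on with
  | zero =>
    simp only [map_zero, smul_zero]
    exact hasVecDerivWithinAt_const _
  | tmul z x =>
    intro l
    simp only [opC_tmul]
    let m : V →L[ℝ] ℂ := LinearMap.toContinuousLinearMap
      ((l.restrictScalars ℝ) ∘ₗ (TensorProduct.mk ℝ ℂ V z))
    have h1 : HasDerivAt (fun r => rot A (c * r) x) (c • A (rot A (c * t) x)) t := by
      have h2 : HasDerivAt (fun r : ℝ => c * r) c t := by simpa using (hasDerivAt_id t).const_mul c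
      exact (hasDerivAt_rot_apply x (c * t)).scomp t h2
    have h3 := (m.hasFDerivAt.comp_hasDerivAt t h1).hasDerivWithinAt (s := s)
    have e : l ((c : ℂ) • z ⊗ₜ[ℝ] A (rot A (c * t) x)) = m (c • A (rot A (c * t) x)) := by
      rw [coe_smul_tensor, ← TensorProduct.tmul_smul]
      rfl
    rw [e]
    exact h3
  | add x y hx hy =>
    simp only [map_add, smul_add]
    exact hx.add hy

variable {ι : Type*} [Fintype ι]

/-- The quadratic operator `¼ ∑ ∇_{e_j} ∇_{A e_j}`. -/
def quadOp (b : OrthonormalBasis ι ℝ V) (A : V →L[ℝ] V) : H₀ V →ₗ[ℂ] H₀ V :=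
  (1 / 4 : ℂ) • ∑ p, covDeriv (b p) ∘ₗ covDeriv (A (b p))

theorem quadOp_apply (b : OrthonormalBasis ι ℝ V) (A : V →L[ℝ] V) (ψ : H₀ V) :
    quadOp b A ψ = (1 / 4 : ℂ) • ∑ p, covDeriv (b p) (covDeriv (A (b p)) ψ) := by
  simp [quadOp]

theorem sum_inner_smul_linear {M : Type*} [AddCommGroup M] [Module ℝ M] [Module ℂ M]
    [IsScalarTower ℝ ℂ M] (b : OrthonormalBasis ι ℝ V) (L : V →ₗ[ℝ] M) (x : V) :
    ∑ p, ((inner ℝ (b p) x : ℝ) : ℂ) • L (b p) = L x := by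
  conv_rhs => rw [← b.sum_repr' x]
  rw [map_sum]
  refine Finset.sum_congr rfl fun p _ => ?_
  rw [map_smul]
  exact algebraMap_smul ℂ (inner ℝ (b p) x : ℝ) (L (b p))

/-- Moving `∇_x` past the two factors leaves two terms linear in `∇`, each summing to `∇_{Ax}`. The
normalisation `¼` thus gives `½ A`, the generator of the rotation `exp(tA/2)` that conjugates `J₀`
into `J_t`. -/
theorem quadOp_covDeriv (b : OrthonormalBasis ι ℝ V) {A : V →L[ℝ] V} (hA : IsSkew A) (x : V)
    (ψ : H₀ V) : quadOp b A (covDeriv x ψ) =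
      covDeriv x (quadOp b A ψ) + (1 / 2 : ℂ) • covDeriv (A x) ψ := by
  have key : ∀ p, covDeriv (b p) (covDeriv (A (b p)) (covDeriv x ψ)) =
      covDeriv x (covDeriv (b p) (covDeriv (A (b p)) ψ)) +
      (((inner ℝ (b p) (A x) : ℝ) : ℂ) • covDeriv (b p) ψ +
        ((inner ℝ (b p) x : ℝ) : ℂ) • covDeriv (A (b p)) ψ) := by
    intro p
    rw [covDeriv_covDeriv (A (b p)) x, map_sub, map_smul, covDeriv_covDeriv (b p) x,
      hA (b p) x]
    push_cast
    module
  have e1 := sum_inner_smul_linear (M := H₀ V) b ((LinearMap.applyₗ ψ).restrictScalars ℝ ∘ₗ covDeriv) (A x)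
  have e2 := sum_inner_smul_linear (M := H₀ V) b ((LinearMap.applyₗ ψ).restrictScalars ℝ ∘ₗ covDeriv ∘ₗ
    (A : V →ₗ[ℝ] V)) x
  rw [quadOp_apply, quadOp_apply]
  simp only [key, Finset.sum_add_distrib]
  have e1' : ∑ p, ((inner ℝ (b p) (A x) : ℝ) : ℂ) • covDeriv (b p) ψ = covDeriv (A x) ψ := e1
  have e2' : ∑ p, ((inner ℝ (b p) x : ℝ) : ℂ) • covDeriv (A (b p)) ψ = covDeriv (A x) ψ := e2
  rw [e1', e2', map_smul, map_sum]
  module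

theorem quadOp_covDerivC (b : OrthonormalBasis ι ℝ V) {A : V →L[ℝ] V} (hA : IsSkew A)
    (v : Cplx V) (ψ : H₀ V) : quadOp b A (covDerivC v ψ) =
      covDerivC v (quadOp b A ψ) + (1 / 2 : ℂ) • covDerivC (opC A v) ψ := by
  induction v using TensorProduct.induction_on with
  | zero => simp
  | tmul z x =>
    simp only [opC_tmul, covDerivC_tmul, LinearMap.smul_apply, map_smul, quadOp_covDeriv b hA]
    module
  | add x y hx hy =>
    simp only [map_add, LinearMap.add_apply, hx, hy, smul_add]
    abel

theorem quadOp_prequantum (b : OrthonormalBasis ι ℝ V) (A : V →L[ℝ] V) (α : Dual ℝ V)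
    (ψ : H₀ V) : quadOp b A (prequantum α ψ) = prequantum α (quadOp b A ψ) := by
  rw [quadOp_apply, quadOp_apply, map_smul, map_sum]
  congr 1
  refine Finset.sum_congr rfl fun p _ => ?_
  rw [covDeriv_prequantum, map_neg, covDeriv_prequantum, neg_neg]

variable {n : ℕ} [Fact (finrank ℝ V = 2 * n)] {o : Orientation ℝ V (Fin (2 * n))}

/-- Taking the adjoint reverses two skew-adjoint factors, and these anticommute because `A x` is
orthogonal to `x`. -/
theorem hermL_quadOp (b : OrthonormalBasis ι ℝ V) {A : V →L[ℝ] V} (hA : IsSkew A) (ψ φ : H₀ V) :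
    hermL o (quadOp b A ψ) φ = -hermL o ψ (quadOp b A φ) := by
  rw [quadOp_apply, quadOp_apply, LinearMap.map_smulₛₗ, LinearMap.smul_apply, map_smul, map_sum,
    map_sum, LinearMap.sum_apply, show starRingEnd ℂ (1 / 4) = 1 / 4 by
      simpa using Complex.conj_ofReal (1 / 4), ← smul_neg,
    ← Finset.sum_neg_distrib]
  congr 1
  refine Finset.sum_congr rfl fun p _ => ?_
  rw [hermL_covDeriv, hermL_covDeriv, neg_neg, covDeriv_covDeriv (A (b p)), hA,
    inner_self_skew hA]
  simp

section Flow

variable (b : OrthonormalBasis ι ℝ V) {A : V →L[ℝ] V} (hA : IsSkew A)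
  {Φ : ℝ → H₀ V →ₗ[ℂ] H₀ V} (h0 : Φ 0 = LinearMap.id)
  (hΦ : ∀ (x : H₀ V) (s : Set ℝ) (t : ℝ),
    HasVecDerivWithinAt (fun r => Φ r x) (quadOp b A (Φ t x)) s t)
include hA h0 hΦ

theorem hermL_flow {t : ℝ} (ht : t ∈ Icc (0 : ℝ) 1) (ψ φ : H₀ V) :
    hermL o (Φ t ψ) (Φ t φ) = hermL o ψ φ := by
  rw [eq_of_hasDerivWithinAt_zero (f := fun t => hermL o (Φ t ψ) (Φ t φ)) (fun t _ => ?_) ht]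
  · simp [h0]
  · have := (hΦ ψ (Icc 0 1) t).hermL o (hΦ φ (Icc 0 1) t)
    rwa [hermL_quadOp b hA, neg_add_cancel] at this

include o in
-- The generator is skew-Hermitian, so the difference of two solutions has constant norm.
theorem flow_eq_of_deriv {f : ℝ → H₀ V} {ψ : H₀ V} (hf0 : f 0 = ψ)
    (hf : ∀ t ∈ Icc (0 : ℝ) 1, HasVecDerivWithinAt f (quadOp b A (f t)) (Icc 0 1) t) {t : ℝ}
    (ht : t ∈ Icc (0 : ℝ) 1) : f t = Φ t ψ := by
  rw [← sub_eq_zero]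
  refine eq_zero_of_hermL_deriv o (f := fun t => f t - Φ t ψ) (by simp [h0, hf0])
    (fun t ht => ⟨_, (hf t ht).sub (hΦ ψ _ t), ?_⟩) ht
  rw [← map_sub, hermL_quadOp b hA, neg_add_cancel]

include o in
theorem flow_prequantum {t : ℝ} (ht : t ∈ Icc (0 : ℝ) 1) (α : Dual ℝ V) (ψ : H₀ V) :
    prequantum α (Φ t ψ) = Φ t (prequantum α ψ) := by
  refine flow_eq_of_deriv (o := o) b hA h0 hΦ (f := fun t => prequantum α (Φ t ψ))
    (by simp [h0]) (fun t _ => ?_) ht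
  rw [quadOp_prequantum]
  exact (hΦ ψ _ t).linear (prequantum α)

include o in
-- Both sides solve the flow equation with the same initial value, since the commutator of the
-- generator with `∇` is the velocity of the half-way rotation. This is what carries `HJ (γ 0)` to
-- `HJ (γ t)`.
theorem flow_covDerivC {t : ℝ} (ht : t ∈ Icc (0 : ℝ) 1) (v : Cplx V) (ψ : H₀ V) :
    covDerivC (opC (rot A (1 / 2 * t)) v) (Φ t ψ) = Φ t (covDerivC v ψ) := by
  refine flow_eq_of_deriv (o := o) b hA h0 hΦ
    (f := fun t => covDerivC (opC (rot A (1 / 2 * t)) v) (Φ t ψ))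
    (by simp only [mul_zero, rot_zero, opC_one, h0, LinearMap.id_apply]) (fun t _ => ?_) ht
  have h1 := (hasVecDerivWithinAt_opC_rot A v (1 / 2) (Icc 0 1) t).bilin (hΦ ψ (Icc 0 1) t)
    covDerivC
  rw [quadOp_covDerivC b hA, add_comm]
  convert h1 using 2
  rw [map_smul, LinearMap.smul_apply]
  norm_num

end Flow

theorem mem_HJ {J : Jg o} {ψ : H₀ V} : ψ ∈ HJ J ↔ ∀ v ∈ V01 J, covDerivC v ψ = 0 := by
  simp [HJ]

theorem mem_V01 {J : Jg o} {v : Cplx V} : v ∈ V01 J ↔ opC J.1 v = -Complex.I • v := by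
  rw [V01, Module.End.mem_eigenspace_iff]; rfl

theorem mem_V10 {J : Jg o} {v : Cplx V} : v ∈ V10 J ↔ opC J.1 v = Complex.I • v := by
  rw [V10, Module.End.mem_eigenspace_iff]; rfl

theorem conjV_mem_V01 {J : Jg o} {v : Cplx V} (h : v ∈ V10 J) : conjV V v ∈ V01 J := by
  rw [mem_V10] at h
  rw [mem_V01, ← conjV_opC, h, LinearMap.map_smulₛₗ, Complex.conj_I]

theorem prequantum_mem_HJ {J : Jg o} {ψ : H₀ V} (h : ψ ∈ HJ J) (α : Dual ℝ V) :
    prequantum α ψ ∈ HJ J := by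
  rw [mem_HJ] at h ⊢
  intro v hv
  rw [covDerivC_prequantum, h v hv, map_zero, neg_zero]

theorem tmul_sub_I_mem_V10 (J : Jg o) (w : V) :
    (1 / 2 : ℂ) • ((1 : ℂ) ⊗ₜ[ℝ] w - Complex.I ⊗ₜ[ℝ] J.1 w) ∈ V10 J := by
  rw [mem_V10, map_smul, map_sub, opC_tmul, opC_tmul, Jg_apply_apply, smul_comm Complex.I]
  congr 1
  rw [smul_sub, TensorProduct.smul_tmul', TensorProduct.smul_tmul', TensorProduct.tmul_neg,
    smul_eq_mul, smul_eq_mul, mul_one, Complex.I_mul_I, TensorProduct.neg_tmul]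
  abel

/-- The matrix elements of `∇_x ∇_{Ax}` between the Hilbert spaces at two points of a geodesic. -/
theorem hermL_covDeriv_covDeriv {J J₁ : Jg o} {A : V →L[ℝ] V} (hA : A ∈ tangent J) {t : ℝ}
    (hJ : J₁.1 = rot A t * J.1) {x : V} {θ : ℝ} (hx : A (A x) = -(θ ^ 2) • x)
    (hcos : Real.cos (t * θ / 2) ≠ 0) {χ φ : H₀ V} (hχ : χ ∈ HJ J) (hφ : φ ∈ HJ J₁) :
    hermL o χ (covDeriv x (covDeriv (A x) φ)) =
      ((-(1 / 2) * (θ * Real.tan (t * θ / 2)) * inner ℝ x x : ℝ) : ℂ) * hermL o χ φ := by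
  obtain ⟨hAJ, hsk⟩ := mem_tangent_iff.mp hA
  have hAJ' : ∀ x, A (J.1 x) = -J.1 (A x) := fun x => congrArg (fun T : V →L[ℝ] V => T x) hAJ
  -- The value of `τ` is chosen so that `A x` is the sum of the `(1,0)` vector `z = ½(1 - iJ)w` for
  -- `J` and a `(0,1)` vector for `J₁`. The latter annihilates `φ`, and the adjoint of `∇_z`
  -- annihilates `χ`.
  set τ := θ * Real.tan (t * θ / 2) with hτ
  set w := A x + τ • x with hw
  -- the rotation maps `w` to `A x - τ x`
  have hrot : rot A t w = A x - τ • x := by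
    have e1 : rot A t (A x) = Real.cos (t * θ) • A x - (Real.sin (t * θ) * θ) • x := by
      rw [← commute_rot_apply, rot_eigen hsk hx, map_add, map_smul, map_smul, hx, smul_smul]
      by_cases hθ : θ = 0
      · subst hθ; simp
      · rw [sub_eq_add_neg, ← neg_smul]
        congr 2
        field_simp
    have hc : Real.cos (t * θ) = 2 * Real.cos (t * θ / 2) ^ 2 - 1 := by
      rw [← Real.cos_two_mul]; congr 1; ring
    have hs : Real.sin (t * θ) = 2 * Real.sin (t * θ / 2) * Real.cos (t * θ / 2) := by
      rw [← Real.sin_two_mul]; congr 1; ring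
    by_cases hθ : θ = 0
    · have hτ0 : τ = 0 := by rw [hτ, hθ, zero_mul]
      have hAx : A x = 0 := eq_zero_of_sq_zero hsk (by rw [hx, hθ]; simp)
      rw [hw, hτ0, hAx]; simp
    · rw [hw, map_add, map_smul, rot_eigen hsk hx, e1, smul_add, smul_smul, smul_smul]
      have hsc := Real.sin_sq_add_cos_sq (t * θ / 2)
      have c1 : Real.cos (t * θ) + τ * (Real.sin (t * θ) / θ) = 1 := by
        rw [hc, hs, hτ, Real.tan_eq_sin_div_cos]
        field_simp
        linear_combination 2 * hsc
      have c2 : -(Real.sin (t * θ) * θ) + τ * Real.cos (t * θ) = -τ := by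
        rw [hc, hs, hτ, Real.tan_eq_sin_div_cos]
        field_simp
        ring
      calc _ = (Real.cos (t * θ) + τ * (Real.sin (t * θ) / θ)) • A x +
            (-(Real.sin (t * θ) * θ) + τ * Real.cos (t * θ)) • x := by module
        _ = _ := by rw [c1, c2]; module
  have hJ₁ : J₁.1 (A x - τ • x) = J.1 w := by
    rw [hJ, ← hrot]
    change rot A t (J.1 (rot A t w)) = J.1 w
    have e := congrArg (fun T : V →L[ℝ] V => T (rot A t w)) (rot_mul_of_anticommute hAJ t)
    have e' : rot A t (J.1 (rot A t w)) = J.1 (rot A (-t) (rot A t w)) := e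
    rw [e']
    congr 1
    exact congrArg (fun T : V →L[ℝ] V => T w) (rot_neg_mul_rot (A := A) t)
  have hJ₁' : J₁.1 (J.1 w) = -(A x - τ • x) := by
    rw [← hJ₁, Jg_apply_apply]
  set z : Cplx V := (1 / 2 : ℂ) • ((1 : ℂ) ⊗ₜ[ℝ] w - Complex.I ⊗ₜ[ℝ] J.1 w) with hz
  have hzm : z ∈ V10 J := tmul_sub_I_mem_V10 J w
  have hy : (1 : ℂ) ⊗ₜ[ℝ] A x - z ∈ V01 J₁ := by
    have e1 : J₁.1 (A x) = (1 / 2 : ℝ) • (J.1 w + J₁.1 w) := by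
      rw [← hJ₁, ← map_add, hw, ← map_smul]
      congr 1
      module
    rw [mem_V01, map_sub, opC_tmul, hz, map_smul, map_sub, opC_tmul, opC_tmul, hJ₁', e1]
    have e2 : A x - τ • x = (2 : ℝ) • A x - w := by rw [hw]; module
    rw [e2]
    simp only [TensorProduct.tmul_smul, TensorProduct.tmul_add, TensorProduct.tmul_sub,
      TensorProduct.tmul_neg, ← coe_smul_tensor]
    have e3 : ∀ x : V, Complex.I ⊗ₜ[ℝ] x = Complex.I • ((1 : ℂ) ⊗ₜ[ℝ] x) := fun x => by
      rw [TensorProduct.smul_tmul', smul_eq_mul, mul_one]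
    simp only [e3]
    push_cast
    have hI : Complex.I * Complex.I = -1 := Complex.I_mul_I
    match_scalars <;> first | ring1 | linear_combination (1 / 2) * hI
  have hφz : covDeriv (A x) φ = covDerivC z φ := by
    have h1 := mem_HJ.mp hφ _ hy
    rw [map_sub, LinearMap.sub_apply, sub_eq_zero, covDerivC_tmul, one_smul] at h1
    exact h1
  have hzd : ∀ φ, covDerivC z φ =
      (1 / 2 : ℂ) • (covDeriv w φ - Complex.I • covDeriv (J.1 w) φ) := by
    intro φ
    rw [hz, map_smul, map_sub, covDerivC_tmul, covDerivC_tmul]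
    simp
  -- Exchanging the two derivatives produces a scalar; that scalar is the whole answer once the
  -- remaining term is shown to be orthogonal to `χ`.
  have hanti : covDeriv x (covDerivC z φ) = (-(1 / 2) * ((inner ℝ x w : ℝ) -
      Complex.I * (inner ℝ x (J.1 w) : ℝ)) : ℂ) • φ - covDerivC z (covDeriv x φ) := by
    rw [hzd, hzd, map_smul, map_sub, map_smul, covDeriv_covDeriv x, covDeriv_covDeriv x]
    module
  have hkill : hermL o χ (covDerivC z (covDeriv x φ)) = 0 := by
    have h1 := hermL_covDerivC o (conjV V z) χ (covDeriv x φ)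
    rw [conjV_conjV, mem_HJ.mp hχ _ (conjV_mem_V01 hzm), map_zero, LinearMap.zero_apply] at h1
    exact neg_eq_zero.mp h1.symm
  have i1 : inner ℝ x w = τ * inner ℝ x x := by
    rw [hw, inner_add_right, inner_self_skew hsk, real_inner_smul_right, zero_add]
  have i2 : inner ℝ x (J.1 w) = (0 : ℝ) := by
    have e1 : inner ℝ x (J.1 (A x)) = (0 : ℝ) := by
      have h1 : inner ℝ (J.1 x) (A x) = -(inner ℝ x (J.1 (A x)) : ℝ) := Jg_skew J x (A x)
      have h2 : inner ℝ (A (J.1 x)) x = -(inner ℝ (J.1 x) (A x) : ℝ) := hsk (J.1 x) x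
      rw [hAJ', inner_neg_left, real_inner_comm] at h2
      linarith
    rw [hw, map_add, map_smul, inner_add_right, real_inner_smul_right, e1,
      inner_self_skew (Jg_skew J), mul_zero, add_zero]
  rw [hφz, hanti, map_sub, hkill, sub_zero, map_smul, i1, i2, smul_eq_mul]
  push_cast
  ring

end Transport

/-! ### Unitary transport and orthogonal projection -/

section TransportH

variable {V : Type*} [NormedAddCommGroup V] [InnerProductSpace ℝ V] [FiniteDimensional ℝ V]
  {n : ℕ} {o : Orientation ℝ V (Fin (2 * n))} {J J₁ : Jg o} {A : V →L[ℝ] V} {t : ℝ}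

theorem mem_tangent_of_rot (hA : A ∈ tangent J) (h : J₁.1 = rot A t * J.1) : A ∈ tangent J₁ := by
  have : J₁ = rotCurve J hA t := Subtype.ext h
  rw [this]
  exact rotCurve_mem_tangent J hA t

/-- The half-way rotation intertwines the complex structures. -/
theorem mul_rot_half (hA : A ∈ tangent J) (h : J₁.1 = rot A t * J.1) :
    J₁.1 * rot A (1 / 2 * t) = rot A (1 / 2 * t) * J.1 := by
  have h1 := (rot_mul_of_anticommute (mem_tangent_iff.mp hA).1 (-(1 / 2 * t))).symm
  rw [neg_neg] at h1
  rw [h, mul_assoc, h1, ← mul_assoc, ← rot_add]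
  congr 2
  ring

theorem opC_rot_injective : Function.Injective (opC (rot A t)) := by
  intro v w h
  have := congrArg (opC (rot A (-t))) h
  rwa [← opC_mul, ← opC_mul, rot_neg_mul_rot, opC_one, opC_one] at this

theorem exists_opC_rot (v : Cplx V) : ∃ w, v = opC (rot A t) w :=
  ⟨opC (rot A (-t)) v, by rw [← opC_mul, rot_mul_rot_neg, opC_one]⟩

/-- The square root of the determinant of the mean along a geodesic. -/
def Eigenbasis.cosProd (E : Eigenbasis J A) (t : ℝ) : ℝ := ∏ k, Real.cos (t * E.θ k / 2)

theorem Eigenbasis.cosProd_zero (E : Eigenbasis J A) : E.cosProd 0 = 1 := by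
  simp [Eigenbasis.cosProd]

theorem Eigenbasis.cos_pos (E : Eigenbasis J A) (hθ : ∀ k, E.θ k < Real.pi)
    (ht : t ∈ Icc (0 : ℝ) 1) (k : Fin n) : 0 < Real.cos (t * E.θ k / 2) := by
  have h0 := E.θ_nonneg k
  have h1 : t * E.θ k ≤ E.θ k := mul_le_of_le_one_left h0 ht.2
  have h2 : 0 ≤ t * E.θ k := mul_nonneg ht.1 h0
  have := hθ k
  exact Real.cos_pos_of_mem_Ioo ⟨by linarith [Real.pi_pos], by linarith⟩

theorem Eigenbasis.cosProd_pos (E : Eigenbasis J A) (hθ : ∀ k, E.θ k < Real.pi)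
    (ht : t ∈ Icc (0 : ℝ) 1) : 0 < E.cosProd t :=
  Finset.prod_pos fun k _ => E.cos_pos hθ ht k

theorem Eigenbasis.hasDerivAt_cosProd (E : Eigenbasis J A) (hθ : ∀ k, E.θ k < Real.pi)
    (ht : t ∈ Icc (0 : ℝ) 1) : HasDerivAt E.cosProd
      ((-(1 / 2) * ∑ k, E.θ k * Real.tan (t * E.θ k / 2)) * E.cosProd t) t := by
  have h1 : ∀ k ∈ Finset.univ, HasDerivAt (fun t => Real.cos (t * E.θ k / 2))
      (-Real.sin (t * E.θ k / 2) * (E.θ k / 2)) t := fun k _ => by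
    have := ((hasDerivAt_id t).mul_const (E.θ k)).div_const 2
    simp only [id, one_mul] at this
    exact this.cos
  have h2 := HasDerivAt.fun_finsetProd h1
  refine h2.congr_deriv ?_
  rw [Finset.mul_sum, Finset.sum_mul]
  refine Finset.sum_congr rfl fun k hk => ?_
  have h3 := Finset.prod_erase_mul Finset.univ (fun k => Real.cos (t * E.θ k / 2)) hk
  have h4 := (E.cos_pos hθ ht k).ne'
  rw [Eigenbasis.cosProd, ← h3, smul_eq_mul, Real.tan_eq_sin_div_cos]
  field_simp

/-- This is the integrating factor for the scalar equation satisfied by the matrix elements of the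
flow. -/
theorem Eigenbasis.hasDerivAt_inv_sqrt_cosProd (E : Eigenbasis J A) (hθ : ∀ k, E.θ k < Real.pi)
    (ht : t ∈ Icc (0 : ℝ) 1) : HasDerivAt (fun t => (√(E.cosProd t))⁻¹)
      ((1 / 4 * ∑ k, E.θ k * Real.tan (t * E.θ k / 2)) * (√(E.cosProd t))⁻¹) t := by
  have hp := E.cosProd_pos hθ ht
  have hs := Real.sqrt_pos.mpr hp
  refine (((E.hasDerivAt_cosProd hθ ht).sqrt hp.ne').inv hs.ne').congr_deriv ?_
  have h2 := Real.sq_sqrt hp.le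
  generalize (∑ k, E.θ k * Real.tan (t * E.θ k / 2)) = c
  set q := √(E.cosProd t)
  rw [← h2]
  field_simp
  ring

variable [Fact (finrank ℝ V = 2 * n)]

theorem opC_rot_mem_V01 (hA : A ∈ tangent J) (h : J₁.1 = rot A t * J.1) {v : Cplx V} :
    opC (rot A (1 / 2 * t)) v ∈ V01 J₁ ↔ v ∈ V01 J := by
  rw [mem_V01, mem_V01, ← opC_mul, mul_rot_half hA h, opC_mul, ← map_smul]
  exact opC_rot_injective.eq_iff

theorem opC_rot_mem_V10 (hA : A ∈ tangent J) (h : J₁.1 = rot A t * J.1) {v : Cplx V} :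
    opC (rot A (1 / 2 * t)) v ∈ V10 J₁ ↔ v ∈ V10 J := by
  rw [mem_V10, mem_V10, ← opC_mul, mul_rot_half hA h, opC_mul, ← map_smul]
  exact opC_rot_injective.eq_iff

theorem hermL_quadOp_HJ {ι : Type*} [Fintype ι] (b : OrthonormalBasis ι ℝ V) (θ : ι → ℝ)
    (hb : ∀ p, A (A (b p)) = -(θ p ^ 2) • b p) (hA : A ∈ tangent J) (hJ : J₁.1 = rot A t * J.1)
    (hcos : ∀ p, Real.cos (t * θ p / 2) ≠ 0) {χ φ : H₀ V} (hχ : χ ∈ HJ J) (hφ : φ ∈ HJ J₁) :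
    hermL o χ (quadOp b A φ) =
      ((-(1 / 8) * ∑ p, θ p * Real.tan (t * θ p / 2) : ℝ) : ℂ) * hermL o χ φ := by
  rw [quadOp_apply, map_smul, map_sum, Finset.sum_congr rfl fun p _ =>
    hermL_covDeriv_covDeriv hA hJ (hb p) (hcos p) hχ hφ]
  simp only [b.norm_eq_one, real_inner_self_eq_norm_sq, one_pow, mul_one]
  rw [← Finset.sum_mul, smul_eq_mul, ← mul_assoc, ← Complex.ofReal_sum, ← Finset.mul_sum]
  push_cast
  ring

/-- At coinciding points, `t = 0`, all the tangents vanish. The velocity of the flow is thus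
orthogonal to the fibre, which is the condition of being parallel. -/
theorem hermL_quadOp_HJ_self (E : Eigenbasis J A) (hA : A ∈ tangent J₁) {χ φ : H₀ V}
    (hχ : χ ∈ HJ J₁) (hφ : φ ∈ HJ J₁) : hermL o χ (quadOp E.b A φ) = 0 := by
  rw [hermL_quadOp_HJ (J := J₁) (J₁ := J₁) (t := 0) E.b (fun p => E.θ p.1) E.A_A_b hA
    (by rw [rot_zero, one_mul]) (by simp) hχ hφ]
  simp

variable {γ : ℝ → Jg o}

/-- The difference stays in the fibres and its velocity is orthogonal to them, so its norm is
constant. -/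
theorem sub_isParallelH {ψ φ : ∀ t, HJ (γ t)} (hψ : IsParallelH γ ψ) (hφ : IsParallelH γ φ)
    (h0 : ψ 0 = φ 0) : ∀ t ∈ Icc (0 : ℝ) 1, ψ t = φ t := by
  intro t ht
  have : ((ψ t : H₀ V) - φ t) = 0 := by
    refine eq_zero_of_hermL_deriv o (f := fun t => (ψ t : H₀ V) - φ t) (by simp [h0])
      (fun t ht => ?_) ht
    obtain ⟨ψ', h1, h2⟩ := hψ t ht
    obtain ⟨φ', h3, h4⟩ := hφ t ht
    have key : hermL o ((ψ t : H₀ V) - φ t) (ψ' - φ') = 0 := by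
      have e1 : hermL o ((ψ t - φ t : HJ (γ t)) : H₀ V) ψ' = 0 := h2 _
      have e2 : hermL o ((ψ t - φ t : HJ (γ t)) : H₀ V) φ' = 0 := h4 _
      rw [Submodule.coe_sub] at e1 e2
      rw [map_sub, e1, e2, sub_zero]
    refine ⟨ψ' - φ', h1.sub h3, ?_⟩
    rw [← hermL_symm, key, map_zero, zero_add]
  exact Subtype.ext (sub_eq_zero.mp this)

theorem IsTransportH.unique {U U' : HJ (γ 0) →ₗ[ℂ] HJ (γ 1)} (h : IsTransportH γ U)
    (h' : IsTransportH γ U') : U = U' := by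
  ext1 ψ₀
  obtain ⟨ψ, h1, h2, h3⟩ := h ψ₀
  obtain ⟨φ, h4, h5, h6⟩ := h' ψ₀
  rw [← h3, ← h6]
  exact sub_isParallelH h1 h4 (h2.trans h5.symm) 1 ⟨zero_le_one, le_rfl⟩

theorem IsOrthProj.unique {P P' : HJ J →ₗ[ℂ] HJ J₁} (h : IsOrthProj P) (h' : IsOrthProj P') :
    P = P' := by
  ext1 ψ
  have e1 : hermL o ((P ψ - P' ψ : HJ J₁) : H₀ V) (ψ - P ψ) = 0 := h ψ _
  have e2 : hermL o ((P ψ - P' ψ : HJ J₁) : H₀ V) (ψ - P' ψ) = 0 := h' ψ _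
  rw [Submodule.coe_sub] at e1 e2
  have e3 : ((P ψ : H₀ V) - P' ψ) = 0 := by
    apply eq_zero_of_hermL_self o
    rw [show ((P ψ : H₀ V) - P' ψ) = (ψ - P' ψ) - (ψ - P ψ) by abel] at e1 e2 ⊢
    rw [map_sub, e1, e2, sub_zero]
  exact Subtype.ext (sub_eq_zero.mp e3)

/-- Existence and properties of the parallel transport in the bundle of Hilbert spaces. -/
theorem exists_transportH (hA : A ∈ tangent (γ 0))
    (hγ : ∀ t ∈ Icc (0 : ℝ) 1, (γ t).1 = rot A t * (γ 0).1) (E : Eigenbasis (γ 0) A)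
    (hθ : ∀ k, E.θ k < Real.pi) :
    ∃ U : HJ (γ 0) →ₗ[ℂ] HJ (γ 1), IsTransportH γ U ∧ IsBogoliubov U ∧
      ∀ χ ψ : HJ (γ 0), hermL o (χ : H₀ V) (U ψ : H₀ V) =
        (√(E.cosProd 1) : ℝ) * hermL o (χ : H₀ V) (ψ : H₀ V) := by
  have hsk := (mem_tangent_iff.mp hA).2
  obtain ⟨Φ, h0, hinv, hΦ⟩ := exists_flow (quadOp E.b A)
  have h1 : (1 : ℝ) ∈ Icc (0 : ℝ) 1 := ⟨zero_le_one, le_rfl⟩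
  have h00 : (0 : ℝ) ∈ Icc (0 : ℝ) 1 := ⟨le_rfl, zero_le_one⟩
  have hinj : ∀ t, Function.Injective (Φ t) := fun t => by
    have := hinv (-t)
    rw [neg_neg] at this
    exact LinearMap.injective_of_comp_eq_id _ _ this
  have hmem : ∀ t ∈ Icc (0 : ℝ) 1, ∀ ψ, Φ t ψ ∈ HJ (γ t) ↔ ψ ∈ HJ (γ 0) := by
    intro t ht ψ
    rw [mem_HJ, mem_HJ]
    refine ⟨fun h v hv => ?_, fun h v hv => ?_⟩
    · have := h _ ((opC_rot_mem_V01 hA (hγ t ht)).mpr hv)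
      rw [flow_covDerivC (o := o) E.b hsk h0 hΦ ht] at this
      exact hinj t (this.trans (map_zero _).symm)
    · obtain ⟨w, rfl⟩ := exists_opC_rot (A := A) (t := 1 / 2 * t) v
      rw [flow_covDerivC (o := o) E.b hsk h0 hΦ ht, h w ((opC_rot_mem_V01 hA (hγ t ht)).mp hv),
        map_zero]
  let U : HJ (γ 0) →ₗ[ℂ] HJ (γ 1) := (Φ 1).restrict fun ψ hψ => (hmem 1 h1 ψ).mpr hψ
  have hU : ∀ ψ, (U ψ : H₀ V) = Φ 1 ψ := fun ψ => rfl
  refine ⟨U, fun ψ => ?_, ⟨⟨?_, ?_⟩, fun ψ ψ' => ?_, fun α ψ => ?_⟩, fun χ ψ => ?_⟩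
  · classical
    -- Sections are indexed by all real parameters; where membership fails, `0` is a default value.
    -- On `[0,1]` it is never used.
    let s : ∀ t, HJ (γ t) := fun t => if h : Φ t ψ ∈ HJ (γ t) then ⟨_, h⟩ else 0
    have hs : ∀ t ∈ Icc (0 : ℝ) 1, (s t : H₀ V) = Φ t ψ := fun t ht => by
      simp only [s]
      rw [dif_pos ((hmem t ht _).mpr ψ.2)]
    refine ⟨s, fun t ht => ⟨quadOp E.b A (Φ t ψ), (hΦ ψ _ t).congr hs ht, fun χ => ?_⟩,
      Subtype.ext ?_, Subtype.ext (hs 1 h1)⟩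
    · exact hermL_quadOp_HJ_self E (mem_tangent_of_rot hA (hγ t ht)) χ.2
        ((hmem t ht _).mpr ψ.2)
    · rw [hs 0 h00, h0]; rfl
  · intro ψ φ h
    exact Subtype.ext (hinj 1 (congrArg Subtype.val h))
  · intro φ
    have e : Φ 1 (Φ (-1) φ) = φ := LinearMap.congr_fun (hinv 1) φ.1
    have : Φ (-1) φ ∈ HJ (γ 0) := (hmem 1 h1 _).mp (by rw [e]; exact φ.2)
    exact ⟨⟨_, this⟩, Subtype.ext e⟩
  · exact hermL_flow E.b hsk h0 hΦ h1 ψ.1 ψ'.1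
  · exact ⟨⟨_, prequantum_mem_HJ ψ.2 α⟩, rfl,
      (flow_prequantum (o := o) E.b hsk h0 hΦ h1 α ψ.1).symm⟩
  -- The overlap `⟨χ, Φ_t ψ⟩` satisfies a linear scalar equation, and its quotient by `√(cosProd t)`
  -- is constant.
  · have key := eq_of_hasDerivWithinAt_zero
      (f := fun t => (((√(E.cosProd t))⁻¹ : ℝ) : ℂ) * hermL o (χ : H₀ V) (Φ t ψ)) (fun t ht => ?_) h1
    · simp only [h0, E.cosProd_zero, LinearMap.id_apply, Real.sqrt_one, inv_one, Complex.ofReal_one,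
        one_mul, Complex.ofReal_inv] at key
      have : ((√(E.cosProd 1) : ℝ) : ℂ) ≠ 0 :=
        Complex.ofReal_ne_zero.mpr (Real.sqrt_pos.mpr (E.cosProd_pos hθ h1)).ne'
      rw [← key, hU, mul_inv_cancel_left₀ this]
    · have e1 := (E.hasDerivAt_inv_sqrt_cosProd hθ ht).ofReal_comp.hasDerivWithinAt (s := Icc 0 1)
      have e2 := HasVecDerivWithinAt.hermL o (hasVecDerivWithinAt_const (χ : H₀ V))
        (hΦ ψ (Icc 0 1) t)
      rw [hermL_quadOp_HJ E.b (fun p => E.θ p.1) E.A_A_b hA (hγ t ht)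
        (fun p => (E.cos_pos hθ ht p.1).ne') χ.2 ((hmem t ht _).mpr ψ.2), map_zero,
        LinearMap.zero_apply, zero_add, Fintype.sum_prod_type] at e2
      refine (e1.mul e2).congr_deriv ?_
      -- Each angle occurs twice in the orthonormal basis, which turns `1/8` into the `1/4` of the
      -- integrating factor.
      simp only [Fin.sum_univ_two]
      push_cast
      rw [Finset.sum_add_distrib]
      ring

/-- The orthogonal projection is a multiple of the parallel transport. -/
theorem isOrthProj_of_unitary {U : HJ J →ₗ[ℂ] HJ J₁} (hU : IsBogoliubov U) {r : ℝ}
    (h : ∀ χ ψ : HJ J, hermL o (χ : H₀ V) (U ψ : H₀ V) = r * hermL o (χ : H₀ V) (ψ : H₀ V)) :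
    IsOrthProj ((r : ℂ) • U) := by
  intro ψ χ
  obtain ⟨χ, rfl⟩ := hU.1.2 χ
  change hermL o (U χ : H₀ V) ((ψ : H₀ V) - (r : ℂ) • (U ψ : H₀ V)) = 0
  have e1 : hermL o (U χ : H₀ V) (U ψ : H₀ V) = hermL o (χ : H₀ V) (ψ : H₀ V) := hU.2.1 χ ψ
  rw [map_sub, map_smul, e1, ← hermL_symm, h, map_mul, Complex.conj_ofReal, hermL_symm,
    smul_eq_mul, sub_self]

end TransportH

/-! ### Products of degree-one elements of the complexified exterior algebra -/

section ComplexWedge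

variable {W : Type*} [AddCommGroup W] [Module ℝ W]

/-- The algebra map from the exterior algebra of the complexification to the complexification
of the exterior algebra. -/
def toCExt : ExteriorAlgebra ℂ (Cplx W) →ₐ[ℂ] CExt W := ExteriorAlgebra.lift ℂ ⟨ιC, ιC_sq⟩

/-- The alternating map `(v₁, …, v_k) ↦ v₁ ∧ ⋯ ∧ v_k`. -/
def wedgeC (k : ℕ) : Cplx W [⋀^Fin k]→ₗ[ℂ] CExt W :=
  toCExt.toLinearMap.compAlternatingMap (ExteriorAlgebra.ιMulti ℂ k)

theorem wedgeC_apply {k : ℕ} (v : Fin k → Cplx W) :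
    wedgeC k v = (List.ofFn fun i => ιC (v i)).prod := by
  change toCExt (ExteriorAlgebra.ιMulti ℂ k v) = _
  rw [ExteriorAlgebra.ιMulti_apply, map_list_prod, List.map_ofFn]
  congr 2
  funext i
  exact ExteriorAlgebra.lift_ι_apply ..

theorem ιC_mul_wedgeC_self {k : ℕ} (v : Fin k → Cplx W) (i : Fin k) :
    ιC (v i) * wedgeC k v = 0 := by
  have h : wedgeC (k + 1) (Fin.cons (v i) v) = 0 :=
    (wedgeC (k + 1)).map_eq_zero_of_eq _ (i := 0) (j := i.succ) (by simp)
      (Fin.succ_ne_zero i).symm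
  rw [wedgeC_apply, List.ofFn_succ, List.prod_cons] at h
  rw [wedgeC_apply]
  simpa using h

theorem ιC_mul_ιC (v w : Cplx W) : ιC v * ιC w = (-1 : ℂ) • (ιC w * ιC v) := by
  rw [neg_smul, one_smul]
  exact eq_neg_of_add_eq_zero_left (ιC_anticomm v w)

theorem ιC_mul_list_prod {ι : Type*} (w : Cplx W) (a : ι → Cplx W) (l : List ι) :
    ιC w * (l.map fun i => ιC (a i)).prod =
      (-1 : ℂ) ^ l.length • ((l.map fun i => ιC (a i)).prod * ιC w) := by
  induction l with
  | nil => simp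
  | cons i l ih =>
    rw [List.map_cons, List.prod_cons, ← mul_assoc, ιC_mul_ιC, smul_mul_assoc, mul_assoc, ih,
      mul_smul_comm, smul_smul, List.length_cons, pow_succ', mul_assoc]

/-- To be interleaved, each factor of the second product passes the later factors of the first,
which makes `0 + 1 + ⋯ + (l.length - 1)` transpositions in total. -/
theorem list_prod_mul_list_prod {ι : Type*} (a c : ι → Cplx W) (l : List ι) :
    (l.map fun i => ιC (a i)).prod * (l.map fun i => ιC (c i)).prod =
      (-1 : ℂ) ^ (l.length * (l.length - 1) / 2) •
        (l.map fun i => ιC (a i) * ιC (c i)).prod := by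
  induction l with
  | nil => simp
  | cons i l ih =>
    have e : (l.length + 1) * (l.length + 1 - 1) / 2 = l.length * (l.length - 1) / 2 + l.length := by
      rcases l.length with - | m
      · rfl
      · have : (m + 1 + 1) * (m + 1 + 1 - 1) = (m + 1) * (m + 1 - 1) + (m + 1) * 2 := by
          simp only [Nat.add_sub_cancel]; ring
        rw [this, Nat.add_mul_div_right _ _ two_pos]
    have h := ιC_mul_list_prod (c i) a l
    have h' : (l.map fun i => ιC (a i)).prod * ιC (c i) =
        (-1 : ℂ) ^ l.length • (ιC (c i) * (l.map fun i => ιC (a i)).prod) := by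
      rw [h, smul_smul, ← pow_add, ← two_mul, pow_mul]; simp
    simp only [List.map_cons, List.prod_cons, List.length_cons]
    calc _ = ιC (a i) * ((l.map fun i => ιC (a i)).prod * ιC (c i)) *
          (l.map fun i => ιC (c i)).prod := by simp only [mul_assoc]
      _ = (-1 : ℂ) ^ l.length • (ιC (a i) * ιC (c i) *
          ((l.map fun i => ιC (a i)).prod * (l.map fun i => ιC (c i)).prod)) := by
        rw [h']; simp only [mul_assoc, mul_smul_comm, smul_mul_assoc]
      _ = _ := by
        rw [ih, mul_smul_comm, smul_smul, e, pow_add, mul_comm]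

theorem extMap_ιC (f : Cplx W →ₗ[ℂ] Cplx W) (v : Cplx W) : extMap f (ιC v) = ιC (f v) := by
  induction v using TensorProduct.induction_on with
  | zero => simp
  | tmul z x =>
    have h : extMap f (ιC (z ⊗ₜ[ℝ] x)) =
        algebraMap ℂ (CExt W) z * ιC (f ((1 : ℂ) ⊗ₜ[ℝ] x)) := by
      rw [ιC_tmul]
      exact (Algebra.TensorProduct.lift_tmul _ _ _ _ _).trans
        (congrArg _ (ExteriorAlgebra.lift_ι_apply ..))
    rw [h, ← Algebra.smul_def, ← map_smul, ← map_smul, TensorProduct.smul_tmul', smul_eq_mul,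
      mul_one]
  | add x y hx hy => rw [map_add, map_add, map_add, map_add, hx, hy]

theorem extMap_baseChange_tmul (f : W →ₗ[ℝ] W) (z : ℂ) (a : ExteriorAlgebra ℝ W) :
    extMap (f.baseChange ℂ) (z ⊗ₜ[ℝ] a) = z ⊗ₜ[ℝ] ExteriorAlgebra.map f a := by
  induction a using exterior_left_induction with
  | hr r =>
    rw [AlgHom.commutes, Algebra.algebraMap_eq_smul_one, TensorProduct.tmul_smul,
      ← coe_smul_tensor, map_smul, show z ⊗ₜ[ℝ] (1 : ExteriorAlgebra ℝ W) =
      algebraMap ℂ (CExt W) z from rfl, AlgHom.commutes]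
  | hadd x y hx hy => rw [TensorProduct.tmul_add, map_add, map_add, hx, hy, TensorProduct.tmul_add]
  | hmul β x hx =>
    have e : ∀ (β : W) (x : ExteriorAlgebra ℝ W), z ⊗ₜ[ℝ] (ExteriorAlgebra.ι ℝ β * x) =
        ιC ((1 : ℂ) ⊗ₜ[ℝ] β) * z ⊗ₜ[ℝ] x := fun β x => by
      rw [ιC_tmul, Algebra.TensorProduct.tmul_mul_tmul, one_mul]
    rw [e, map_mul, extMap_ιC, hx, map_mul, ExteriorAlgebra.map_apply_ι, e,
      LinearMap.baseChange_tmul]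

theorem conj_extMap (f : W →ₗ[ℝ] W) (x : CExt W) :
    conj (extMap (f.baseChange ℂ) x) = extMap (f.baseChange ℂ) (conj x) := by
  induction x using TensorProduct.induction_on with
  | zero => simp
  | tmul z a => rw [extMap_baseChange_tmul, conj_tmul, conj_tmul, extMap_baseChange_tmul]
  | add x y hx hy => rw [map_add, map_add, map_add, map_add, hx, hy]

end ComplexWedge

/-! ### The canonical bundle -/

section Canonical

variable {V : Type*} [NormedAddCommGroup V] [InnerProductSpace ℝ V] [FiniteDimensional ℝ V]
  {n : ℕ} [Fact (finrank ℝ V = 2 * n)] {o : Orientation ℝ V (Fin (2 * n))} {J J₁ : Jg o}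
  {A : V →L[ℝ] V} {t : ℝ}

theorem volumeForm_basis_pos {b : Basis (Fin (2 * n)) ℝ V} (hb : b.orientation = o) :
    0 < o.volumeForm b := by
  let e : OrthonormalBasis (Fin (2 * n)) ℝ V :=
    (stdOrthonormalBasis ℝ V).reindex (finCongr Fact.out)
  by_cases h : e.toBasis.orientation = o
  · rw [o.volumeForm_robust e h]
    exact (Basis.orientation_eq_iff_det_pos e.toBasis b).mp (h.trans hb.symm)
  · rw [o.volumeForm_robust_neg e h, AlternatingMap.neg_apply, neg_pos]
    refine lt_of_le_of_ne (not_lt.mp fun h' => h ?_) (e.toBasis.isUnit_det b).ne_zero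
    exact ((Basis.orientation_eq_iff_det_pos e.toBasis b).mpr h').trans hb

theorem topCoeff_tmul (z : ℂ) (a : ExteriorAlgebra ℝ V) : topCoeff o (z ⊗ₜ[ℝ] a) =
    z * (ExteriorAlgebra.liftAlternating (onlyDegree o.volumeForm) a : ℝ) := by
  simp [topCoeff]

theorem topCoeff_prod (b : Fin (2 * n) → V) :
    topCoeff o (List.ofFn fun i => ιC ((1 : ℂ) ⊗ₜ[ℝ] b i)).prod = o.volumeForm b := by
  have : (List.ofFn fun i => ιC ((1 : ℂ) ⊗ₜ[ℝ] b i)).prod =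
      (1 : ℂ) ⊗ₜ[ℝ] ExteriorAlgebra.ιMulti ℝ (2 * n) b := by
    rw [ExteriorAlgebra.ιMulti_apply]
    have := map_list_prod (Algebra.TensorProduct.includeRight :
      ExteriorAlgebra ℝ V →ₐ[ℝ] ℂ ⊗[ℝ] ExteriorAlgebra ℝ V)
      (List.ofFn fun i => ExteriorAlgebra.ι ℝ (b i))
    rw [Algebra.TensorProduct.includeRight_apply] at this
    rw [this, List.map_ofFn]
    congr 2
  rw [this, topCoeff_tmul, ExteriorAlgebra.liftAlternating_apply_ιMulti, onlyDegree_self, one_mul]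

/-- Rotations preserve the coefficient of the volume element. -/
theorem topCoeff_extMap_rot (hA : IsSkew A) (t : ℝ) (x : CExt V) :
    topCoeff o (extMap (opC (rot A t)) x) = topCoeff o x := by
  induction x using TensorProduct.induction_on with
  | zero => simp
  | add x y hx hy => rw [map_add, map_add, map_add, hx, hy]
  | tmul z a =>
    rw [opC, extMap_baseChange_tmul, topCoeff_tmul, topCoeff_tmul]
    congr 2
    have : ExteriorAlgebra.liftAlternating (onlyDegree o.volumeForm) ∘ₗ
        (ExteriorAlgebra.map (rot A t : V →ₗ[ℝ] V)).toLinearMap =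
        ExteriorAlgebra.liftAlternating (onlyDegree o.volumeForm) := by
      refine exterior_lhom_ext fun k v => ?_
      rw [LinearMap.comp_apply, AlgHom.toLinearMap_apply, ExteriorAlgebra.map_apply_ιMulti,
        ExteriorAlgebra.liftAlternating_apply_ιMulti, ExteriorAlgebra.liftAlternating_apply_ιMulti]
      by_cases hk : k = 2 * n
      · subst hk
        rw [onlyDegree_self]
        exact o.volumeForm_comp_linearIsometryEquiv (rotIsometry hA t) (det_rot_pos t) v
      · rw [onlyDegree_of_ne _ hk]; rfl
    exact LinearMap.congr_fun this a

variable (o) in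
/-- The pairing of the canonical bundle as a sesquilinear map. -/
def pairKL : CExt V →ₗ⋆[ℂ] CExt V →ₗ[ℂ] ℂ :=
  ((((-1) ^ (n * (n + 1) / 2) / Complex.I ^ n : ℂ) • LinearMap.mul ℂ (CExt V)).compr₂
    (topCoeff o)) ∘ₛₗ conjS

theorem pairKL_apply (μ ν : CExt V) : pairKL o μ ν = pairK o μ ν := by
  simp only [pairKL, pairK, conjS, LinearMap.comp_apply, LinearMap.compr₂_apply,
    LinearMap.smul_apply, map_smul, LinearMap.mul_apply']
  rw [smul_eq_mul]
  change _ * topCoeff o (conj μ * ν) = _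
  ring

theorem pairK_smul_left (c : ℂ) (μ ν : CExt V) :
    pairK o (c • μ) ν = starRingEnd ℂ c * pairK o μ ν := by
  rw [← pairKL_apply, LinearMap.map_smulₛₗ, LinearMap.smul_apply, pairKL_apply, smul_eq_mul]

theorem pairK_smul_right (c : ℂ) (μ ν : CExt V) : pairK o μ (c • ν) = c * pairK o μ ν := by
  rw [← pairKL_apply, map_smul, pairKL_apply, smul_eq_mul]

theorem pairK_extMap_rot (hA : IsSkew A) (t : ℝ) (μ ν : CExt V) :
    pairK o (extMap (opC (rot A t)) μ) (extMap (opC (rot A t)) ν) = pairK o μ ν := by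
  rw [pairK, pairK, opC, conj_extMap, ← map_mul, topCoeff_extMap_rot hA]

/-- The vector `½ (1 - iJ) x` of type `(1, 0)`. -/
def holVec (J : Jg o) (x : V) : Cplx V :=
  (1 / 2 : ℂ) • ((1 : ℂ) ⊗ₜ[ℝ] x - Complex.I ⊗ₜ[ℝ] J.1 x)

theorem holVec_mem (J : Jg o) (x : V) : holVec J x ∈ V10 J := tmul_sub_I_mem_V10 J x

theorem projV_apply (J : Jg o) (v : Cplx V) :
    projV J v = (1 / 2 : ℂ) • (v - Complex.I • opC J.1 v) := by
  simp [projV, JC]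

theorem projV_tmul (J : Jg o) (z : ℂ) (x : V) : projV J (z ⊗ₜ[ℝ] x) = z • holVec J x := by
  have h : ∀ (z : ℂ) (x : V), z ⊗ₜ[ℝ] x = z • ((1 : ℂ) ⊗ₜ[ℝ] x) := fun z x => by
    rw [TensorProduct.smul_tmul', smul_eq_mul, mul_one]
  rw [projV_apply, opC_tmul, holVec, h z, h z, h Complex.I]
  module

theorem projV_of_mem_V10 {v : Cplx V} (hv : v ∈ V10 J) : projV J v = v := by
  rw [projV_apply, mem_V10.mp hv, smul_smul, Complex.I_mul_I]
  module

theorem projV_of_mem_V01 {v : Cplx V} (hv : v ∈ V01 J) : projV J v = 0 := by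
  rw [projV_apply, mem_V01.mp hv, smul_smul, mul_neg, Complex.I_mul_I]
  module

theorem holVec_J (J : Jg o) (x : V) : holVec J (J.1 x) = Complex.I • holVec J x := by
  have := mem_V10.mp (holVec_mem J x)
  rw [← this, holVec, holVec, map_smul, map_sub, opC_tmul, opC_tmul]

theorem conjV_holVec (J : Jg o) (x : V) :
    conjV V (holVec J x) = (1 / 2 : ℂ) • ((1 : ℂ) ⊗ₜ[ℝ] x + Complex.I ⊗ₜ[ℝ] J.1 x) := by
  rw [holVec, LinearMap.map_smulₛₗ, map_sub, conjV_tmul, conjV_tmul, Complex.conj_I, map_one,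
    TensorProduct.neg_tmul, sub_neg_eq_add, show starRingEnd ℂ (1 / 2) = 1 / 2 by
      simpa using Complex.conj_ofReal (1 / 2)]

/-- The span of the vectors of type `(1, 0)` defined by a frame. -/
theorem V10_eq_span {b : Fin (2 * n) → V}
    (hb : ∀ k : Fin n, b ⟨2 * k + 1, by omega⟩ = J.1 (b ⟨2 * k, by omega⟩))
    (hs : Submodule.span ℝ (range b) = ⊤) :
    V10 J = Submodule.span ℂ (range fun k : Fin n => holVec J (b ⟨2 * k, by omega⟩)) := by
  apply le_antisymm
  · intro v hv
    -- Once `v` is replaced by `P_J v`, the claim holds for every `v` in `V^ℂ`, which makes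
    -- induction on tensors possible.
    rw [← projV_of_mem_V10 hv]
    clear hv
    induction v using TensorProduct.induction_on with
    | zero => simp
    | add x y hx hy => rw [map_add]; exact add_mem hx hy
    | tmul z x =>
      rw [projV_tmul]
      apply Submodule.smul_mem
      have hx : x ∈ Submodule.span ℝ (range b) := hs ▸ Submodule.mem_top
      induction hx using Submodule.span_induction with
      | zero => simp [holVec]
      | add x y _ _ hx hy =>
        rw [show holVec J (x + y) = holVec J x + holVec J y by
          simp only [holVec, map_add, TensorProduct.tmul_add]; module]
        exact add_mem hx hy
      | smul r x _ hx =>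
        rw [show holVec J (r • x) = (r : ℂ) • holVec J x by
          simp only [holVec, map_smul, TensorProduct.tmul_smul, ← coe_smul_tensor]; module]
        exact Submodule.smul_mem _ _ hx
      | mem x hx =>
        obtain ⟨⟨i, hi⟩, rfl⟩ := hx
        rcases Nat.even_or_odd' i with ⟨k, rfl | rfl⟩
        · exact Submodule.subset_span ⟨⟨k, by omega⟩, rfl⟩
        · rw [hb ⟨k, by omega⟩, holVec_J]
          exact Submodule.smul_mem _ _ (Submodule.subset_span ⟨⟨k, by omega⟩, rfl⟩)
  · rw [Submodule.span_le]
    rintro _ ⟨k, rfl⟩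
    exact holVec_mem _ _

open scoped Pointwise in
/-- The canonical line at `J` is generated by the product of a frame of `V_J^{1,0}`. -/
theorem Kinv_eq_span {e : Fin n → Cplx V} (he : V10 J = Submodule.span ℂ (range e)) :
    Kinv J = Submodule.span ℂ {wedgeC n e} := by
  have h1 : Kinv J = Submodule.span ℂ ((range fun k => ιC (e k)) ^ n) := by
    rw [Kinv, he, Submodule.map_span, Submodule.span_pow, ← range_comp]
    rfl
  rw [h1]
  apply le_antisymm
  · rw [Submodule.span_le]
    intro x hx
    obtain ⟨f, rfl⟩ := Set.mem_pow.mp hx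
    choose g hg using fun i => (f i).2
    have e1 : (List.ofFn fun i => (f i : CExt V)).prod = wedgeC n (e ∘ g) := by
      rw [wedgeC_apply]
      congr 2
      funext i
      exact (hg i).symm
    rw [e1, SetLike.mem_coe]
    -- A product repeating a frame vector vanishes; any other one is a permutation of the frame,
    -- equal to the generator up to sign.
    by_cases hi : Function.Injective g
    · let σ : Equiv.Perm (Fin n) := Equiv.ofBijective g (Finite.injective_iff_bijective.mp hi)
      have := (wedgeC n).map_perm e σ
      rw [show e ∘ g = e ∘ σ from rfl, this]
      rcases Int.units_eq_one_or (Equiv.Perm.sign σ) with h | h <;> rw [h]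
      · rw [one_smul]; exact Submodule.mem_span_singleton_self _
      · rw [Units.neg_smul, one_smul]
        exact neg_mem (Submodule.mem_span_singleton_self _)
    · rw [(wedgeC n).map_eq_zero_of_not_injective _ fun h => hi h.of_comp]
      exact zero_mem _
  · rw [Submodule.span_singleton_le_iff_mem, wedgeC_apply]
    exact Submodule.subset_span (Set.mem_pow.mpr ⟨fun i => ⟨ιC (e i), mem_range_self i⟩, rfl⟩)

/-- The norm of the generator of the canonical line defined by a frame. -/
theorem pairK_wedgeC {b : Fin (2 * n) → V}
    (hb : ∀ k : Fin n, b ⟨2 * k + 1, by omega⟩ = J.1 (b ⟨2 * k, by omega⟩)) :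
    pairK o (wedgeC n fun k : Fin n => holVec J (b ⟨2 * k, by omega⟩))
      (wedgeC n fun k : Fin n => holVec J (b ⟨2 * k, by omega⟩)) =
      ((o.volumeForm b / 2 ^ n : ℝ) : ℂ) := by
  set e : Fin n → Cplx V := fun k : Fin n => holVec J (b ⟨2 * k, by omega⟩) with he
  have h1 : conj (wedgeC n e) = ((List.finRange n).map fun k => ιC (conjV V (e k))).prod := by
    rw [wedgeC_apply, map_list_prod, List.map_ofFn, List.ofFn_eq_map]
    congr 2
  have h2 : wedgeC n e = ((List.finRange n).map fun k => ιC (e k)).prod := by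
    rw [wedgeC_apply, List.ofFn_eq_map]
  -- This is `½(x + iJx) ∧ ½(x - iJx) = -(i/2) x ∧ Jx`.
  have h3 : ∀ k, ιC (conjV V (e k)) * ιC (e k) = (-(Complex.I / 2)) •
      (ιC ((1 : ℂ) ⊗ₜ[ℝ] b ⟨2 * k, by omega⟩) * ιC ((1 : ℂ) ⊗ₜ[ℝ] b ⟨2 * k + 1, by omega⟩)) := by
    intro k
    have hI : ∀ x : V, Complex.I ⊗ₜ[ℝ] x = Complex.I • ((1 : ℂ) ⊗ₜ[ℝ] x) := fun x => by
      rw [TensorProduct.smul_tmul', smul_eq_mul, mul_one]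
    change ιC (conjV V (holVec J _)) * ιC (holVec J _) = _
    rw [conjV_holVec, holVec, hI, ← hb]
    set x := (1 : ℂ) ⊗ₜ[ℝ] b ⟨2 * k, by omega⟩
    set y := (1 : ℂ) ⊗ₜ[ℝ] b ⟨2 * k + 1, by omega⟩
    simp only [map_smul, map_add, map_sub, smul_mul_assoc, mul_smul_comm, add_mul, mul_sub,
      ιC_sq, ιC_mul_ιC y x]
    module
  have h4 : ∀ l : List (Fin n), (l.map fun k => ιC (conjV V (e k)) * ιC (e k)).prod =
      (-(Complex.I / 2)) ^ l.length • (l.map fun k : Fin n =>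
        ιC ((1 : ℂ) ⊗ₜ[ℝ] b ⟨2 * k, by omega⟩) *
          ιC ((1 : ℂ) ⊗ₜ[ℝ] b ⟨2 * k + 1, by omega⟩)).prod := by
    intro l
    induction l with
    | nil => simp
    | cons k l ih =>
      rw [List.map_cons, List.map_cons, List.prod_cons, List.prod_cons, List.length_cons, ih, h3,
        smul_mul_assoc, mul_smul_comm, smul_smul, pow_succ']
  have h5 : ((List.finRange n).map fun k : Fin n => ιC ((1 : ℂ) ⊗ₜ[ℝ] b ⟨2 * k, by omega⟩) *
      ιC ((1 : ℂ) ⊗ₜ[ℝ] b ⟨2 * k + 1, by omega⟩)).prod =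
      (List.ofFn fun i => ιC ((1 : ℂ) ⊗ₜ[ℝ] b i)).prod := by
    rw [List.ofFn_mul', List.prod_flatten, List.map_ofFn, ← List.ofFn_eq_map]
    congr 2
    funext k
    simp [List.ofFn_succ]
  rw [pairK, h1, h2, list_prod_mul_list_prod, h4, h5, map_smul, map_smul, topCoeff_prod,
    List.length_finRange, smul_eq_mul, smul_eq_mul]
  -- The reordering sign and the `(-1)^n` from `(-i/2)^n` cancel exactly against the sign built into
  -- the pairing.
  have hpow : (-1 : ℂ) ^ (n * (n + 1) / 2) * ((-1) ^ (n * (n - 1) / 2) * (-1) ^ n) = 1 := by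
    rw [← pow_add, ← pow_add]
    apply Even.neg_one_pow
    have e1 : n * (n + 1) / 2 = n * (n - 1) / 2 + n := by
      rcases n with - | m
      · rfl
      · have : (m + 1) * (m + 1 + 1) = (m + 1) * (m + 1 - 1) + (m + 1) * 2 := by
          simp only [Nat.add_sub_cancel]; ring
        rw [this, Nat.add_mul_div_right _ _ two_pos]
    rw [e1]
    exact ⟨_, rfl⟩
  have hI : Complex.I ^ n ≠ 0 := pow_ne_zero _ Complex.I_ne_zero
  rw [neg_pow (Complex.I / 2), div_pow]
  push_cast
  field_simp
  linear_combination (o.volumeForm b : ℂ) * hpow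

end Canonical

/-! ### Parallel sections and pairings of the canonical lines -/

section CanonicalTransport

variable {V : Type*} [NormedAddCommGroup V] [InnerProductSpace ℝ V] [FiniteDimensional ℝ V]
  {n : ℕ} [Fact (finrank ℝ V = 2 * n)] {o : Orientation ℝ V (Fin (2 * n))} {J J₁ : Jg o}
  {A : V →L[ℝ] V} {t : ℝ}

theorem exists_generator_Kinv (J : Jg o) : ∃ μ ∈ Kinv J, ∃ p : ℝ, 0 < p ∧ pairK o μ μ = p ∧
    ∀ ν ∈ Kinv J, ∃ c : ℂ, ν = c • μ := by
  obtain ⟨b, hb, ho⟩ := J.2.2.2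
  have hK := Kinv_eq_span (V10_eq_span hb b.span_eq)
  refine ⟨_, hK ▸ Submodule.mem_span_singleton_self _, _,
    div_pos (volumeForm_basis_pos ho) (pow_pos two_pos n), pairK_wedgeC hb, fun ν hν => ?_⟩
  rw [hK, Submodule.mem_span_singleton] at hν
  obtain ⟨c, rfl⟩ := hν
  exact ⟨c, rfl⟩

theorem exists_smul_of_mem_Kinv {μ ν : CExt V} (hμ : μ ∈ Kinv J) (h0 : μ ≠ 0) (hν : ν ∈ Kinv J) :
    ∃ c : ℂ, ν = c • μ := by
  obtain ⟨g, -, -, -, -, hg⟩ := exists_generator_Kinv J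
  obtain ⟨a, rfl⟩ := hg μ hμ
  obtain ⟨c, rfl⟩ := hg ν hν
  have ha : a ≠ 0 := fun h => h0 (by rw [h, zero_smul])
  exact ⟨c / a, by rw [smul_smul, div_mul_cancel₀ _ ha]⟩

theorem pairK_self_pos {μ : CExt V} (hμ : μ ∈ Kinv J) (h0 : μ ≠ 0) :
    ∃ p : ℝ, 0 < p ∧ pairK o μ μ = p := by
  obtain ⟨g, -, p, hp, hpg, hg⟩ := exists_generator_Kinv J
  obtain ⟨a, rfl⟩ := hg μ hμ
  have ha : a ≠ 0 := fun h => h0 (by rw [h, zero_smul])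
  refine ⟨Complex.normSq a * p, mul_pos (Complex.normSq_pos.mpr ha) hp, ?_⟩
  rw [pairK_smul_left, pairK_smul_right, hpg, ← mul_assoc, ← Complex.normSq_eq_conj_mul_self]
  push_cast
  rfl

theorem algHom_eq_of_mem_Kinv {f g : CExt V →ₐ[ℂ] CExt V}
    (h : ∀ v ∈ V10 J, f (ιC v) = g (ιC v)) {μ : CExt V} (hμ : μ ∈ Kinv J) : f μ = g μ := by
  rw [Kinv] at hμ
  refine Submodule.pow_induction_on_left _ (C := fun μ => f μ = g μ) (fun r => ?_)
    (fun x y hx hy => ?_) (fun m hm x hx => ?_) hμ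
  · rw [AlgHom.commutes, AlgHom.commutes]
  · rw [map_add, map_add, hx, hy]
  · obtain ⟨v, hv, rfl⟩ := hm
    rw [map_mul, map_mul, hx, h v hv]

theorem extMap_projV_of_mem {μ : CExt V} (hμ : μ ∈ Kinv J) : extMap (projV J) μ = μ :=
  algHom_eq_of_mem_Kinv (g := AlgHom.id ℂ _) (fun v hv => by
    rw [extMap_ιC, projV_of_mem_V10 hv]; rfl) hμ

/-- Along a geodesic, `J_{t/2} / i` acts on `V_{J_0}^{1,0}` as a rotation. -/
theorem extMap_JC_of_mem (h : J₁.1 = rot A t * J.1) {μ : CExt V} (hμ : μ ∈ Kinv J) :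
    extMap (Complex.I⁻¹ • JC J₁) μ = extMap (opC (rot A t)) μ := by
  refine algHom_eq_of_mem_Kinv (fun v hv => ?_) hμ
  rw [extMap_ιC, extMap_ιC]
  congr 1
  change Complex.I⁻¹ • opC J₁.1 v = _
  rw [h, opC_mul, mem_V10.mp hv, map_smul, inv_smul_smul₀ Complex.I_ne_zero]

theorem extMap_rot_mem_Kinv (hA : A ∈ tangent J) (h : J₁.1 = rot A t * J.1) {μ : CExt V}
    (hμ : μ ∈ Kinv J) : extMap (opC (rot A (1 / 2 * t))) μ ∈ Kinv J₁ := by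
  have h1 := Submodule.mem_map_of_mem (f := (extMap (opC (rot A (1 / 2 * t)))).toLinearMap) hμ
  rw [Kinv, Submodule.map_pow] at h1
  suffices h2 : Submodule.map (extMap (opC (rot A (1 / 2 * t)))).toLinearMap ((V10 J).map ιC) ≤
      (V10 J₁).map ιC from pow_le_pow_left' h2 n h1
  rintro _ ⟨_, ⟨v, hv, rfl⟩, rfl⟩
  exact ⟨_, (opC_rot_mem_V10 hA h).mpr hv, (extMap_ιC _ _).symm⟩

theorem opC_mem_V01 (hA : A ∈ tangent J) {v : Cplx V} (hv : v ∈ V10 J) : opC A v ∈ V01 J := by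
  rw [mem_V01, ← opC_mul, ← neg_neg (J.1 * A), ← (mem_tangent_iff.mp hA).1, opC_neg, opC_mul,
    mem_V10.mp hv, map_smul, neg_smul]

/-- The rotated vector is of type `(1,0)` at `J₁`, and `A` maps it to type `(0,1)`, so the
projection annihilates its velocity. The product rule extends this from single vectors to their
products. -/
theorem hasVecDerivWithinAt_extMap_rot (hA : A ∈ tangent J) (h : J₁.1 = rot A t * J.1)
    {μ : CExt V} (hμ : μ ∈ Kinv J) {s : Set ℝ} (ht : t ∈ s) :
    ∃ μ', HasVecDerivWithinAt (fun r => extMap (opC (rot A (1 / 2 * r))) μ) μ' s t ∧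
      extMap (projV J₁) μ' = 0 := by
  rw [Kinv] at hμ
  refine Submodule.pow_induction_on_left _ (C := fun μ => ∃ μ', HasVecDerivWithinAt
    (fun r => extMap (opC (rot A (1 / 2 * r))) μ) μ' s t ∧ extMap (projV J₁) μ' = 0) (fun r => ?_)
    (fun x y hx hy => ?_) (fun m hm x hx => ?_) hμ
  · refine ⟨0, ?_, map_zero _⟩
    simp only [AlgHom.commutes]
    exact hasVecDerivWithinAt_const _
  · obtain ⟨x', hx1, hx2⟩ := hx
    obtain ⟨y', hy1, hy2⟩ := hy
    refine ⟨x' + y', ?_, by rw [map_add, hx2, hy2, add_zero]⟩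
    simp only [map_add]
    exact hx1.add hy1
  · obtain ⟨v, hv, rfl⟩ := hm
    obtain ⟨x', hx1, hx2⟩ := hx
    have h1 := (hasVecDerivWithinAt_opC_rot A v (1 / 2) s t).linear ιC
    have h2 := h1.mul hx1
    refine ⟨_, h2.congr (fun r _ => ?_) ht, ?_⟩
    · rw [map_mul, extMap_ιC]
    · rw [map_add, map_mul, map_mul, hx2, extMap_ιC, map_smul, projV_of_mem_V01
        (opC_mem_V01 (mem_tangent_of_rot hA h) ((opC_rot_mem_V10 hA h).mpr hv))]
      simp

/-- A factor from `M` can be moved to the right, up to sign, until it meets `x`. Hence the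
components `v i` drop out. -/
theorem list_prod_mul_of_killed {ι : Type*} {M : Submodule ℂ (Cplx V)} {x : CExt V}
    (hx : ∀ v ∈ M, ιC v * x = 0) (c : ι → ℂ) (e v : ι → Cplx V) (hv : ∀ i, v i ∈ M)
    (l : List ι) :
    (l.map fun i => ιC (c i • e i + v i)).prod * x =
        (l.map c).prod • ((l.map fun i => ιC (e i)).prod * x) ∧
      ∀ w ∈ M, ιC w * ((l.map fun i => ιC (e i)).prod * x) = 0 := by
  induction l with
  | nil => simpa using hx
  | cons i l ih =>
    obtain ⟨h1, h2⟩ := ih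
    simp only [List.map_cons, List.prod_cons]
    refine ⟨?_, fun w hw => ?_⟩
    · rw [mul_assoc, h1, map_add, add_mul, mul_smul_comm, mul_smul_comm, h2 _ (hv i), smul_zero,
        add_zero, map_smul, smul_mul_assoc, smul_smul, mul_comm, mul_assoc]
    · rw [mul_assoc, ← mul_assoc, ιC_mul_ιC, smul_mul_assoc, mul_assoc, h2 w hw, mul_zero,
        smul_zero]

/-- The basis of an eigenbasis, in the order `x₁, J x₁, x₂, J x₂, …`. -/
def Eigenbasis.frame (E : Eigenbasis J A) : Basis (Fin (2 * n)) ℝ V :=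
  E.b.toBasis.reindex (finProdFinEquiv.trans (finCongr (mul_comm n 2)))

theorem Eigenbasis.frame_apply (E : Eigenbasis J A) (k : Fin n) (i : Fin 2)
    (h : 2 * (k : ℕ) + i < 2 * n) : E.frame ⟨2 * k + i, h⟩ = E.b (k, i) := by
  rw [Eigenbasis.frame, Basis.reindex_apply, OrthonormalBasis.coe_toBasis]
  congr 1
  rw [Equiv.symm_apply_eq]
  apply Fin.ext
  simp [finProdFinEquiv, add_comm]

/-- Half-way rotations change the pairing of the canonical lines by the product of cosines. -/
theorem pairK_extMap_rot_left (hA : A ∈ tangent J) (E : Eigenbasis J A) (t : ℝ) {μ ν : CExt V}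
    (hμ : μ ∈ Kinv J) (hν : ν ∈ Kinv J) :
    pairK o (extMap (opC (rot A (1 / 2 * t))) μ) ν = E.cosProd t * pairK o μ ν := by
  obtain ⟨hAJ, hsk⟩ := mem_tangent_iff.mp hA
  have hAJ' : ∀ x, A (J.1 x) = -J.1 (A x) := fun x => congrArg (fun T : V →L[ℝ] V => T x) hAJ
  have hb : ∀ k : Fin n, E.frame ⟨2 * k + 1, by omega⟩ = J.1 (E.frame ⟨2 * k, by omega⟩) :=
    fun k => (E.frame_apply k 1 (by simp; omega)).trans
      ((E.J_b k).symm.trans (congrArg J.1 (E.frame_apply k 0 (by simp)).symm))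
  have hV := V10_eq_span hb E.frame.span_eq
  set e : Fin n → Cplx V := fun k => holVec J (E.frame ⟨2 * k, by omega⟩) with he
  have hK := Kinv_eq_span hV
  rw [hK, Submodule.mem_span_singleton] at hμ hν
  obtain ⟨a, rfl⟩ := hμ
  obtain ⟨c, rfl⟩ := hν
  rw [map_smul, pairK_smul_left, pairK_smul_right, pairK_smul_left, pairK_smul_right]
  suffices hw : pairK o (extMap (opC (rot A (1 / 2 * t))) (wedgeC n e)) (wedgeC n e) =
      E.cosProd t * pairK o (wedgeC n e) (wedgeC n e) by rw [hw]; ring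
  have hx : ∀ v ∈ V10 J, ιC v * wedgeC n e = 0 := by
    intro v hv
    rw [hV] at hv
    induction hv using Submodule.span_induction with
    | zero => simp
    | add x y _ _ hx hy => rw [map_add, add_mul, hx, hy, add_zero]
    | smul r x _ hx => rw [map_smul, smul_mul_assoc, hx, smul_zero]
    | mem x hx =>
      obtain ⟨k, rfl⟩ := hx
      exact ιC_mul_wedgeC_self e k
  -- Since `A` sends type `(0,1)` to type `(1,0)`, the sine term lies in `V10 J`, which annihilates
  -- the top product of the frame; only the cosines remain.
  have hrot : ∀ k, opC (rot A (1 / 2 * t)) (conjV V (e k)) =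
      (Real.cos (t * E.θ k / 2) : ℂ) • conjV V (e k) +
        ((Real.sin (t * E.θ k / 2) / E.θ k : ℝ) : ℂ) • holVec J (A (E.b (k, 0))) := by
    intro k
    have ek : e k = holVec J (E.b (k, 0)) := congrArg (holVec J) (E.frame_apply k 0 (by simp))
    have h1 := E.A_A_b (k, 0)
    have h2 : A (A (J.1 (E.b (k, 0)))) = -(E.θ k ^ 2) • J.1 (E.b (k, 0)) := by
      rw [A_A_J hA, h1, map_smul]
    rw [ek, conjV_holVec, map_smul, map_add, opC_tmul, opC_tmul, rot_eigen hsk h1,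
      rot_eigen hsk h2, hAJ', holVec, show 1 / 2 * t * E.θ k = t * E.θ k / 2 by ring]
    simp only [TensorProduct.tmul_add, TensorProduct.tmul_smul, ← coe_smul_tensor,
      TensorProduct.tmul_neg]
    module
  have h1 : conj (wedgeC n e) = ((List.finRange n).map fun k => ιC (conjV V (e k))).prod := by
    rw [wedgeC_apply, map_list_prod, List.map_ofFn, List.ofFn_eq_map]
    congr 2
  have h2 : conj (extMap (opC (rot A (1 / 2 * t))) (wedgeC n e)) =
      ((List.finRange n).map fun k => ιC ((Real.cos (t * E.θ k / 2) : ℂ) • conjV V (e k) +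
        ((Real.sin (t * E.θ k / 2) / E.θ k : ℝ) : ℂ) • holVec J (A (E.b (k, 0))))).prod := by
    rw [opC, conj_extMap, h1, map_list_prod, List.map_map]
    congr 2
    funext k
    rw [← hrot]
    exact extMap_ιC _ _
  have h3 := (list_prod_mul_of_killed hx (fun k => (Real.cos (t * E.θ k / 2) : ℂ))
    (fun k => conjV V (e k))
    (fun k => ((Real.sin (t * E.θ k / 2) / E.θ k : ℝ) : ℂ) • holVec J (A (E.b (k, 0))))
    (fun k => Submodule.smul_mem _ _ (holVec_mem _ _)) (List.finRange n)).1
  have h4 : ((List.finRange n).map fun k => (Real.cos (t * E.θ k / 2) : ℂ)).prod =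
      (E.cosProd t : ℂ) := by
    rw [Eigenbasis.cosProd, Complex.ofReal_prod, ← List.ofFn_eq_map, List.prod_ofFn]
  rw [pairK, pairK, h2, h3, h1, h4, map_smul, smul_eq_mul]
  ring

variable {γ : ℝ → Jg o}

/-- Parallel sections of the canonical bundle along a geodesic. -/
theorem IsParallelK.eq_smul (hA : A ∈ tangent (γ 0))
    (hγ : ∀ t ∈ Icc (0 : ℝ) 1, (γ t).1 = rot A t * (γ 0).1) {μ : CExt V} (hμ : μ ∈ Kinv (γ 0))
    (h0 : μ ≠ 0) {ν : ∀ t, Kinv (γ t)} (hν : IsParallelK γ ν) :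
    ∃ k : ℂ, ∀ t ∈ Icc (0 : ℝ) 1, (ν t : CExt V) = k • extMap (opC (rot A (1 / 2 * t))) μ := by
  have hsk := (mem_tangent_iff.mp hA).2
  obtain ⟨p, hp, hpμ⟩ := pairK_self_pos hμ h0
  have hp' : (p : ℂ) ≠ 0 := Complex.ofReal_ne_zero.mpr hp.ne'
  let E : ℝ → CExt V := fun t => extMap (opC (rot A (1 / 2 * t))) μ
  have hEp : ∀ t, pairK o (E t) (E t) = p := fun t => (pairK_extMap_rot hsk _ μ μ).trans hpμ
  have hE0 : ∀ t, E t ≠ 0 := fun t h => hp' (by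
    rw [← hEp t, h, ← pairKL_apply, map_zero])
  have hEm : ∀ t ∈ Icc (0 : ℝ) 1, E t ∈ Kinv (γ t) := fun t ht => extMap_rot_mem_Kinv hA (hγ t ht) hμ
  -- Expressing the coefficient through the pairing, whose value on `E t` is the constant `p`, makes
  -- it differentiable.
  let k : ℝ → ℂ := fun t => pairKL o (E t) (ν t : CExt V) * (p : ℂ)⁻¹
  have hk : ∀ t ∈ Icc (0 : ℝ) 1, (ν t : CExt V) = k t • E t := by
    intro t ht
    obtain ⟨c, hc⟩ := exists_smul_of_mem_Kinv (hEm t ht) (hE0 t) (ν t).2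
    have : k t = c := by
      simp only [k]
      rw [hc, pairKL_apply, pairK_smul_right, hEp, mul_assoc, mul_inv_cancel₀ hp', mul_one]
    rw [this, hc]
  refine ⟨k 0, fun t ht => ?_⟩
  have hconst := eq_of_hasDerivWithinAt_zero (f := k) (fun t ht => ?_) ht
  · rw [hk t ht, hconst]
  · obtain ⟨ν', hν1, hν2⟩ := hν t ht
    obtain ⟨E', hE1, hE2⟩ := hasVecDerivWithinAt_extMap_rot hA (hγ t ht) hμ ht
    have hkd : ∃ k', HasDerivWithinAt k k' (Icc 0 1) t := by
      have h1 := ((hE1.semilinear conjS).bilin hν1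
        ((((-1) ^ (n * (n + 1) / 2) / Complex.I ^ n : ℂ) • LinearMap.mul ℂ (CExt V)).compr₂
          (topCoeff o)))
      exact ⟨_, (hasVecDerivWithinAt_complex.mp h1).mul_const _⟩
    obtain ⟨k', hk'⟩ := hkd
    have h2 := ((HasVecDerivWithinAt.smul hk' hE1).congr hk ht)
    have h3 : ν' = k' • E t + k t • E' := by
      have : ∀ l : Dual ℂ (CExt V), l ν' = l (k' • E t + k t • E') := fun l =>
        hasDerivWithinAt_unique ht (hν1 l) (h2 l)
      rw [← sub_eq_zero]
      refine (Module.forall_dual_apply_eq_zero_iff ℂ _).mp fun l => ?_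
      rw [map_sub, this l, sub_self]
    -- Projection annihilates both `ν'` and `E'`, leaving `0 = k' E`.
    have h4 := congrArg (extMap (projV (γ t))) h3
    rw [hν2, map_add, map_smul, map_smul, hE2, smul_zero, add_zero,
      extMap_projV_of_mem (hEm t ht)] at h4
    have : k' = 0 := (smul_eq_zero.mp h4.symm).resolve_right (hE0 t)
    rwa [this] at hk'

end CanonicalTransport

/-! ### Continuous sections of line bundles along curves -/

section LineBundle

open Filter Topology Bundle

variable {B : Type*} [TopologicalSpace B] {L : B → Type*} [∀ b, AddCommGroup (L b)]
  [∀ b, Module ℂ (L b)] [∀ b, TopologicalSpace (L b)] [TopologicalSpace (TotalSpace ℂ L)]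
  [FiberBundle ℂ L] [VectorBundle ℂ ℂ L]

theorem exists_smul_of_line {b : B} {s : L b} (hs : s ≠ 0) (s' : L b) : ∃ c : ℂ, s' = c • s := by
  let e := (trivializationAt ℂ L b).linearEquivAt ℂ b (mem_baseSet_trivializationAt ℂ L b)
  have h : e s ≠ 0 := e.map_ne_zero_iff.mpr hs
  refine ⟨e s' / e s, e.injective ?_⟩
  rw [map_smul, smul_eq_mul, div_mul_cancel₀ _ h]

theorem exists_ne_zero_line (b : B) : ∃ s : L b, s ≠ 0 := by
  let e := (trivializationAt ℂ L b).linearEquivAt ℂ b (mem_baseSet_trivializationAt ℂ L b)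
  exact ⟨e.symm 1, e.symm.map_ne_zero_iff.mpr one_ne_zero⟩

variable {X : Type*} [TopologicalSpace X] {γ : X → B} {I : Set X}

theorem continuousOn_smul_section {c : X → ℂ} {s : ∀ x, L (γ x)} (hc : ContinuousOn c I)
    (hs : ContinuousOn (fun x => (⟨γ x, s x⟩ : TotalSpace ℂ L)) I) :
    ContinuousOn (fun x => (⟨γ x, c x • s x⟩ : TotalSpace ℂ L)) I := by
  intro x hx
  have h := (FiberBundle.continuousWithinAt_totalSpace _ _).mp (hs x hx)
  refine (FiberBundle.continuousWithinAt_totalSpace _ _).mpr ⟨h.1, ?_⟩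
  have hmem : ∀ᶠ y in 𝓝[I] x, γ y ∈ (trivializationAt ℂ L (γ x)).baseSet :=
    h.1.eventually ((trivializationAt ℂ L (γ x)).open_baseSet.mem_nhds
      (mem_baseSet_trivializationAt ℂ L _))
  refine ((hc x hx).mul h.2).congr_of_eventuallyEq (hmem.mono fun y hy => ?_) ?_
  · exact ((trivializationAt ℂ L (γ x)).linear ℂ hy).map_smul _ _
  · exact ((trivializationAt ℂ L (γ x)).linear ℂ (mem_baseSet_trivializationAt ℂ L _)).map_smul _ _

/-- In a local trivialisation `c` is a quotient of continuous functions with nonvanishing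
denominator. -/
theorem continuousOn_ratio {c : X → ℂ} {s s' : ∀ x, L (γ x)}
    (hs : ContinuousOn (fun x => (⟨γ x, s x⟩ : TotalSpace ℂ L)) I)
    (hs' : ContinuousOn (fun x => (⟨γ x, s' x⟩ : TotalSpace ℂ L)) I)
    (h0 : ∀ x ∈ I, s x ≠ 0) (hc : ∀ x ∈ I, s' x = c x • s x) : ContinuousOn c I := by
  intro x hx
  have h := (FiberBundle.continuousWithinAt_totalSpace _ _).mp (hs x hx)
  have h' := (FiberBundle.continuousWithinAt_totalSpace _ _).mp (hs' x hx)
  have hmem : ∀ᶠ y in 𝓝[I] x, γ y ∈ (trivializationAt ℂ L (γ x)).baseSet :=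
    h.1.eventually ((trivializationAt ℂ L (γ x)).open_baseSet.mem_nhds
      (mem_baseSet_trivializationAt ℂ L _))
  have key : ∀ y ∈ I, γ y ∈ (trivializationAt ℂ L (γ x)).baseSet →
      (trivializationAt ℂ L (γ x) ⟨γ y, s y⟩).2 ≠ 0 ∧
      c y = (trivializationAt ℂ L (γ x) ⟨γ y, s' y⟩).2 /
        (trivializationAt ℂ L (γ x) ⟨γ y, s y⟩).2 := by
    intro y hy hyb
    let e := (trivializationAt ℂ L (γ x)).linearEquivAt ℂ (γ y) hyb
    have h1 : e (s y) ≠ 0 := e.map_ne_zero_iff.mpr (h0 y hy)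
    refine ⟨h1, (eq_div_iff h1).mpr ?_⟩
    change c y * e (s y) = e (s' y)
    rw [hc y hy, map_smul, smul_eq_mul]
  refine (h'.2.div h.2 (key x hx (mem_baseSet_trivializationAt ℂ L _)).1).congr_of_eventuallyEq
    ?_ (key x hx (mem_baseSet_trivializationAt ℂ L _)).2
  filter_upwards [hmem, self_mem_nhdsWithin] with y hy hyI
  exact (key y hyI hy).2

end LineBundle

/-! ### Continuous square roots of curves in the canonical bundle -/

section HalfForms

open Filter Topology Bundle

variable {V : Type*} [NormedAddCommGroup V] [InnerProductSpace ℝ V] [FiniteDimensional ℝ V]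
  {n : ℕ} [Fact (finrank ℝ V = 2 * n)] {o : Orientation ℝ V (Fin (2 * n))}
  {L : Jg o → Type*} [∀ J, AddCommGroup (L J)] [∀ J, Module ℂ (L J)]
  [∀ J, TopologicalSpace (L J)] [TopologicalSpace (TotalSpace ℂ L)]
  [FiberBundle ℂ L] [VectorBundle ℂ ℂ L] (S : SquareRoot L) {J : Jg o}

namespace SquareRoot

theorem mul_mem (s s' : L J) : S.mul s s' ∈ Kinv J := (S.sq J _).2

theorem mul_smul_smul (a c : ℂ) (s s' : L J) : S.mul (a • s) (c • s') = (a * c) • S.mul s s' := by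
  rw [SquareRoot.mul, TensorProduct.smul_tmul_smul, map_smul, Submodule.coe_smul]
  rfl

/-- As `L J` is a line, `s ⊗ s = 0` would make `L J ⊗ L J` vanish, whereas the isomorphic space
`Kinv J` does not. -/
theorem mul_self_ne_zero {s : L J} (hs : s ≠ 0) : S.mul s s ≠ 0 := by
  intro h
  have h1 : s ⊗ₜ[ℂ] s = 0 := (S.sq J).map_eq_zero_iff.mp (Subtype.ext h)
  obtain ⟨μ, hμ, p, hp, hpμ, -⟩ := exists_generator_Kinv J
  have h2 : ∀ x : L J ⊗[ℂ] L J, x = 0 := by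
    intro x
    induction x using TensorProduct.induction_on with
    | zero => rfl
    | add x y hx hy => rw [hx, hy, add_zero]
    | tmul a c =>
      obtain ⟨a, rfl⟩ := exists_smul_of_line hs a
      obtain ⟨c, rfl⟩ := exists_smul_of_line hs c
      rw [TensorProduct.tmul_smul, ← TensorProduct.smul_tmul', h1, smul_zero, smul_zero]
  have h3 : (⟨μ, hμ⟩ : Kinv J) = 0 := by
    rw [← (S.sq J).apply_symm_apply ⟨μ, hμ⟩, h2 ((S.sq J).symm _), map_zero]
  have h4 : μ = 0 := congrArg Subtype.val h3
  rw [h4, ← pairKL_apply, map_zero] at hpμ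
  exact hp.ne (Complex.ofReal_eq_zero.mp hpμ.symm).symm

theorem exists_sign {s s' : L J} (hs : s ≠ 0) (h : S.mul s' s' = S.mul s s) :
    ∃ c : ℂ, c ^ 2 = 1 ∧ s' = c • s := by
  obtain ⟨c, rfl⟩ := exists_smul_of_line hs s'
  refine ⟨c, ?_, rfl⟩
  rw [S.mul_smul_smul, ← sub_eq_zero] at h
  nth_rewrite 2 [← one_smul ℂ (S.mul s s)] at h
  rw [← sub_smul, smul_eq_zero] at h
  rw [pow_two]
  exact sub_eq_zero.mp (h.resolve_right (S.mul_self_ne_zero hs))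

variable {γ : ℝ → Jg o} {M : ℝ → CExt V}

/-- A continuous curve in the canonical bundle has local square roots. -/
theorem exists_local_lift {I : Set ℝ} (hγ : ContinuousOn γ I)
    (hM : ∀ l : Dual ℂ (CExt V), ContinuousOn (fun t => l (M t)) I)
    (hMm : ∀ t ∈ I, M t ∈ Kinv (γ t)) (hM0 : ∀ t ∈ I, M t ≠ 0) {t₀ : ℝ} (ht₀ : t₀ ∈ I) :
    ∃ O : Set ℝ, IsOpen O ∧ t₀ ∈ O ∧ ∃ σ : ∀ t, L (γ t),
      ContinuousOn (fun t => (⟨γ t, σ t⟩ : TotalSpace ℂ L)) (O ∩ I) ∧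
      ∀ t ∈ O ∩ I, S.mul (σ t) (σ t) = M t := by
  let e := trivializationAt ℂ L (γ t₀)
  have hb₀ : γ t₀ ∈ e.baseSet := mem_baseSet_trivializationAt ℂ L _
  have h1 : ∀ᶠ t in 𝓝[I] t₀, γ t ∈ e.baseSet := (hγ t₀ ht₀).eventually (e.open_baseSet.mem_nhds hb₀)
  obtain ⟨O₁, hO₁, ht₁, hb⟩ := mem_nhdsWithin.mp h1
  replace hb : ∀ t ∈ O₁ ∩ I, γ t ∈ e.baseSet := hb
  let σ : ∀ t, L (γ t) := fun t => e.symm (γ t) 1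
  have hσ : ContinuousOn (fun t => (⟨γ t, σ t⟩ : TotalSpace ℂ L)) (O₁ ∩ I) :=
    e.continuousOn_symm.comp ((hγ.mono inter_subset_right).prodMk continuousOn_const)
      fun t ht => ⟨hb t ht, mem_univ _⟩
  have hσ0 : ∀ t ∈ O₁ ∩ I, σ t ≠ 0 := fun t ht =>
    (e.linearEquivAt ℂ (γ t) (hb t ht)).symm.map_ne_zero_iff.mpr one_ne_zero
  have ht₀' : t₀ ∈ O₁ ∩ I := ⟨ht₁, ht₀⟩
  let q : ℝ → CExt V := fun t => S.mul (σ t) (σ t)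
  have hq : ∀ l : Dual ℂ (CExt V), ContinuousOn (fun t => l (q t)) (O₁ ∩ I) := fun l =>
    (S.continuous_sq l).comp_continuousOn hσ
  obtain ⟨l, hl⟩ : ∃ l : Dual ℂ (CExt V), l (q t₀) ≠ 0 := by
    by_contra! h
    exact S.mul_self_ne_zero (hσ0 t₀ ht₀') ((Module.forall_dual_apply_eq_zero_iff ℂ _).mp h)
  let c : ℝ → ℂ := fun t => l (M t) / l (q t)
  have hMq : ∀ t ∈ O₁ ∩ I, l (q t) ≠ 0 → M t = c t • q t := by
    intro t ht hlt
    obtain ⟨k, hk⟩ := exists_smul_of_mem_Kinv (S.mul_mem (σ t) (σ t))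
      (S.mul_self_ne_zero (hσ0 t ht)) (hMm t ht.2)
    have : c t = k := by
      simp only [c]
      rw [hk, map_smul, smul_eq_mul]
      exact mul_div_cancel_right₀ _ hlt
    rw [this]
    exact hk
  have hc₀ : c t₀ ≠ 0 := fun h => hM0 t₀ ht₀ (by rw [hMq t₀ ht₀' hl, h, zero_smul])
  have h2 : ∀ᶠ t in 𝓝[O₁ ∩ I] t₀, l (q t) ≠ 0 := (hq l t₀ ht₀').eventually_ne hl
  have hc : ContinuousWithinAt c (O₁ ∩ I) t₀ :=
    ((hM l).mono inter_subset_right t₀ ht₀').div (hq l t₀ ht₀') hl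
  have h3 : ∀ᶠ t in 𝓝[O₁ ∩ I] t₀, c t / c t₀ ∈ Complex.slitPlane := by
    refine (hc.div_const (c t₀)).eventually (Complex.isOpen_slitPlane.mem_nhds ?_)
    change c t₀ / c t₀ ∈ _
    rw [div_self hc₀]
    exact Complex.one_mem_slitPlane
  obtain ⟨O₂, hO₂, ht₂, hO⟩ := mem_nhdsWithin.mp (h2.and h3)
  obtain ⟨z, hz⟩ := IsAlgClosed.exists_pow_nat_eq (c t₀) two_pos
  -- Dividing by `c t₀` brings the argument close to `1`, away from the cut of the principal root;
  -- `z` restores the constant.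
  let r : ℝ → ℂ := fun t => z * (c t / c t₀) ^ ((2 : ℕ) : ℂ)⁻¹
  have hr : ∀ t, r t * r t = c t := by
    intro t
    rw [← pow_two, mul_pow, hz, Complex.cpow_nat_inv_pow _ two_ne_zero, mul_div_cancel₀ _ hc₀]
  have hsub : O₂ ∩ O₁ ∩ I ⊆ O₁ ∩ I := fun t ht => ⟨ht.1.2, ht.2⟩
  have hgood : ∀ t ∈ O₂ ∩ O₁ ∩ I, l (q t) ≠ 0 ∧ c t / c t₀ ∈ Complex.slitPlane :=
    fun t ht => hO ⟨ht.1.1, hsub ht⟩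
  refine ⟨O₂ ∩ O₁, hO₂.inter hO₁, ⟨ht₂, ht₁⟩, fun t => r t • σ t, ?_, fun t ht => ?_⟩
  · refine continuousOn_smul_section ?_ (hσ.mono hsub)
    refine continuousOn_const.mul (ContinuousOn.cpow_const ?_ fun t ht => (hgood t ht).2)
    exact ((((hM l).mono inter_subset_right).div ((hq l).mono hsub)
      fun t ht => (hgood t ht).1).div_const _)
  · rw [S.mul_smul_smul, hr]
    exact (hMq t (hsub ht) (hgood t ht).1).symm

/-- A continuous curve in the canonical bundle has a square root with a given initial value. -/
theorem exists_lift (hγ : ContinuousOn γ (Icc 0 1))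
    (hM : ∀ l : Dual ℂ (CExt V), ContinuousOn (fun t => l (M t)) (Icc 0 1))
    (hMm : ∀ t ∈ Icc (0 : ℝ) 1, M t ∈ Kinv (γ t)) (hM0 : ∀ t ∈ Icc (0 : ℝ) 1, M t ≠ 0)
    {s₀ : L (γ 0)} (hs₀ : S.mul s₀ s₀ = M 0) :
    ∃ e : ∀ t, L (γ t), e 0 = s₀ ∧
      ContinuousOn (fun t => (⟨γ t, e t⟩ : TotalSpace ℂ L)) (Icc 0 1) ∧
      ∀ t ∈ Icc (0 : ℝ) 1, S.mul (e t) (e t) = M t := by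
  choose O hO hOm σ hσ hσM using fun t : Icc (0 : ℝ) 1 =>
    S.exists_local_lift hγ hM hMm hM0 t.2
  obtain ⟨τ, hτ0, hτmono, ⟨m, hm⟩, hτ⟩ := exists_monotone_Icc_subset_open_cover_Icc
    (zero_le_one (α := ℝ)) (c := fun i => Subtype.val ⁻¹' O i)
    (fun i => (hO i).preimage continuous_subtype_val)
    (fun t _ => mem_iUnion.mpr ⟨t, hOm t⟩)
  have key : ∀ k : ℕ, ∃ e : ∀ t, L (γ t), e 0 = s₀ ∧
      ContinuousOn (fun t => (⟨γ t, e t⟩ : TotalSpace ℂ L)) (Icc 0 (τ k)) ∧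
      ∀ t ∈ Icc (0 : ℝ) (τ k), S.mul (e t) (e t) = M t := by
    intro k
    induction k with
    | zero =>
      refine ⟨Function.update (fun _ => 0) 0 s₀, Function.update_self .., ?_, ?_⟩
      · rw [hτ0, Icc_self]
        exact continuousOn_singleton _ _
      · intro t ht
        rw [hτ0, Icc_self, mem_singleton_iff] at ht
        subst ht
        rw [Function.update_self, hs₀]
    | succ k ih =>
      obtain ⟨e, he0, hec, heM⟩ := ih
      obtain ⟨i, hi⟩ := hτ k
      have hle : (τ k : ℝ) ≤ τ (k + 1) := hτmono k.le_succ
      have h0k : (0 : ℝ) ≤ τ k := (τ k).2.1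
      have hiO : ∀ t ∈ Icc (τ k : ℝ) (τ (k + 1)), t ∈ O i ∩ Icc 0 1 := by
        intro t ht
        have ht' : t ∈ Icc (0 : ℝ) 1 := ⟨h0k.trans ht.1, ht.2.trans (τ (k + 1)).2.2⟩
        exact ⟨hi (show (⟨t, ht'⟩ : Icc (0 : ℝ) 1) ∈ Icc (τ k) (τ (k + 1)) from ht), ht'⟩
      have hkO := hiO _ ⟨le_rfl, hle⟩
      have hσ0 : σ i (τ k) ≠ 0 := by
        intro h
        have := hσM i _ hkO
        rw [h] at this
        apply hM0 _ hkO.2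
        rw [← this, ← zero_smul ℂ (0 : L (γ (τ k))), S.mul_smul_smul, zero_mul, zero_smul]
      -- At the node the old root and the next local root differ by a sign, which is used to glue
      -- them continuously.
      obtain ⟨ε, hε, hεe⟩ := S.exists_sign hσ0 ((heM _ ⟨h0k, le_rfl⟩).trans (hσM i _ hkO).symm)
      classical
      let e' : ∀ t, L (γ t) := fun t => if t ≤ τ k then e t else ε • σ i t
      have h1 : ∀ t ∈ Icc (0 : ℝ) (τ k), e' t = e t := fun t ht => if_pos ht.2
      have h2 : ∀ t ∈ Icc (τ k : ℝ) (τ (k + 1)), e' t = ε • σ i t := by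
        intro t ht
        rcases ht.1.eq_or_lt with h | h
        · rw [← h, ← hεe]
          exact if_pos le_rfl
        · exact if_neg (not_le.mpr h)
      refine ⟨e', (h1 0 ⟨le_rfl, h0k⟩).trans he0, ?_, fun t ht => ?_⟩
      · rw [← Icc_union_Icc_eq_Icc h0k hle]
        refine ContinuousOn.union_of_isClosed (hec.congr fun t ht => ?_) ?_ isClosed_Icc isClosed_Icc
        · simp only [h1 t ht]
        · refine (continuousOn_smul_section (c := fun _ => ε) continuousOn_const
            ((hσ i).mono hiO)).congr fun t ht => ?_
          simp only [h2 t ht]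
      · rcases le_total t (τ k) with h | h
        · rw [h1 t ⟨ht.1, h⟩, heM t ⟨ht.1, h⟩]
        · rw [h2 t ⟨h, ht.2⟩, S.mul_smul_smul, ← pow_two, hε, one_smul, hσM i t (hiO t ⟨h, ht.2⟩)]
  have := key m
  rwa [hm m le_rfl] at this

end SquareRoot

end HalfForms

/-! ### Transport and pairing of half-forms -/

section HalfFormTransport

open Filter Topology Bundle

variable {V : Type*} [NormedAddCommGroup V] [InnerProductSpace ℝ V] [FiniteDimensional ℝ V]
  {n : ℕ} [Fact (finrank ℝ V = 2 * n)] {o : Orientation ℝ V (Fin (2 * n))}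
  {L : Jg o → Type*} [∀ J, AddCommGroup (L J)] [∀ J, Module ℂ (L J)]
  [∀ J, TopologicalSpace (L J)] [TopologicalSpace (TotalSpace ℂ L)]

/-- A frame of the line bundle of half-forms along a geodesic, whose square is parallel. -/
structure HalfFormFrame (S : SquareRoot L) (γ : ℝ → Jg o) (A : V →L[ℝ] V) where
  /-- the frame -/
  e : ∀ t, L (γ t)
  /-- the norm of the square of the frame -/
  p : ℝ
  p_pos : 0 < p
  continuousOn : ContinuousOn (fun t => (⟨γ t, e t⟩ : TotalSpace ℂ L)) (Icc 0 1)
  mul_e : ∀ t ∈ Icc (0 : ℝ) 1,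
    S.mul (e t) (e t) = extMap (opC (rot A (1 / 2 * t))) (S.mul (e 0) (e 0))
  pair_e : pairK o (S.mul (e 0) (e 0)) (S.mul (e 0) (e 0)) = p

variable [FiberBundle ℂ L] [VectorBundle ℂ ℂ L] {S : SquareRoot L} {γ : ℝ → Jg o}
  {A : V →L[ℝ] V}

/-- The condition `s ≠ 0` sits inside the conclusion so that a coordinate can be chosen at every
real parameter, although the frame is known to be nonzero only on `[0,1]`. -/
theorem exists_coord {J : Jg o} (s : L J) :
    ∃ φ : L J →ₗ[ℂ] ℂ, s ≠ 0 → ∀ s', s' = φ s' • s := by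
  let e := (trivializationAt ℂ L J).linearEquivAt ℂ J (mem_baseSet_trivializationAt ℂ L J)
  refine ⟨(e s)⁻¹ • e.toLinearMap, fun hs s' => e.injective ?_⟩
  have h : e s ≠ 0 := e.map_ne_zero_iff.mpr hs
  rw [map_smul, LinearMap.smul_apply, smul_eq_mul, smul_eq_mul]
  change e s' = (e s)⁻¹ * e s' * e s
  field_simp

theorem continuousOn_geodesic (hγ : ∀ t ∈ Icc (0 : ℝ) 1, (γ t).1 = rot A t * (γ 0).1) :
    ContinuousOn γ (Icc 0 1) := by
  rw [IsInducing.subtypeVal.continuousOn_iff]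
  refine ContinuousOn.congr (f := fun t => rot A t * (γ 0).1) (fun t _ => ?_) hγ
  exact ((hasDerivAt_rot t).mul_const (γ 0).1).continuousAt.continuousWithinAt

theorem exists_halfFormFrame (S : SquareRoot L) (hA : A ∈ tangent (γ 0))
    (hγ : ∀ t ∈ Icc (0 : ℝ) 1, (γ t).1 = rot A t * (γ 0).1) :
    Nonempty (HalfFormFrame S γ A) := by
  have hsk := (mem_tangent_iff.mp hA).2
  obtain ⟨s₀, hs₀⟩ := exists_ne_zero_line (L := L) (γ 0)
  have hμ := S.mul_mem s₀ s₀
  obtain ⟨p, hp, hpμ⟩ := pairK_self_pos hμ (S.mul_self_ne_zero hs₀)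
  have hc : ∀ l : Dual ℂ (CExt V), ContinuousOn
      (fun t => l (extMap (opC (rot A (1 / 2 * t))) (S.mul s₀ s₀))) (Icc 0 1) := by
    intro l t ht
    obtain ⟨μ', h, -⟩ := hasVecDerivWithinAt_extMap_rot hA (hγ t ht) hμ ht
    exact (h l).continuousWithinAt
  have hne : ∀ t ∈ Icc (0 : ℝ) 1, extMap (opC (rot A (1 / 2 * t))) (S.mul s₀ s₀) ≠ 0 := by
    intro t _ h
    have := pairK_extMap_rot (o := o) hsk (1 / 2 * t) (S.mul s₀ s₀) (S.mul s₀ s₀)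
    rw [h, hpμ, ← pairKL_apply, map_zero] at this
    exact hp.ne (Complex.ofReal_eq_zero.mp this.symm).symm
  have hinit : S.mul s₀ s₀ = extMap (opC (rot A (1 / 2 * 0))) (S.mul s₀ s₀) := by
    rw [mul_zero, rot_zero]
    refine (algHom_eq_of_mem_Kinv (J := γ 0) (g := AlgHom.id ℂ _) (fun v _ => ?_) hμ).symm
    rw [extMap_ιC, opC_one]
    rfl
  obtain ⟨e, he0, hec, heM⟩ := S.exists_lift (continuousOn_geodesic hγ) hc
    (fun t ht => extMap_rot_mem_Kinv hA (hγ t ht) hμ) hne hinit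
  subst he0
  exact ⟨⟨e, p, hp, hec, heM, hpμ⟩⟩

namespace HalfFormFrame

variable (F : HalfFormFrame S γ A)
include F

theorem pairK_e (hA : IsSkew A) {t : ℝ} (ht : t ∈ Icc (0 : ℝ) 1) :
    pairK o (S.mul (F.e t) (F.e t)) (S.mul (F.e t) (F.e t)) = F.p := by
  rw [F.mul_e t ht, pairK_extMap_rot hA, F.pair_e]

theorem e_ne_zero (hA : IsSkew A) {t : ℝ} (ht : t ∈ Icc (0 : ℝ) 1) : F.e t ≠ 0 := by
  intro h
  have := F.pairK_e hA ht
  rw [h, ← zero_smul ℂ (0 : L (γ t)), S.mul_smul_smul, zero_mul, zero_smul, ← pairKL_apply,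
    map_zero] at this
  exact F.p_pos.ne (Complex.ofReal_eq_zero.mp this.symm).symm

theorem inner_e (hA : IsSkew A) {t : ℝ} (ht : t ∈ Icc (0 : ℝ) 1) (a c : ℂ) :
    S.inner (a • F.e t) (c • F.e t) = starRingEnd ℂ a * c * (√F.p : ℝ) := by
  have h1 : pairK o (S.mul (a • F.e t) (a • F.e t)) (S.mul (a • F.e t) (a • F.e t)) =
      ((Complex.normSq a ^ 2 * F.p : ℝ) : ℂ) := by
    rw [S.mul_smul_smul, pairK_smul_left, pairK_smul_right, F.pairK_e hA ht]
    push_cast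
    rw [Complex.normSq_eq_conj_mul_self, map_mul]
    ring
  have h2 : pairK o (S.mul (a • F.e t) (a • F.e t)) (S.mul (a • F.e t) (c • F.e t)) =
      starRingEnd ℂ a * c * (Complex.normSq a * F.p) := by
    rw [S.mul_smul_smul, S.mul_smul_smul, pairK_smul_left, pairK_smul_right, F.pairK_e hA ht]
    rw [Complex.normSq_eq_conj_mul_self, map_mul]
    ring
  rw [SquareRoot.inner, h1, h2, Complex.ofReal_re, Real.sqrt_mul (sq_nonneg _),
    Real.sqrt_sq (Complex.normSq_nonneg a)]
  -- For `a = 0` the quotient defining the inner product is `0 / 0 = 0`, the correct value.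
  by_cases ha : a = 0
  · simp [ha]
  · have h3 : (Complex.normSq a : ℂ) ≠ 0 :=
      Complex.ofReal_ne_zero.mpr (Complex.normSq_pos.mpr ha).ne'
    have h4 : ((√F.p : ℝ) : ℂ) ≠ 0 :=
      Complex.ofReal_ne_zero.mpr (Real.sqrt_pos.mpr F.p_pos).ne'
    have h5 : (F.p : ℂ) = (√F.p : ℝ) * (√F.p : ℝ) := by
      rw [← Complex.ofReal_mul, Real.mul_self_sqrt F.p_pos.le]
    push_cast
    rw [h5]
    field_simp

/-- Parallel sections are the constant multiples of the frame. -/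
theorem eq_smul_of_isParallel (hA : A ∈ tangent (γ 0))
    (hγ : ∀ t ∈ Icc (0 : ℝ) 1, (γ t).1 = rot A t * (γ 0).1) {s : ∀ t, L (γ t)}
    (hs : S.IsParallel γ s) : ∃ k : ℂ, ∀ t ∈ Icc (0 : ℝ) 1, s t = k • F.e t := by
  have hsk := (mem_tangent_iff.mp hA).2
  have h0 : (0 : ℝ) ∈ Icc (0 : ℝ) 1 := ⟨le_rfl, zero_le_one⟩
  choose φ hφ using fun t => exists_coord (F.e t)
  have hc : ∀ t ∈ Icc (0 : ℝ) 1, s t = φ t (s t) • F.e t := fun t ht =>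
    hφ t (F.e_ne_zero hsk ht) (s t)
  have hcont := continuousOn_ratio F.continuousOn hs.1 (fun t ht => F.e_ne_zero hsk ht) hc
  obtain ⟨κ, hκ⟩ := hs.2.eq_smul hA hγ (S.mul_mem (F.e 0) (F.e 0))
    (S.mul_self_ne_zero (F.e_ne_zero hsk h0))
  have hsq : ∀ t ∈ Icc (0 : ℝ) 1, φ t (s t) ^ 2 = κ := by
    intro t ht
    have h1 : S.mul (s t) (s t) = κ • S.mul (F.e t) (F.e t) := by
      rw [F.mul_e t ht]; exact hκ t ht
    rw [hc t ht, S.mul_smul_smul, ← sub_eq_zero, ← sub_smul, smul_eq_zero] at h1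
    have h2 := sub_eq_zero.mp (h1.resolve_right (S.mul_self_ne_zero (F.e_ne_zero hsk ht)))
    rw [pow_two, h2]
  refine ⟨φ 0 (s 0), fun t ht => ?_⟩
  rw [hc t ht]
  congr 1
  -- If the constant square is zero, so is the coefficient. Otherwise a continuous square root of a
  -- nonzero constant cannot change sign on an interval.
  by_cases hκ0 : κ = 0
  · have h1 := hsq t ht
    have h2 := hsq 0 h0
    rw [hκ0] at h1 h2
    rw [pow_eq_zero_iff two_ne_zero] at h1 h2
    rw [h1, h2]
  · refine isPreconnected_Icc.eq_of_sq_eq hcont (continuousOn_const (c := φ 0 (s 0)))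
      (fun t ht => (hsq t ht).trans (hsq 0 h0).symm) (fun _ h => ?_) h0 rfl ht
    have h2 := hsq 0 h0
    rw [h] at h2
    exact hκ0 (by rw [← h2]; simp)

theorem exists_transport (hA : A ∈ tangent (γ 0))
    (hγ : ∀ t ∈ Icc (0 : ℝ) 1, (γ t).1 = rot A t * (γ 0).1) :
    ∃ U : L (γ 0) →ₗ[ℂ] L (γ 1), S.IsTransport γ U ∧ S.IsSqrtDet γ U := by
  have hsk := (mem_tangent_iff.mp hA).2
  have h0 : (0 : ℝ) ∈ Icc (0 : ℝ) 1 := ⟨le_rfl, zero_le_one⟩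
  obtain ⟨φ, hφ⟩ := exists_coord (F.e 0)
  replace hφ := hφ (F.e_ne_zero hsk h0)
  let R : ∀ t, L (γ 0) →ₗ[ℂ] L (γ t) := fun t => φ.smulRight (F.e t)
  have hR0 : R 0 = LinearMap.id := LinearMap.ext fun s => (hφ s).symm
  have hRc : ∀ s, ContinuousOn (fun t => (⟨γ t, R t s⟩ : TotalSpace ℂ L)) (Icc 0 1) := fun s =>
    continuousOn_smul_section (c := fun _ => φ s) continuousOn_const F.continuousOn
  have hRm : ∀ t ∈ Icc (0 : ℝ) 1, ∀ s s', S.mul (R t s) (R t s') =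
      extMap (opC (rot A (1 / 2 * t))) (S.mul s s') := by
    intro t ht s s'
    change S.mul (φ s • F.e t) (φ s' • F.e t) = _
    rw [S.mul_smul_smul, F.mul_e t ht, ← map_smul, ← S.mul_smul_smul, ← hφ s, ← hφ s']
  refine ⟨R 1, fun s₀ => ⟨fun t => R t s₀, ⟨hRc s₀, fun t ht => ?_⟩, ?_, rfl⟩,
    R, hR0, rfl, hRc, fun t ht s s' => ?_⟩
  · obtain ⟨μ', h1, h2⟩ := hasVecDerivWithinAt_extMap_rot hA (hγ t ht) (S.mul_mem s₀ s₀) ht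
    exact ⟨μ', h1.congr (fun r hr => hRm r hr s₀ s₀) ht, h2⟩
  · change R 0 s₀ = s₀
    rw [hR0]; rfl
  · have ht2 : t / 2 ∈ Icc (0 : ℝ) 1 := ⟨by linarith [ht.1], by linarith [ht.2]⟩
    rw [hRm t ht, extMap_JC_of_mem (hγ _ ht2) (S.mul_mem s s'),
      show 1 / 2 * t = t / 2 by ring]

theorem isParallel_eq_transport (hA : A ∈ tangent (γ 0))
    (hγ : ∀ t ∈ Icc (0 : ℝ) 1, (γ t).1 = rot A t * (γ 0).1) {U : L (γ 0) →ₗ[ℂ] L (γ 1)}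
    (hU : S.IsTransport γ U) {s : ∀ t, L (γ t)} (hs : S.IsParallel γ s) : s 1 = U (s 0) := by
  have hsk := (mem_tangent_iff.mp hA).2
  have h0 : (0 : ℝ) ∈ Icc (0 : ℝ) 1 := ⟨le_rfl, zero_le_one⟩
  have h1 : (1 : ℝ) ∈ Icc (0 : ℝ) 1 := ⟨zero_le_one, le_rfl⟩
  obtain ⟨s', hs', h2, h3⟩ := hU (s 0)
  obtain ⟨k, hk⟩ := F.eq_smul_of_isParallel hA hγ hs
  obtain ⟨k', hk'⟩ := F.eq_smul_of_isParallel hA hγ hs'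
  have : k' = k := by
    rw [hk' 0 h0, hk 0 h0, ← sub_eq_zero, ← sub_smul, smul_eq_zero] at h2
    exact sub_eq_zero.mp (h2.resolve_right (F.e_ne_zero hsk h0))
  rw [← h3, hk 1 h1, hk' 1 h1, this]

theorem transport_unique (hA : A ∈ tangent (γ 0))
    (hγ : ∀ t ∈ Icc (0 : ℝ) 1, (γ t).1 = rot A t * (γ 0).1) {U U' : L (γ 0) →ₗ[ℂ] L (γ 1)}
    (hU : S.IsTransport γ U) (hU' : S.IsTransport γ U') : U = U' := by
  ext1 s₀
  obtain ⟨s, hs, h2, h3⟩ := hU s₀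
  rw [← h3, F.isParallel_eq_transport hA hγ hU' hs, h2]

theorem transport_e (hA : A ∈ tangent (γ 0))
    (hγ : ∀ t ∈ Icc (0 : ℝ) 1, (γ t).1 = rot A t * (γ 0).1) {U : L (γ 0) →ₗ[ℂ] L (γ 1)}
    (hU : S.IsTransport γ U) : U (F.e 0) = F.e 1 := by
  refine (F.isParallel_eq_transport hA hγ hU ⟨F.continuousOn, fun t ht => ?_⟩).symm
  obtain ⟨μ', h1, h2⟩ := hasVecDerivWithinAt_extMap_rot hA (hγ t ht)
    (S.mul_mem (F.e 0) (F.e 0)) ht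
  exact ⟨μ', h1.congr F.mul_e ht, h2⟩

theorem pairK_e_left (hA : A ∈ tangent (γ 0)) (E : Eigenbasis (γ 0) A) {t : ℝ}
    (ht : t ∈ Icc (0 : ℝ) 1) : pairK o (S.mul (F.e t) (F.e t)) (S.mul (F.e 0) (F.e 0)) =
      E.cosProd t * F.p := by
  rw [F.mul_e t ht, pairK_extMap_rot_left hA E t (S.mul_mem _ _) (S.mul_mem _ _), F.pair_e]

theorem sqrt_cosProd_sq (E : Eigenbasis (γ 0) A) (hθ : ∀ k, E.θ k < Real.pi) {t : ℝ}
    (ht : t ∈ Icc (0 : ℝ) 1) :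
    ((√(E.cosProd t) * √F.p : ℝ) : ℂ) ^ 2 = E.cosProd t * F.p := by
  rw [← Complex.ofReal_pow, mul_pow, Real.sq_sqrt (E.cosProd_pos hθ ht).le,
    Real.sq_sqrt F.p_pos.le, Complex.ofReal_mul]

theorem continuousOn_sqrt_cosProd (E : Eigenbasis (γ 0) A) (hθ : ∀ k, E.θ k < Real.pi) :
    ContinuousOn (fun t => ((√(E.cosProd t) * √F.p : ℝ) : ℂ)) (Icc 0 1) := fun _ ht =>
  (Complex.continuous_ofReal.continuousAt.comp
    ((E.hasDerivAt_cosProd hθ ht).continuousAt.sqrt.mul continuousAt_const)).continuousWithinAt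

/-- On frame vectors the pairing is the positive number `√(cosProd t) √p`, a continuous square root
of the pairing of their squares. -/
theorem exists_isPairing (hA : A ∈ tangent (γ 0)) (E : Eigenbasis (γ 0) A)
    (hθ : ∀ k, E.θ k < Real.pi) : ∃ h, S.IsPairing γ h := by
  have hsk := (mem_tangent_iff.mp hA).2
  have h0 : (0 : ℝ) ∈ Icc (0 : ℝ) 1 := ⟨le_rfl, zero_le_one⟩
  choose φ hφ using fun t => exists_coord (F.e t)
  let h : ∀ t : ℝ, L (γ t) →ₗ⋆[ℂ] L (γ 0) →ₗ[ℂ] ℂ := fun t =>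
    LinearMap.mk₂'ₛₗ (starRingEnd ℂ) (RingHom.id ℂ)
      (fun s' s => starRingEnd ℂ (φ t s') * φ 0 s * ((√(E.cosProd t) * √F.p : ℝ) : ℂ))
      (fun x y z => by rw [map_add, map_add]; ring)
      (fun c x y => by rw [map_smul, smul_eq_mul, map_mul, smul_eq_mul]; ring)
      (fun x y z => by rw [map_add]; ring)
      (fun c x y => by rw [map_smul, smul_eq_mul, smul_eq_mul, RingHom.id_apply]; ring)
  have hh : ∀ t s' s, h t s' s =
      starRingEnd ℂ (φ t s') * φ 0 s * ((√(E.cosProd t) * √F.p : ℝ) : ℂ) := fun _ _ _ => rfl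
  refine ⟨h, fun s' s => ?_, fun t ht s' s => ?_, fun s hs s₀ => ?_⟩
  · have h1 := F.inner_e hsk h0 (φ 0 s') (φ 0 s)
    rw [← hφ 0 (F.e_ne_zero hsk h0), ← hφ 0 (F.e_ne_zero hsk h0)] at h1
    rw [h1, hh, E.cosProd_zero, Real.sqrt_one, one_mul]
  · have e1 : S.mul s' s' = (φ t s' * φ t s') • S.mul (F.e t) (F.e t) := by
      rw [← S.mul_smul_smul, ← hφ t (F.e_ne_zero hsk ht)]
    have e2 : S.mul s s = (φ 0 s * φ 0 s) • S.mul (F.e 0) (F.e 0) := by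
      rw [← S.mul_smul_smul, ← hφ 0 (F.e_ne_zero hsk h0)]
    rw [hh, mul_pow, F.sqrt_cosProd_sq E hθ ht, e1, e2, pairK_smul_left, pairK_smul_right,
      F.pairK_e_left hA E ht, map_mul]
    ring
  · have hc := continuousOn_ratio F.continuousOn hs (fun t ht => F.e_ne_zero hsk ht)
      fun t ht => hφ t (F.e_ne_zero hsk ht) (s t)
    simp only [hh]
    exact ((Complex.continuous_conj.comp_continuousOn hc).mul continuousOn_const).mul
      (F.continuousOn_sqrt_cosProd E hθ)

/-- Two continuous functions on an interval with equal squares, one of them nowhere zero, agree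
everywhere once they agree at `0`. -/
theorem isPairing_e (hA : A ∈ tangent (γ 0)) (E : Eigenbasis (γ 0) A)
    (hθ : ∀ k, E.θ k < Real.pi) {h : ∀ t : ℝ, L (γ t) →ₗ⋆[ℂ] L (γ 0) →ₗ[ℂ] ℂ}
    (hh : S.IsPairing γ h) {t : ℝ} (ht : t ∈ Icc (0 : ℝ) 1) :
    h t (F.e t) (F.e 0) = ((√(E.cosProd t) * √F.p : ℝ) : ℂ) := by
  have hsk := (mem_tangent_iff.mp hA).2
  have h0 : (0 : ℝ) ∈ Icc (0 : ℝ) 1 := ⟨le_rfl, zero_le_one⟩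
  refine isPreconnected_Icc.eq_of_sq_eq (hh.2.2 F.e F.continuousOn (F.e 0))
    (F.continuousOn_sqrt_cosProd E hθ) (fun t ht => ?_) (fun ht => ?_) h0 ?_ ht
  · change h t (F.e t) (F.e 0) ^ 2 = ((√(E.cosProd t) * √F.p : ℝ) : ℂ) ^ 2
    rw [hh.2.1 t ht, F.pairK_e_left hA E ht, F.sqrt_cosProd_sq E hθ ht]
  · exact Complex.ofReal_ne_zero.mpr (mul_pos (Real.sqrt_pos.mpr (E.cosProd_pos hθ ht))
      (Real.sqrt_pos.mpr F.p_pos)).ne'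
  · have h1 := F.inner_e hsk h0 1 1
    rw [one_smul] at h1
    rw [hh.1, h1, E.cosProd_zero]
    simp

theorem isPairing_smul_e (hA : A ∈ tangent (γ 0)) (E : Eigenbasis (γ 0) A)
    (hθ : ∀ k, E.θ k < Real.pi) {h : ∀ t : ℝ, L (γ t) →ₗ⋆[ℂ] L (γ 0) →ₗ[ℂ] ℂ}
    (hh : S.IsPairing γ h) {t : ℝ} (ht : t ∈ Icc (0 : ℝ) 1) (a c : ℂ) :
    h t (a • F.e t) (c • F.e 0) =
      (√(E.cosProd t) : ℝ) * (starRingEnd ℂ a * c * (√F.p : ℝ)) := by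
  rw [LinearMap.map_smulₛₗ, LinearMap.map_smulₛₗ, LinearMap.smul_apply, RingHom.id_apply,
    F.isPairing_e hA E hθ hh ht, smul_eq_mul, smul_eq_mul]
  push_cast
  ring

theorem isPairing_unique (hA : A ∈ tangent (γ 0)) (E : Eigenbasis (γ 0) A)
    (hθ : ∀ k, E.θ k < Real.pi) {h h' : ∀ t : ℝ, L (γ t) →ₗ⋆[ℂ] L (γ 0) →ₗ[ℂ] ℂ}
    (hh : S.IsPairing γ h) (hh' : S.IsPairing γ h') {t : ℝ} (ht : t ∈ Icc (0 : ℝ) 1) :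
    h t = h' t := by
  have hsk := (mem_tangent_iff.mp hA).2
  have h0 : (0 : ℝ) ∈ Icc (0 : ℝ) 1 := ⟨le_rfl, zero_le_one⟩
  ext s' s
  obtain ⟨a, rfl⟩ := exists_smul_of_line (F.e_ne_zero hsk ht) s'
  obtain ⟨c, rfl⟩ := exists_smul_of_line (F.e_ne_zero hsk h0) s
  rw [F.isPairing_smul_e hA E hθ hh ht, F.isPairing_smul_e hA E hθ hh' ht]

/-- The parallel transport in the line bundle of half-forms and the pairing. -/
theorem isPairing_transport (hA : A ∈ tangent (γ 0))
    (hγ : ∀ t ∈ Icc (0 : ℝ) 1, (γ t).1 = rot A t * (γ 0).1) (E : Eigenbasis (γ 0) A)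
    (hθ : ∀ k, E.θ k < Real.pi) {h : ∀ t : ℝ, L (γ t) →ₗ⋆[ℂ] L (γ 0) →ₗ[ℂ] ℂ}
    (hh : S.IsPairing γ h) {U : L (γ 0) →ₗ[ℂ] L (γ 1)} (hU : S.IsTransport γ U)
    (s' s : L (γ 0)) :
    h 1 (U s') s = (√(E.cosProd 1) : ℝ) * S.inner s' s ∧
      S.inner (U s') (U s) = S.inner s' s ∧ ∀ u, ∃ s, U s = u := by
  have hsk := (mem_tangent_iff.mp hA).2
  have h0 : (0 : ℝ) ∈ Icc (0 : ℝ) 1 := ⟨le_rfl, zero_le_one⟩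
  have h1 : (1 : ℝ) ∈ Icc (0 : ℝ) 1 := ⟨zero_le_one, le_rfl⟩
  have hUe := F.transport_e hA hγ hU
  obtain ⟨a, rfl⟩ := exists_smul_of_line (F.e_ne_zero hsk h0) s'
  obtain ⟨c, rfl⟩ := exists_smul_of_line (F.e_ne_zero hsk h0) s
  rw [U.map_smul, U.map_smul, hUe, F.isPairing_smul_e hA E hθ hh h1, F.inner_e hsk h0,
    F.inner_e hsk h1]
  refine ⟨rfl, rfl, fun u => ?_⟩
  obtain ⟨d, rfl⟩ := exists_smul_of_line (F.e_ne_zero hsk h1) u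
  exact ⟨d • F.e 0, by rw [map_smul, hUe]⟩

/-- The inner product of the line at the end point is sesquilinear. -/
theorem exists_innerL (hA : IsSkew A) : ∃ k : L (γ 1) →ₗ⋆[ℂ] L (γ 1) →ₗ[ℂ] ℂ,
    ∀ s' s, k s' s = S.inner s' s := by
  have h1 : (1 : ℝ) ∈ Icc (0 : ℝ) 1 := ⟨zero_le_one, le_rfl⟩
  obtain ⟨φ, hφ⟩ := exists_coord (F.e 1)
  replace hφ := hφ (F.e_ne_zero hA h1)
  refine ⟨LinearMap.mk₂'ₛₗ (starRingEnd ℂ) (RingHom.id ℂ)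
      (fun s' s => starRingEnd ℂ (φ s') * φ s * (√F.p : ℝ))
      (fun x y z => by rw [map_add, map_add]; ring)
      (fun c x y => by rw [map_smul, smul_eq_mul, map_mul, smul_eq_mul]; ring)
      (fun x y z => by rw [map_add]; ring)
      (fun c x y => by rw [map_smul, smul_eq_mul, smul_eq_mul, RingHom.id_apply]; ring),
    fun s' s => ?_⟩
  have h2 := F.inner_e hA h1 (φ s') (φ s)
  rw [← hφ, ← hφ] at h2
  exact h2.symm

end HalfFormFrame

end HalfFormTransport

/-! ### The metaplectically corrected bundle and its product pairing -/

section Corrected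

open Bundle

variable {V : Type*} [NormedAddCommGroup V] [InnerProductSpace ℝ V] [FiniteDimensional ℝ V]
  {n : ℕ} [Fact (finrank ℝ V = 2 * n)] {o : Orientation ℝ V (Fin (2 * n))}
  {L : Jg o → Type*} [∀ J, AddCommGroup (L J)] [∀ J, Module ℂ (L J)]

theorem IsProductPairing.unique {J' J : Jg o} {k : L J' → L J → ℂ}
    {F F' : (HJ J' ⊗[ℂ] L J') →ₗ⋆[ℂ] (HJ J ⊗[ℂ] L J) →ₗ[ℂ] ℂ}
    (h : IsProductPairing k F) (h' : IsProductPairing k F') : F = F' := by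
  refine LinearMap.ext fun Ψ' => LinearMap.ext fun Ψ => ?_
  induction Ψ' using TensorProduct.induction_on with
  | zero => simp
  | add x y hx hy => rw [map_add, map_add, LinearMap.add_apply, LinearMap.add_apply, hx, hy]
  | tmul ψ' s' =>
    induction Ψ using TensorProduct.induction_on with
    | zero => simp
    | add x y hx hy => rw [map_add, map_add, hx, hy]
    | tmul ψ s => rw [h, h']

theorem exists_isProductPairing {J' J : Jg o} (k : L J' →ₗ⋆[ℂ] L J →ₗ[ℂ] ℂ) :
    ∃ F : (HJ J' ⊗[ℂ] L J') →ₗ⋆[ℂ] (HJ J ⊗[ℂ] L J) →ₗ[ℂ] ℂ,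
      IsProductPairing (fun s' s => k s' s) F := by
  let a : HJ J' →ₗ⋆[ℂ] HJ J →ₗ[ℂ] ℂ := (hermL o).domRestrict₁₂ (HJ J') (HJ J)
  let B : HJ J' →ₗ⋆[ℂ] L J' →ₗ⋆[ℂ] (HJ J ⊗[ℂ] L J) →ₗ[ℂ] ℂ :=
    LinearMap.mk₂'ₛₗ (starRingEnd ℂ) (starRingEnd ℂ)
      (fun ψ' s' => LinearMap.mul' ℂ ℂ ∘ₗ TensorProduct.map (a ψ') (k s'))
      (fun x y z => by rw [map_add, TensorProduct.map_add_left, LinearMap.comp_add])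
      (fun c x y => by rw [LinearMap.map_smulₛₗ, TensorProduct.map_smul_left, LinearMap.comp_smul])
      (fun x y z => by rw [map_add, TensorProduct.map_add_right, LinearMap.comp_add])
      (fun c x y => by rw [LinearMap.map_smulₛₗ, TensorProduct.map_smul_right, LinearMap.comp_smul])
  refine ⟨TensorProduct.lift B, fun ψ' s' ψ s => ?_⟩
  rw [TensorProduct.lift.tmul]
  rfl

variable [∀ J, TopologicalSpace (L J)] [TopologicalSpace (TotalSpace ℂ L)]
  [FiberBundle ℂ L] [VectorBundle ℂ ℂ L] {S : SquareRoot L} {γ : ℝ → Jg o} {A : V →L[ℝ] V}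

theorem exists_tmul {J : Jg o} {s : L J} (hs : s ≠ 0) (Ψ : HJ J ⊗[ℂ] L J) :
    ∃ ψ : HJ J, Ψ = ψ ⊗ₜ[ℂ] s := by
  induction Ψ using TensorProduct.induction_on with
  | zero => exact ⟨0, by simp⟩
  | add x y hx hy =>
    obtain ⟨ψ, rfl⟩ := hx
    obtain ⟨φ, rfl⟩ := hy
    exact ⟨ψ + φ, by rw [TensorProduct.add_tmul]⟩
  | tmul ψ s' =>
    obtain ⟨c, rfl⟩ := exists_smul_of_line hs s'
    exact ⟨c • ψ, by rw [TensorProduct.smul_tmul]⟩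

theorem isTransportHat_map {UH : HJ (γ 0) →ₗ[ℂ] HJ (γ 1)} {UL : L (γ 0) →ₗ[ℂ] L (γ 1)}
    (hUH : IsTransportH γ UH) (hUL : S.IsTransport γ UL) :
    S.IsTransportHat γ (TensorProduct.map UH UL) := by
  intro Ψ₀
  obtain ⟨s₀, hs₀⟩ := exists_ne_zero_line (L := L) (γ 0)
  obtain ⟨ψ₀, rfl⟩ := exists_tmul hs₀ Ψ₀
  obtain ⟨ψ, h1, h2, h3⟩ := hUH ψ₀
  obtain ⟨s, h4, h5, h6⟩ := hUL s₀
  refine ⟨fun t => ψ t ⊗ₜ[ℂ] s t, ⟨1, fun _ => ψ, fun _ => s, fun _ => h1, fun _ => h4,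
    fun t _ => by simp⟩, ?_, ?_⟩
  · simp only [h2, h5]
  · simp only [h3, h6, TensorProduct.map_tmul]

/-- A parallel section is a sum of products of parallel sections, and each factor is determined by
its value at `0`. -/
theorem isTransportHat_unique (F : HalfFormFrame S γ A) (hA : A ∈ tangent (γ 0))
    (hγ : ∀ t ∈ Icc (0 : ℝ) 1, (γ t).1 = rot A t * (γ 0).1)
    {UH : HJ (γ 0) →ₗ[ℂ] HJ (γ 1)} {UL : L (γ 0) →ₗ[ℂ] L (γ 1)}
    (hUH : IsTransportH γ UH) (hUL : S.IsTransport γ UL)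
    {U : (HJ (γ 0) ⊗[ℂ] L (γ 0)) →ₗ[ℂ] (HJ (γ 1) ⊗[ℂ] L (γ 1))} (hU : S.IsTransportHat γ U) :
    U = TensorProduct.map UH UL := by
  have h0 : (0 : ℝ) ∈ Icc (0 : ℝ) 1 := ⟨le_rfl, zero_le_one⟩
  have h1 : (1 : ℝ) ∈ Icc (0 : ℝ) 1 := ⟨zero_le_one, le_rfl⟩
  refine LinearMap.ext fun Ψ₀ => ?_
  obtain ⟨Ψ, ⟨m, ψ, s, hψ, hs, hΨ⟩, h2, h3⟩ := hU Ψ₀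
  rw [← h3, ← h2, hΨ 1 h1, hΨ 0 h0, map_sum]
  refine Finset.sum_congr rfl fun k _ => ?_
  obtain ⟨φ, hφ, e1, e2⟩ := hUH (ψ k 0)
  rw [TensorProduct.map_tmul, ← F.isParallel_eq_transport hA hγ hUL (hs k), ← e2,
    sub_isParallelH hφ (hψ k) e1 1 h1]

set_option maxHeartbeats 2000000 in
/-- A product pairing that differs by scalars from the inner products of the transported
vectors is the inner product with the transported vector, up to a scalar. -/
theorem productPairing_transport {J J₁ : Jg o} {U : HJ J →ₗ[ℂ] HJ J₁} {T : L J →ₗ[ℂ] L J₁} {r : ℝ}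
    (hP : IsOrthProj ((r : ℂ) • U)) {k : L J₁ →ₗ⋆[ℂ] L J →ₗ[ℂ] ℂ}
    (hk : ∀ s' s, k (T s') s = r * S.inner s' s) (hT : ∀ s' s, S.inner (T s') (T s) = S.inner s' s)
    (hs : ∀ u, ∃ s, T s = u) {F : (HJ J₁ ⊗[ℂ] L J₁) →ₗ⋆[ℂ] (HJ J ⊗[ℂ] L J) →ₗ[ℂ] ℂ}
    {G : (HJ J₁ ⊗[ℂ] L J₁) →ₗ⋆[ℂ] (HJ J₁ ⊗[ℂ] L J₁) →ₗ[ℂ] ℂ}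
    (hF : IsProductPairing (fun s' s => k s' s) F) (hG : IsProductPairing S.inner G) :
    (∀ Ψ₁ Ψ₀, F Ψ₁ Ψ₀ = ((r * r : ℝ) : ℂ) * G Ψ₁ (TensorProduct.map U T Ψ₀)) ∧
      ∀ (ψ' ψ : HJ J) (s' s : L J), F (TensorProduct.map U T (ψ' ⊗ₜ[ℂ] s')) (ψ ⊗ₜ[ℂ] s) =
        herm₀ o (((r : ℂ) • U) ψ' : H₀ V) (ψ : H₀ V) * S.inner s' s := by
  have hF' : ∀ (ψ' : HJ J₁) (s' : L J₁) (ψ : HJ J) (s : L J), F (ψ' ⊗ₜ[ℂ] s') (ψ ⊗ₜ[ℂ] s) =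
    herm₀ o (ψ' : H₀ V) (ψ : H₀ V) * k s' s := hF
  refine ⟨fun Ψ₁ Ψ₀ => ?_, fun ψ' ψ s' s => ?_⟩
  · induction Ψ₁ using TensorProduct.induction_on with
    | zero => simp
    | add x y hx hy =>
      rw [map_add, map_add, LinearMap.add_apply, LinearMap.add_apply, hx, hy, mul_add]
    | tmul ψ₁ s₁ =>
      induction Ψ₀ using TensorProduct.induction_on with
      | zero => simp
      | add x y hx hy => rw [map_add, map_add, map_add, hx, hy, mul_add]
      | tmul ψ₀ s₀ =>
        -- Writing `s₁ = T s'` produces one factor `r` from the half-form pairing; the projection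
        -- property produces the other.
        obtain ⟨s', rfl⟩ := hs s₁
        have e1 : hermL o (ψ₁ : H₀ V) ((ψ₀ : H₀ V) - (r : ℂ) • (U ψ₀ : H₀ V)) = 0 := hP ψ₀ ψ₁
        rw [map_sub, map_smul, sub_eq_zero, smul_eq_mul] at e1
        have e2 : herm₀ o (ψ₁ : H₀ V) (ψ₀ : H₀ V) =
            (r : ℂ) * herm₀ o (ψ₁ : H₀ V) (U ψ₀ : H₀ V) := e1
        rw [hF', TensorProduct.map_tmul, hG, hk, e2, hT]
        push_cast
        ring
  · have e1 : hermL o ((r : ℂ) • (U ψ' : H₀ V)) (ψ : H₀ V) =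
        (r : ℂ) * hermL o (U ψ' : H₀ V) (ψ : H₀ V) := by
      rw [LinearMap.map_smulₛₗ, LinearMap.smul_apply, Complex.conj_ofReal, smul_eq_mul]
    have e2 : herm₀ o (((r : ℂ) • U) ψ' : H₀ V) (ψ : H₀ V) =
        (r : ℂ) * herm₀ o (U ψ' : H₀ V) (ψ : H₀ V) := e1
    rw [TensorProduct.map_tmul, hF', hk, e2]
    ring

end Corrected

end FermionQuant

end

/-! ### Assembly of the theorem -/

set_option maxHeartbeats 2000000 in
theorem mainTheorem2
    {V : Type*} [NormedAddCommGroup V] [InnerProductSpace ℝ V] [FiniteDimensional ℝ V]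
    {n : ℕ} [Fact (Module.finrank ℝ V = 2 * n)] (o : Orientation ℝ V (Fin (2 * n)))
    (L : Jg o → Type*) [∀ J, AddCommGroup (L J)] [∀ J, Module ℂ (L J)]
    [∀ J, TopologicalSpace (L J)] [TopologicalSpace (Bundle.TotalSpace ℂ L)]
    [FiberBundle ℂ L] [VectorBundle ℂ ℂ L] (S : SquareRoot L)
    (γ : ℝ → Jg o) (hγ : IsGeodesicOn γ (Icc 0 1))
    (hcut : ∀ t ∈ Icc (0 : ℝ) 1, γ t ∉ cutLocus (γ 0)) :
    0 < detMean (γ 0) (γ 1) ∧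
    (∃! P : HJ (γ 0) →ₗ[ℂ] HJ (γ 1), IsOrthProj P) ∧
    (∃! U : HJ (γ 0) →ₗ[ℂ] HJ (γ 1), IsTransportH γ U) ∧
    (∃! U : L (γ 0) →ₗ[ℂ] L (γ 1), S.IsTransport γ U) ∧
    (∃! U : (HJ (γ 0) ⊗[ℂ] L (γ 0)) →ₗ[ℂ] (HJ (γ 1) ⊗[ℂ] L (γ 1)), S.IsTransportHat γ U) ∧
    (∃ h, S.IsPairing γ h) ∧
    (∀ h h', S.IsPairing γ h → S.IsPairing γ h' → ∀ t ∈ Icc (0 : ℝ) 1, h t = h' t) ∧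
    ∀ (P UH : HJ (γ 0) →ₗ[ℂ] HJ (γ 1)) (UL : L (γ 0) →ₗ[ℂ] L (γ 1))
      (UHat : (HJ (γ 0) ⊗[ℂ] L (γ 0)) →ₗ[ℂ] (HJ (γ 1) ⊗[ℂ] L (γ 1)))
      (h : ∀ t : ℝ, L (γ t) →ₗ⋆[ℂ] L (γ 0) →ₗ[ℂ] ℂ),
      IsOrthProj P → IsTransportH γ UH → S.IsTransport γ UL → S.IsTransportHat γ UHat →
      S.IsPairing γ h →
      -- part 1
      (UH = ((detMean (γ 0) (γ 1) ^ (-(1 / 4) : ℝ) : ℝ) : ℂ) • P ∧ IsBogoliubov UH) ∧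
      -- part 2
      (S.IsSqrtDet γ UL ∧
        ∀ s' s : L (γ 0),
          h 1 (UL s') s = ((detMean (γ 0) (γ 1) ^ (1 / 4 : ℝ) : ℝ) : ℂ) * S.inner s' s) ∧
      -- part 3
      (UHat = TensorProduct.map UH UL ∧
        (∃! F : (HJ (γ 1) ⊗[ℂ] L (γ 1)) →ₗ⋆[ℂ] (HJ (γ 0) ⊗[ℂ] L (γ 0)) →ₗ[ℂ] ℂ,
          IsProductPairing (fun s' s => h 1 s' s) F) ∧
        (∃! G : (HJ (γ 1) ⊗[ℂ] L (γ 1)) →ₗ⋆[ℂ] (HJ (γ 1) ⊗[ℂ] L (γ 1)) →ₗ[ℂ] ℂ,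
          IsProductPairing S.inner G) ∧
        ∀ F G, IsProductPairing (fun s' s => h 1 s' s) F → IsProductPairing S.inner G →
          (∀ Ψ₁ Ψ₀, F Ψ₁ Ψ₀ =
            ((detMean (γ 0) (γ 1) ^ (1 / 2 : ℝ) : ℝ) : ℂ) * G Ψ₁ (UHat Ψ₀)) ∧
          ∀ (ψ' ψ : HJ (γ 0)) (s' s : L (γ 0)),
            F (UHat (ψ' ⊗ₜ[ℂ] s')) (ψ ⊗ₜ[ℂ] s) =
              herm₀ o (P ψ' : H₀ V) (ψ : H₀ V) * S.inner s' s) := by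
  have h1 : (1 : ℝ) ∈ Icc (0 : ℝ) 1 := ⟨zero_le_one, le_rfl⟩
  obtain ⟨A, hA, hrot⟩ := exists_rot_of_isGeodesicOn hγ
  have hsk := (mem_tangent_iff.mp hA).2
  obtain ⟨E⟩ := nonempty_eigenbasis (γ 0) hA
  have hθ := E.θ_lt_pi hA hrot hcut
  have hf := E.cosProd_pos hθ h1
  have hD : detMean (γ 0) (γ 1) = E.cosProd 1 ^ 2 := E.detMean_eq hA (hrot 1 h1)
  obtain ⟨F₀⟩ := exists_halfFormFrame S hA hrot
  obtain ⟨U₀, hU₀, hB₀, hr₀⟩ := exists_transportH hA hrot E hθ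
  have hP₀ := isOrthProj_of_unitary hB₀ hr₀
  obtain ⟨T₀, hT₀, hsq₀⟩ := F₀.exists_transport hA hrot
  -- As `D` is the square of a positive product of cosines, its fourth root is the scalar found both
  -- in `H` and in the line of half-forms.
  have hD4 : detMean (γ 0) (γ 1) ^ (1 / 4 : ℝ) = √(E.cosProd 1) := by
    rw [hD, ← Real.rpow_natCast, ← Real.rpow_mul hf.le, Real.sqrt_eq_rpow]
    norm_num
  have hD4' : detMean (γ 0) (γ 1) ^ (-(1 / 4) : ℝ) = (√(E.cosProd 1))⁻¹ := by
    rw [Real.rpow_neg (by rw [hD]; positivity), hD4]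
  have hD2 : detMean (γ 0) (γ 1) ^ (1 / 2 : ℝ) = √(E.cosProd 1) * √(E.cosProd 1) := by
    rw [hD, ← Real.sqrt_eq_rpow, Real.sqrt_sq hf.le, Real.mul_self_sqrt hf.le]
  have hr : ((√(E.cosProd 1) : ℝ) : ℂ) ≠ 0 :=
    Complex.ofReal_ne_zero.mpr (Real.sqrt_pos.mpr hf).ne'
  refine ⟨by rw [hD]; positivity, ⟨_, hP₀, fun P hP => hP.unique hP₀⟩,
    ⟨U₀, hU₀, fun U hU => hU.unique hU₀⟩,
    ⟨T₀, hT₀, fun U hU => F₀.transport_unique hA hrot hU hT₀⟩,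
    ⟨_, isTransportHat_map hU₀ hT₀, fun U hU => isTransportHat_unique F₀ hA hrot hU₀ hT₀ hU⟩,
    F₀.exists_isPairing hA E hθ,
    fun h h' hh hh' t ht => F₀.isPairing_unique hA E hθ hh hh' ht, ?_⟩
  intro P UH UL UHat h hP hUH hUL hUHat hh
  -- By uniqueness the given maps are the constructed ones, for which all the identities are known.
  obtain rfl := hP.unique hP₀
  obtain rfl := hUH.unique hU₀
  obtain rfl := F₀.transport_unique hA hrot hUL hT₀
  obtain rfl := isTransportHat_unique F₀ hA hrot hUH hUL hUHat
  have hpair := F₀.isPairing_transport hA hrot E hθ hh hUL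
  obtain ⟨k, hk⟩ := F₀.exists_innerL hsk
  have hk' : (fun s' s => k s' s) = S.inner (J := γ 1) := funext fun s' => funext fun s => hk s' s
  refine ⟨⟨?_, hB₀⟩, ⟨hsq₀, fun s' s => ?_⟩, rfl, ?_, ?_, fun F G hF hG => ?_⟩
  · rw [hD4', Complex.ofReal_inv, inv_smul_smul₀ hr]
  · rw [hD4, (hpair s' s).1]
  · obtain ⟨F, hF⟩ := exists_isProductPairing (h 1)
    exact ⟨F, hF, fun F' hF' => hF'.unique hF⟩
  · obtain ⟨G, hG⟩ := exists_isProductPairing k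
    rw [hk'] at hG
    exact ⟨G, hG, fun G' hG' => hG'.unique hG⟩
  · rw [hD2]
    exact productPairing_transport hP (fun s' s => (hpair s' s).1) (fun s' s => (hpair s' s).2.1)
      (hpair 0 0).2.2 hF hG
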